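/- Let $M$ be a connected smooth manifold (of finite dimension, Hausdorff, second countable, without boundary) and let $R=C^\infty(M)$ be its ring of smooth real-valued functions. **Octonion algebras.** An octonion algebra over $R$ is a unital, not necessarily associative $R$-algebra $C$, finitely generated projective of constant rank $8$ as an $R$-module, with unit $e$, multiplication $m$, and a quadratic form $q\colon C\to R$ such that $q(xy)=q(x)q(y)$ for all $x,y\in C$ and such that the bilinear form $b(x,y)=q(x+y)-q(x)-q(y)$ induces an isomorphism $C\to C^\vee$, $x\mapsto b(x,-)$. It is globally non-split if for every maximal ideal $\mathfrak m$ of $R$ the octonion algebra $C\otimes_R\kappa(\mathfrak m)$ over the residue field $\kappa(\mathfrak m)$ is non-split, i.e. has no zero divisors. Let $\mathrm{octalg}^+_{R}$ be the category of globally non-split octonion algebras over $R$, whose morphisms $C\to C'$ are the $R$-linear isomorphisms that carry $m,e,b$ to $m',e',b'$. Write $C\ominus eR=\{x\in C: b(e,x)=0\}$. **Formal $G_2$-structures.** Let $\varphi_0=e^{123}+e^{145}+e^{167}+e^{246}-e^{257}-e^{347}-e^{356}$ on $\mathbb R^7$, where $e^{ijk}=e^i\wedge e^j\wedge e^k$,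 and let $G_2\subset \mathrm{GL}_7(\mathbb R)$ be its stabilizer. A formal $G_2$-structure on $M$ is a smooth real vector bundle $E\to M$ of rank $7$ together with a $G_2$-reduction $P\subset F(E)$ of its frame bundle (a smooth principal $G_2$-subbundle). A morphism $(E,P)\to(E',P')$ is an isomorphism $\mathsf f\colon E\to E'$ of smooth vector bundles over $\mathrm{id}_M$ with $P'=\mathsf f P=\{\mathsf f\circ u: u\in P\}$. Let $\mathrm{fG2str}(M)$ be the resulting category. **Theorem.** There is an equivalence of categories $$\mathrm{octalg}^+_{C^\infty(M)}\longrightarrow \mathrm{fG2str}(M)$$ which sends $C$ to the $G_2$-structure given by the $3$-form $$\varphi_C=\tfrac12\, b(m(-\otimes-)\otimes-)\quad\text{on } C\ominus eR,$$ and a morphism $f\colon C\to C'$ to its restriction $f|\colon C\ominus eR\to C'\ominus e'R$. Here modules of sections are identified with vector bundles. Precisely: there are an equivalence of categories $\Phi\colon\mathrm{octalg}^+_{C^\infty(M)}\to\mathrm{fG2str}(M)$, $\Phi(C)=(E_C,P_C)$, and, for every $C$, an isomorphism of $R$-modules $\theta_C\colon C\ominus eR\to\Gamma(E_C)$ such that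 1. for every $C$, $P_C$ is the set of all frames $u\colon\mathbb R^7\to (E_C)_p$, $p\in M$, with $u^*((\varphi_C)_p)=\varphi_0$, where $\varphi_C$ is regarded as a $3$-form on $E_C$ through $\theta_C$, i.e. $(\varphi_C)_p(r(p),s(p),t(p))=\varphi_C(\theta_C^{-1}r,\theta_C^{-1}s,\theta_C^{-1}t)(p)$ for $r,s,t\in\Gamma(E_C)$; 2. for every morphism $f\colon C\to C'$, $\Gamma(\Phi(f))\circ\theta_C=\theta_{C'}\circ f|_{C\ominus eR}$. -/

import Mathlib

open CategoryTheory Bundle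
open scoped Manifold ContDiff TensorProduct

universe u v

noncomputable section

/-! ### Octonion algebras over a commutative ring -/

/-- An octonion algebra over `R`: a unital, not necessarily associative `R`-algebra, finitely
generated projective of constant rank `8` as an `R`-module, with a multiplicative quadratic form
whose polar form `b (x, y) = q (x + y) - q x - q y` induces an isomorphism onto the dual. -/
structure OctonionAlgebra (R : Type u) [CommRing R] where
  carrier : Type v
  [ring : NonAssocRing carrier]
  [module : Module R carrier]
  [isScalarTower : IsScalarTower R carrier carrier]
  [smulCommClass : SMulCommClass R carrier carrier]
  [finite : Module.Finite R carrier]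
  [projective : Module.Projective R carrier]
  rank_eq : ∀ p : PrimeSpectrum R, Module.rankAtStalk (R := R) carrier p = 8
  norm : QuadraticForm R carrier
  nondegenerate : Function.Bijective
    (QuadraticMap.polarBilin norm : carrier → Module.Dual R carrier)
  norm_mul : ∀ x y : carrier, norm (x * y) = norm x * norm y

namespace OctonionAlgebra

attribute [instance] ring module isScalarTower smulCommClass finite projective

variable {R : Type u} [CommRing R]

/-- The symmetric bilinear form `b` of an octonion algebra. -/
def bilin (C : OctonionAlgebra.{u, v} R) : LinearMap.BilinForm R C.carrier :=
  QuadraticMap.polarBilin C.norm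

/-- Morphisms of octonion algebras: linear isomorphisms that carry the multiplication, the unit
and the bilinear form of the source to those of the target. -/
@[ext]
structure Hom (C D : OctonionAlgebra.{u, v} R) where
  toEquiv : C.carrier ≃ₗ[R] D.carrier
  map_mul : ∀ x y, toEquiv (x * y) = toEquiv x * toEquiv y
  map_one : toEquiv 1 = 1
  map_bilin : ∀ x y, D.bilin (toEquiv x) (toEquiv y) = C.bilin x y

/-- The category of octonion algebras over `R`. -/
instance : Category (OctonionAlgebra.{u, v} R) where
  Hom := Hom
  id C := ⟨LinearEquiv.refl R C.carrier, fun _ _ => rfl, rfl, fun _ _ => rfl⟩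
  comp f g := ⟨f.toEquiv.trans g.toEquiv,
    fun x y => by simp [f.map_mul, g.map_mul],
    by simp [f.map_one, g.map_one],
    fun x y => by simp [f.map_bilin, g.map_bilin]⟩

/-- `C` is non-split at the prime `p` if the octonion algebra `κ(p) ⊗ C` over the residue field
`κ(p)` is non-split, i.e. has no zero divisors. -/
def IsNonsplitAt (C : OctonionAlgebra.{u, v} R) (p : Ideal R) [p.IsPrime] : Prop :=
  NoZeroDivisors (p.ResidueField ⊗[R] C.carrier)

/-- `C` is globally non-split if it is non-split at every maximal ideal. -/
def IsGloballyNonsplit : ObjectProperty (OctonionAlgebra.{u, v} R) := fun C =>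
  ∀ (m : Ideal R) [m.IsMaximal], C.IsNonsplitAt m

/-- The orthogonal complement `C ⊖ eR` of the unit. -/
def imag (C : OctonionAlgebra.{u, v} R) : Submodule R C.carrier :=
  LinearMap.ker (C.bilin 1)

/-- The restriction of a morphism to the orthogonal complements of the units. -/
def Hom.imag {C D : OctonionAlgebra.{u, v} R} (f : Hom C D) : C.imag →ₗ[R] D.imag :=
  f.toEquiv.toLinearMap.restrict fun x hx => by
    have h := f.map_bilin 1 x
    rw [f.map_one] at h
    exact h.trans hx

/-- The form `φ_C (x, y, z) = ½ b (x y, z)` on the orthogonal complement of the unit. -/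
def threeForm [Algebra ℝ R] (C : OctonionAlgebra.{u, v} R) (x y z : C.imag) : R :=
  (1 / 2 : ℝ) • C.bilin ((x : C.carrier) * (y : C.carrier)) (z : C.carrier)

end OctonionAlgebra

/-- The category of globally non-split octonion algebras over `R`. -/
abbrev NonsplitOctonionAlgebra (R : Type u) [CommRing R] :=
  (OctonionAlgebra.IsGloballyNonsplit.{u, v} (R := R)).FullSubcategory

/-! ### The group `G₂` -/

/-- Euclidean space `ℝ⁷`. -/
abbrev R7 := EuclideanSpace ℝ (Fin 7)

/-- The alternating form `eⁱ ∧ eʲ ∧ eᵏ` on `ℝ⁷`, with coordinates numbered from `0` to `6`. -/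
def wedge3 (i j k : Fin 7) (x y z : R7) : ℝ :=
  Matrix.det !![x i, x j, x k; y i, y j, y k; z i, z j, z k]

/-- The standard form `φ₀ = e¹²³ + e¹⁴⁵ + e¹⁶⁷ + e²⁴⁶ - e²⁵⁷ - e³⁴⁷ - e³⁵⁶`
(with coordinates numbered from `0` to `6` in the code). -/
def phi0 (x y z : R7) : ℝ :=
  wedge3 0 1 2 x y z + wedge3 0 3 4 x y z + wedge3 0 5 6 x y z + wedge3 1 3 5 x y z
    - wedge3 1 4 6 x y z - wedge3 2 3 6 x y z - wedge3 2 4 5 x y z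

/-- The compact group `G₂`, the stabilizer of `φ₀` in `GL(7, ℝ)`. -/
def G2 : Subgroup (R7 ≃ₗ[ℝ] R7) where
  carrier := {g | ∀ x y z, phi0 (g x) (g y) (g z) = phi0 x y z}
  mul_mem' {g h} hg hh := fun x y z => by
    simp only [LinearEquiv.mul_apply]
    rw [hg, hh]
  one_mem' := fun _ _ _ => rfl
  inv_mem' {g} hg := fun x y z => by
    have h := hg (g⁻¹ x) (g⁻¹ y) (g⁻¹ z)
    simp only [← LinearEquiv.mul_apply, mul_inv_cancel] at h
    exact h.symm

/-! ### Vector bundles of rank 7 and their frames -/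

variable (n : ℕ) (M : Type u) [TopologicalSpace M] [ChartedSpace (EuclideanSpace ℝ (Fin n)) M]

/-- The ring of smooth real-valued functions on `M`. -/
abbrev SmoothFun := C^∞⟮𝓡 n, M; ℝ⟯

/-- Smooth real vector bundles of rank `7` on `M`. -/
structure Rank7Bundle where
  fiber : M → Type u
  [addCommGroup : ∀ x, AddCommGroup (fiber x)]
  [module : ∀ x, Module ℝ (fiber x)]
  [fiberTopology : ∀ x, TopologicalSpace (fiber x)]
  [totalTopology : TopologicalSpace (TotalSpace R7 fiber)]
  [fiberBundle : FiberBundle R7 fiber]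
  [vectorBundle : VectorBundle ℝ R7 fiber]
  [smooth : ContMDiffVectorBundle ∞ R7 fiber (𝓡 n)]

attribute [instance] Rank7Bundle.addCommGroup Rank7Bundle.module Rank7Bundle.fiberTopology
  Rank7Bundle.totalTopology Rank7Bundle.fiberBundle Rank7Bundle.vectorBundle Rank7Bundle.smooth

namespace Rank7Bundle

variable {n M}

/-- The smooth global sections of `E`. -/
abbrev Sections (E : Rank7Bundle n M) := Cₛ^∞⟮𝓡 n; R7, E.fiber⟯

/-- Multiplication of a section by a smooth function, pointwise. -/
instance (E : Rank7Bundle n M) : SMul (SmoothFun n M) E.Sections where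
  smul f s := ⟨fun x => f x • s x, ContMDiff.smul_section f.contMDiff s.contMDiff⟩

/-- The module structure of the global sections over the ring of smooth functions. -/
instance (E : Rank7Bundle n M) : Module (SmoothFun n M) E.Sections where
  one_smul s := ContMDiffSection.ext fun x => one_smul ℝ (s x)
  mul_smul f g s := ContMDiffSection.ext fun x => mul_smul (f x) (g x) (s x)
  smul_zero f := ContMDiffSection.ext fun x => smul_zero (f x)
  smul_add f s t := ContMDiffSection.ext fun x => smul_add (f x) (s x) (t x)
  add_smul f g s := ContMDiffSection.ext fun x => add_smul (f x) (g x) (s x)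
  zero_smul s := ContMDiffSection.ext fun x => zero_smul ℝ (s x)

/-- Isomorphisms of smooth vector bundles over the identity of `M`. -/
@[ext]
structure Iso (E E' : Rank7Bundle n M) where
  toEquiv : ∀ x, E.fiber x ≃ₗ[ℝ] E'.fiber x
  smooth_toEquiv : ContMDiff ((𝓡 n).prod 𝓘(ℝ, R7)) ((𝓡 n).prod 𝓘(ℝ, R7)) ∞
    (fun p : TotalSpace R7 E.fiber => (⟨p.1, toEquiv p.1 p.2⟩ : TotalSpace R7 E'.fiber))
  smooth_symm : ContMDiff ((𝓡 n).prod 𝓘(ℝ, R7)) ((𝓡 n).prod 𝓘(ℝ, R7)) ∞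
    (fun p : TotalSpace R7 E'.fiber => (⟨p.1, (toEquiv p.1).symm p.2⟩ : TotalSpace R7 E.fiber))

/-- The points of the frame bundle `F(E)`: linear isomorphisms from `ℝ⁷` to a fibre of `E`. -/
abbrev Frame (E : Rank7Bundle n M) := Σ x : M, R7 ≃ₗ[ℝ] E.fiber x

/-- The map `F(E) → F(E')` given by composition with a bundle isomorphism `E → E'`. -/
def Iso.mapFrame {E E' : Rank7Bundle n M} (f : Iso E E') (u : E.Frame) : E'.Frame :=
  ⟨u.1, u.2.trans (f.toEquiv u.1)⟩

/-- `P ⊆ F(E)` is a `G₂`-reduction, i.e. a smooth principal `G₂`-subbundle: over each point it is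
one orbit of the right action of `G₂` on frames, and through each point of `M` there is a local
smooth section of `F(E)`, i.e. a smooth local frame of `E`, with values in `P`. -/
structure IsG2Reduction (E : Rank7Bundle n M) (P : Set E.Frame) : Prop where
  act_mem : ∀ (x : M) (w : R7 ≃ₗ[ℝ] E.fiber x), (⟨x, w⟩ : E.Frame) ∈ P →
    ∀ g ∈ G2, (⟨x, g.trans w⟩ : E.Frame) ∈ P
  transitive : ∀ (x : M) (w w' : R7 ≃ₗ[ℝ] E.fiber x), (⟨x, w⟩ : E.Frame) ∈ P →
    (⟨x, w'⟩ : E.Frame) ∈ P → ∃ g ∈ G2, w' = g.trans w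
  exists_local_section : ∀ x : M, ∃ U : Set M, IsOpen U ∧ x ∈ U ∧
    ∃ σ : ∀ y, R7 ≃ₗ[ℝ] E.fiber y, (∀ y ∈ U, (⟨y, σ y⟩ : E.Frame) ∈ P) ∧
      ∀ e : R7, ContMDiffOn (𝓡 n) ((𝓡 n).prod 𝓘(ℝ, R7)) ∞
        (fun y => (⟨y, σ y e⟩ : TotalSpace R7 E.fiber)) U

/-- The frames `w : ℝ⁷ → E_x` with `w^* φ_x = φ₀`, for a `3`-form `φ` on the module of sections
of `E`; its value at `x` is `φ_x (r(x), s(x), t(x)) = φ(r, s, t)(x)`. -/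
def adaptedFrames (E : Rank7Bundle n M)
    (φ : E.Sections → E.Sections → E.Sections → SmoothFun n M) : Set E.Frame :=
  {w | ∀ r s t : E.Sections,
    φ r s t w.1 = phi0 (w.2.symm (r w.1)) (w.2.symm (s w.1)) (w.2.symm (t w.1))}

end Rank7Bundle

/-! ### Formal `G₂`-structures -/

/-- A formal `G₂`-structure on `M`: a `G₂`-reduction of the frame bundle of some rank `7`
vector bundle on `M`. -/
structure FormalG2Structure where
  bundle : Rank7Bundle n M
  frames : Set bundle.Frame
  isReduction : bundle.IsG2Reduction frames

namespace FormalG2Structure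

variable {n M}

/-- Morphisms of formal `G₂`-structures: isomorphisms `f` of the vector bundles with
`P' = f P`. -/
@[ext]
structure Hom (P P' : FormalG2Structure n M) where
  toIso : Rank7Bundle.Iso P.bundle P'.bundle
  map_frames : P'.frames = toIso.mapFrame '' P.frames

/-- The category of formal `G₂`-structures on `M`. -/
instance : Category (FormalG2Structure n M) where
  Hom := Hom
  id P :=
    { toIso := ⟨fun x => LinearEquiv.refl ℝ (P.bundle.fiber x), contMDiff_id, contMDiff_id⟩
      map_frames := (Set.image_id P.frames).symm }
  comp f g :=
    { toIso := ⟨fun x => (f.toIso.toEquiv x).trans (g.toIso.toEquiv x),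
        g.toIso.smooth_toEquiv.comp f.toIso.smooth_toEquiv,
        f.toIso.smooth_symm.comp g.toIso.smooth_symm⟩
      map_frames := by
        rw [g.map_frames, f.map_frames, Set.image_image]
        rfl }

end FormalG2Structure

end

noncomputable section

/-! Evaluation at a point p of M turns an octonion algebra C over C^∞(M) into an 8-dimensional real
algebra, `OctonionAlgebra.Fiber`, on which ½b is a nondegenerate form with multiplicative diagonal
q. An element times its conjugate is q(x), so non-splitness at the maximal ideal of p makes this
form anisotropic, and a root of t ↦ q(x + t) shows that it is positive definite
(`IsGloballyNonsplit.form_pos`).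

Smooth orthonormalization gives, near every point, imaginary a, b, c such that 1, a, b, ab, c are
orthonormal. The composition identities then force the octonion multiplication table on a, b, ab, c,
ac, bc, a(bc), so that φ_C is φ₀ in this frame (`IsBasicTriple.frame_phi0`, `exists_adaptedFrame`).
Changes between such frames are smooth and preserve φ₀ and the inner product; they are the
transition functions of a rank 7 bundle. Its sections are C ⊖ eR because b is nondegenerate, and its
adapted frames form a G₂-reduction (`exists_bundle`).

The algebra can be recovered from the inner product and φ_C: for imaginary x, y the product is xy =
-⟨x, y⟩ + x × y with ⟨x × y, z⟩ = φ_C(x, y, z). The form alone already determines the inner product,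
since the stabilizer of φ₀ lies in O(7) (`G2.inner_map_map`). So a bundle isomorphism that respects
the reductions is an isomorphism of octonion algebras, which gives fullness; faithfulness holds
because a morphism fixes the unit and is determined by its imaginary part.

For essential surjectivity, a reduction P of E gives a smooth inner product and cross product on E,
and R ⊕ Γ(E) carries the product (r, x)(s, y) = (rs - ⟨x, y⟩, ry + sx + x × y). Three points need an
argument. Γ(E) is finitely generated projective and the form is perfect: generic combinations give n
+ 8 sections that span every fibre, and inverting their Gram operator gives a dual basis. The rank
is constant because C^∞(M) has no idempotents besides 0 and 1 when M is connected. Non-splitness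
must hold at all maximal ideals, including those that do not come from points; it follows from the
Cauchy–Schwarz inequality and the convexity of maximal ideals (`SmoothFun.mem_of_sq_le`). -/

/-! ### Real composition algebras -/

/-- A normalized nondegenerate symmetric bilinear form `B` on a unital real algebra whose quadratic
form `x ↦ B x x` is multiplicative. -/
structure IsCompositionForm {V : Type*} [NonAssocRing V] [Module ℝ V]
    (B : LinearMap.BilinForm ℝ V) : Prop where
  symm : ∀ x y, B x y = B y x
  nondeg : ∀ x, (∀ z, B x z = 0) → x = 0
  mul : ∀ x y, B (x * y) (x * y) = B x x * B y y
  one : B 1 1 = 1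

namespace IsCompositionForm

variable {V : Type*} [NonAssocRing V] [Module ℝ V]
  {B : LinearMap.BilinForm ℝ V} (hB : IsCompositionForm B)

include hB

theorem ext {x y : V} (h : ∀ z, B x z = B y z) : x = y :=
  sub_eq_zero.1 (hB.nondeg _ fun z => by simp [h z])

theorem mul_left (x y z : V) : B (x * y) (x * z) = B x x * B y z := by
  have h := hB.mul x (y + z)
  simp only [mul_add, map_add, LinearMap.add_apply, hB.mul] at h
  rw [hB.symm (x * z) (x * y), hB.symm z y] at h
  linarith

theorem mul_right (x y z : V) : B (x * y) (z * y) = B x z * B y y := by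
  have h := hB.mul (x + z) y
  simp only [add_mul, map_add, LinearMap.add_apply, hB.mul] at h
  rw [hB.symm (z * y) (x * y), hB.symm z x] at h
  linarith

/-- The full linearization of multiplicativity. Setting one argument to 1 shows that multiplication
by an imaginary element, on either side, is skew-adjoint. -/
theorem mul_mul (x y z w : V) : B (x * y) (z * w) + B (x * w) (z * y) = 2 * B x z * B y w := by
  have h := hB.mul_right x (y + w) z
  simp only [mul_add, map_add, LinearMap.add_apply, hB.mul_right] at h
  rw [hB.symm w y] at h
  linarith

theorem mul_left_skew {a : V} (ha : B 1 a = 0) (y z : V) : B (a * y) z = -B y (a * z) := by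
  have h := hB.mul_mul a y 1 z
  rw [hB.symm a 1, ha, one_mul, one_mul, hB.symm (a * z) y] at h
  linarith

theorem mul_right_skew {a : V} (ha : B 1 a = 0) (y z : V) : B (y * a) z = -B y (z * a) := by
  have h := hB.mul_mul y a z 1
  rw [hB.symm a 1, ha, mul_one, mul_one] at h
  linarith

/-- Left multiplication by `a` is skew and scales the form by `B a a`, so its square is the scalar
`-B a a`. This weak form of associativity is all that the multiplication table needs. -/
theorem mul_mul_self {a : V} (ha : B 1 a = 0) (y : V) : a * (a * y) = -(B a a • y) :=
  hB.ext fun z => by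
    rw [hB.mul_left_skew ha, hB.mul_left]; simp

theorem mul_self_mul {a : V} (ha : B 1 a = 0) (y : V) : (y * a) * a = -(B a a • y) :=
  hB.ext fun z => by
    rw [hB.mul_right_skew ha, hB.mul_right]; simp [mul_comm]

/-- Polarization of `mul_mul_self` at `a + b`: left multiplications by orthogonal imaginary elements
satisfy the Clifford relation. -/
theorem mul_left_anticomm {a b : V} (ha : B 1 a = 0) (hb : B 1 b = 0) (hab : B a b = 0) (y : V) :
    a * (b * y) = -(b * (a * y)) := by
  have h := hB.mul_mul_self (a := a + b) (by simp [ha, hb]) y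
  simp only [add_mul, mul_add, map_add, LinearMap.add_apply, hB.mul_mul_self ha,
    hB.mul_mul_self hb, hab, hB.symm b a, add_zero, zero_add, add_smul] at h
  have h2 : a * (b * y) + b * (a * y) = 0 := by
    have : a * (b * y) + b * (a * y) =
      (-(B a a • y) + b * (a * y) + (a * (b * y) + -(B b b • y))) + (B a a • y + B b b • y) := by
      abel
    rw [this, h]; abel
  exact eq_neg_of_add_eq_zero_left h2

theorem anticomm {a b : V} (ha : B 1 a = 0) (hb : B 1 b = 0) (hab : B a b = 0) :
    a * b = -(b * a) := by
  simpa using hB.mul_left_anticomm ha hb hab 1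

theorem one_mul_eq {a : V} (ha : B 1 a = 0) (b : V) : B 1 (a * b) = -B a b := by
  have := hB.mul_left_skew ha b 1
  rw [mul_one, hB.symm b a, hB.symm] at this
  exact this

end IsCompositionForm

/-! ### Basic triples and the multiplication table of the octonions -/

/-- The standard basis `(a, b, ab, c, ac, bc, a(bc))` of the imaginary octonions attached to a
basic triple. -/
def tripleFrame {V : Type*} [Mul V] (a b c : V) : Fin 7 → V :=
  ![a, b, a * b, c, a * c, b * c, a * (b * c)]

/-- A basic triple: orthonormal imaginary elements `a, b, c` such that `c` is orthogonal to `ab`. -/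
structure IsBasicTriple {V : Type*} [NonAssocRing V] [Module ℝ V]
    (B : LinearMap.BilinForm ℝ V) (a b c : V) : Prop where
  one_a : B 1 a = 0
  one_b : B 1 b = 0
  one_c : B 1 c = 0
  aa : B a a = 1
  bb : B b b = 1
  cc : B c c = 1
  ab : B a b = 0
  ac : B a c = 0
  bc : B b c = 0
  ab_c : B (a * b) c = 0

namespace IsBasicTriple

variable {V : Type*} [NonAssocRing V] [Module ℝ V]
  {B : LinearMap.BilinForm ℝ V} {a b c : V}

theorem one_frame (h : IsBasicTriple B a b c) (hB : IsCompositionForm B) (i : Fin 7) :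
    B 1 (tripleFrame a b c i) = 0 := by
  obtain ⟨ha, hb, hc, haa, hbb, hcc, hab, hac, hbc, habc⟩ := h
  -- Skewness of left multiplication by b gives ⟨a, bc⟩ = -⟨ba, c⟩ = ⟨ab, c⟩ = 0.
  have h7 : B a (b * c) = 0 := by
    have := hB.mul_left_skew ha b c
    rw [habc] at this
    have h2 := hB.mul_left_skew hb a c
    rw [hB.anticomm hb ha (by rw [hB.symm, hab])] at h2
    simp only [map_neg, LinearMap.neg_apply, habc] at h2
    linarith
  fin_cases i <;> simp [tripleFrame, ha, hb, hc, hB.one_mul_eq, hab, hac, hbc, h7]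

/-- The multiplication table of the frame of a basic triple. -/
theorem mul_table (h : IsBasicTriple B a b c) (hB : IsCompositionForm B) (x : V) :
    (a * (a * x) = -x) ∧ (b * (b * x) = -x) ∧ (c * (c * x) = -x) ∧
    (b * (a * x) = -(a * (b * x))) ∧ (c * (a * x) = -(a * (c * x))) ∧
    (c * (b * x) = -(b * (c * x))) ∧ ((a * b) * (a * x) = -(a * ((a * b) * x))) ∧
    ((a * b) * (b * x) = -(b * ((a * b) * x))) ∧ ((a * c) * (a * x) = -(a * ((a * c) * x))) ∧
    ((a * c) * (b * x) = -(b * ((a * c) * x))) ∧ ((a * c) * (c * x) = -(c * ((a * c) * x))) ∧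
    ((b * c) * (a * x) = -(a * ((b * c) * x))) := by
  have h6 := h.one_frame hB
  have ho4 : B 1 (a * b) = 0 := h6 2
  have ho5 : B 1 (a * c) = 0 := h6 4
  have ho6 : B 1 (b * c) = 0 := h6 5
  have ho7 : B 1 (a * (b * c)) = 0 := h6 6
  obtain ⟨ha, hb, hc, haa, hbb, hcc, hab, hac, hbc, habc⟩ := h
  have e1 : B (b * c) a = 0 := by rw [hB.one_mul_eq ha] at ho7; rw [hB.symm]; linarith
  have e2 : B (a * c) b = 0 := by
    rw [hB.mul_left_skew ha, hB.symm, habc, neg_zero]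
  have e3 : B (a * b) a = 0 := by
    have := hB.mul_left a b 1; rw [mul_one, hB.symm b, hb, mul_zero] at this; exact this
  have e4 : B (a * c) a = 0 := by
    have := hB.mul_left a c 1; rw [mul_one, hB.symm c, hc, mul_zero] at this; exact this
  have e5 : B (a * b) b = 0 := by
    have := hB.mul_right a b 1; rw [one_mul, hB.symm a, ha, zero_mul] at this; exact this
  have e6 : B (a * c) c = 0 := by
    have := hB.mul_right a c 1; rw [one_mul, hB.symm a, ha, zero_mul] at this; exact this
  refine ⟨by rw [hB.mul_mul_self ha, haa, one_smul], by rw [hB.mul_mul_self hb, hbb, one_smul],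
    by rw [hB.mul_mul_self hc, hcc, one_smul], hB.mul_left_anticomm hb ha (by rw [hB.symm, hab]) x,
    hB.mul_left_anticomm hc ha (by rw [hB.symm, hac]) x,
    hB.mul_left_anticomm hc hb (by rw [hB.symm, hbc]) x, hB.mul_left_anticomm ho4 ha e3 x,
    hB.mul_left_anticomm ho4 hb e5 x, hB.mul_left_anticomm ho5 ha e4 x,
    hB.mul_left_anticomm ho5 hb e2 x, hB.mul_left_anticomm ho5 hc e6 x,
    hB.mul_left_anticomm ho6 ha e1 x⟩

theorem frame_orthonormal (h : IsBasicTriple B a b c) (hB : IsCompositionForm B) (i j : Fin 7) :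
    B (tripleFrame a b c i) (tripleFrame a b c j) = if i = j then 1 else 0 := by
  wlog hij : i ≤ j generalizing i j
  · rw [hB.symm, this j i (le_of_not_ge hij)]; simp [eq_comm]
  have h6 := h.one_frame hB
  have ho7 : B 1 (a * (b * c)) = 0 := h6 6
  obtain ⟨ha, hb, hc, haa, hbb, hcc, hab, hac, hbc, habc⟩ := h
  have e1 : B a (b * c) = 0 := by rw [hB.one_mul_eq ha] at ho7; linarith
  have e2 : B b (a * c) = 0 := by
    rw [hB.symm, hB.mul_left_skew ha, hB.symm, habc, neg_zero]
  have left (y : V) (hy : B 1 y = 0) (x : V) : B x (x * y) = 0 := by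
    have := hB.mul_left x 1 y; rw [mul_one, hy, mul_zero] at this; exact this
  have right (y : V) (hy : B 1 y = 0) (x : V) : B x (y * x) = 0 := by
    have := hB.mul_right 1 x y; rw [one_mul, hy, zero_mul] at this; exact this
  have e3 : B b (a * (b * c)) = 0 := by
    rw [hB.mul_left_anticomm ha hb hab, map_neg, left (a * c) (h6 4), neg_zero]
  have e4 : B c (a * (b * c)) = 0 := by
    have := hB.mul_left_skew ha c (b * c)
    have h2 := hB.mul_right a c b
    rw [hab, zero_mul] at h2
    linarith
  have e6 : B (a * b) (b * c) = 0 := by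
    rw [hB.anticomm ha hb hab, map_neg, LinearMap.neg_apply, hB.mul_left, hac]; simp
  fin_cases i <;> fin_cases j <;> first | exact absurd hij (by decide) |
    simp [tripleFrame, haa, hbb, hcc, hab, hac, hbc, habc, hB.mul, e1, e2, e3, e4, e6,
      hB.mul_left, hB.mul_right, left b hb, left c hc, left (b * c) (h6 5), right a ha, right b hb]

end IsBasicTriple

/-- The structure constants of the form `φ₀`. -/
def phi0Int (i j k : Fin 7) : ℤ :=
  let w (l m n : Fin 7) : ℤ :=
    let d (p q : Fin 7) : ℤ := if p = q then 1 else 0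
    d i l * d j m * d k n - d i l * d j n * d k m - d i m * d j l * d k n + d i m * d j n * d k l +
      d i n * d j l * d k m - d i n * d j m * d k l
  w 0 1 2 + w 0 3 4 + w 0 5 6 + w 1 3 5 - w 1 4 6 - w 2 3 6 - w 2 4 5

theorem phi0_single (i j k : Fin 7) :
    phi0 (EuclideanSpace.single i 1) (EuclideanSpace.single j 1) (EuclideanSpace.single k 1) =
      phi0Int i j k := by
  simp only [phi0, wedge3, Matrix.det_fin_three, phi0Int, PiLp.single_apply]
  push_cast
  simp [@eq_comm (Fin 7)]

/-- The index `k` with `eᵢ eⱼ = ± eₖ`. -/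
def octIdx : Fin 7 → Fin 7 → Fin 7 :=
  -- The diagonal entries are placeholders: the sign `octSign i i` is zero.
  ![![0, 2, 1, 4, 3, 6, 5], ![2, 0, 0, 5, 6, 3, 4], ![1, 0, 0, 6, 5, 4, 3], ![4, 5, 6, 0, 0, 1, 2],
    ![3, 6, 5, 0, 0, 2, 1], ![6, 3, 4, 1, 2, 0, 0], ![5, 4, 3, 2, 1, 0, 0]]

/-- The sign in `eᵢ eⱼ = ± eₖ`. -/
def octSign : Fin 7 → Fin 7 → ℤ :=
  ![![0, 1, -1, 1, -1, 1, -1], ![-1, 0, 1, 1, -1, -1, 1], ![1, -1, 0, -1, -1, 1, 1],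
    ![-1, -1, 1, 0, 1, 1, -1], ![1, 1, 1, -1, 0, -1, -1], ![-1, 1, -1, -1, 1, 0, 1],
    ![1, -1, -1, 1, 1, -1, 0]]

/-- With integer structure constants this is a finite check over the 343 index triples. -/
theorem phi0Int_eq (i j k : Fin 7) :
    phi0Int i j k = octSign i j * if octIdx i j = k then 1 else 0 := by
  revert i j k; decide +kernel

namespace IsBasicTriple

variable {V : Type*} [NonAssocRing V] [Module ℝ V]
  {B : LinearMap.BilinForm ℝ V} {a b c : V}

theorem frame_mul (h : IsBasicTriple B a b c) (hB : IsCompositionForm B) (i j : Fin 7) :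
    tripleFrame a b c i * tripleFrame a b c j =
      if i = j then -1 else octSign i j • tripleFrame a b c (octIdx i j) := by
  have T := h.mul_table hB
  have t1 := fun x => (T x).1
  have t2 := fun x => (T x).2.1
  have t3 := fun x => (T x).2.2.1
  have t4 := fun x => (T x).2.2.2.1
  have t5 := fun x => (T x).2.2.2.2.1
  have t6 := fun x => (T x).2.2.2.2.2.1
  have t7 := fun x => (T x).2.2.2.2.2.2.1
  have t8 := fun x => (T x).2.2.2.2.2.2.2.1
  have t9 := fun x => (T x).2.2.2.2.2.2.2.2.1
  have t10 := fun x => (T x).2.2.2.2.2.2.2.2.2.1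
  have t12 := fun x => (T x).2.2.2.2.2.2.2.2.2.2.2
  have o := h.frame_orthonormal hB
  have o1 := h.one_frame hB
  have key (i j : Fin 7) (hij : i ≠ j) : tripleFrame a b c i * tripleFrame a b c j =
      -(tripleFrame a b c j * tripleFrame a b c i) :=
    hB.anticomm (o1 i) (o1 j) (by rw [o, if_neg hij])
  by_cases hij : i = j
  · subst hij
    have := hB.mul_mul_self (o1 i) 1
    rw [mul_one, o, if_pos rfl, one_smul] at this
    rw [this, if_pos rfl]
  rw [if_neg hij]
  wlog hlt : i < j generalizing i j
  · have h1 : octSign i j = -octSign j i := by clear * -; revert i j; decide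
    have h2 : octIdx i j = octIdx j i := by clear * -; revert i j; decide
    rw [key i j hij, this j i (Ne.symm hij) (lt_of_le_of_ne (le_of_not_gt hlt) (Ne.symm hij)), h1,
      h2, neg_smul]
  have bb : b * b = -1 := by simpa using t2 1
  have cc : c * c = -1 := by simpa using t3 1
  have ba : b * a = -(a * b) := by simpa using t4 1
  have cb : c * b = -(b * c) := by simpa using t6 1
  -- The failure of associativity: (ab)c = -c(ab) = a(cb) = -a(bc). Products such as (ab)(bc) are
  -- brought to frame elements by moving left multiplications past each other with the
  -- anticommutation rules.
  have p34 : (a * b) * c = -(a * (b * c)) := by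
    have : (a * b) * c = -(c * (a * b)) := key 2 3 (by decide)
    rw [this, t5, cb, mul_neg, neg_neg]
  have p5c : (a * c) * c = -a := by
    have := hB.mul_self_mul (a := c) (o1 3) a
    rwa [show B c c = 1 from o 3 3, one_smul] at this
  have p36 : (a * b) * (b * c) = a * c := by rw [t8, p34, mul_neg, t4, t2]; simp
  have p56 : (a * c) * (b * c) = -(a * b) := by rw [t10, p5c, mul_neg, neg_neg, ba]
  have p66 : (b * c) * (b * c) = -1 := by
    have := hB.mul_mul_self (o1 5) 1
    rwa [mul_one, o, if_pos rfl, one_smul] at this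
  fin_cases i <;> fin_cases j <;> first | exact absurd hlt (by decide) |
    simp [tripleFrame, octSign, octIdx, t1, t2, t4, t5, t6, t7, t9, t12, p34, p36, p56,
      p66, bb, cc]

/-- In the frame of a basic triple the form `⟨xy, z⟩` is `φ₀`. -/
theorem frame_phi0 (h : IsBasicTriple B a b c) (hB : IsCompositionForm B) (i j k : Fin 7) :
    B (tripleFrame a b c i * tripleFrame a b c j) (tripleFrame a b c k) =
      phi0 (EuclideanSpace.single i 1) (EuclideanSpace.single j 1)
        (EuclideanSpace.single k 1) := by
  rw [phi0_single, phi0Int_eq, h.frame_mul hB]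
  split_ifs with hij hk hk
  · subst hij; simp [h.one_frame hB, show octSign i i = 0 by clear * -; revert i; decide]
  · simp [h.one_frame hB]
  · rw [← hk]
    have := h.frame_orthonormal hB (octIdx i j) (octIdx i j)
    rw [map_zsmul, LinearMap.smul_apply, this]
    simp
  · rw [map_zsmul, LinearMap.smul_apply, h.frame_orthonormal hB, if_neg hk]
    simp

end IsBasicTriple

/-! ### The cross product on `ℝ⁷` and the inclusion `G₂ ⊆ O(7)` -/

/-- The cross product on `ℝ⁷` determined by `⟨x × y, z⟩ = φ₀ (x, y, z)`. -/
def cross7 (x y : R7) : R7 :=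
  !₂[x 1 * y 2 - x 2 * y 1 + (x 3 * y 4 - x 4 * y 3) + (x 5 * y 6 - x 6 * y 5),
    x 2 * y 0 - x 0 * y 2 + (x 3 * y 5 - x 5 * y 3) - (x 4 * y 6 - x 6 * y 4),
    x 0 * y 1 - x 1 * y 0 - (x 3 * y 6 - x 6 * y 3) - (x 4 * y 5 - x 5 * y 4),
    x 4 * y 0 - x 0 * y 4 + (x 5 * y 1 - x 1 * y 5) - (x 6 * y 2 - x 2 * y 6),
    x 0 * y 3 - x 3 * y 0 - (x 6 * y 1 - x 1 * y 6) - (x 5 * y 2 - x 2 * y 5),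
    x 6 * y 0 - x 0 * y 6 + (x 1 * y 3 - x 3 * y 1) - (x 2 * y 4 - x 4 * y 2),
    x 0 * y 5 - x 5 * y 0 - (x 1 * y 4 - x 4 * y 1) - (x 2 * y 3 - x 3 * y 2)]

theorem inner_eq_sum7 (x y : R7) : inner ℝ x y = x 0 * y 0 + x 1 * y 1 + x 2 * y 2 + x 3 * y 3 +
    x 4 * y 4 + x 5 * y 5 + x 6 * y 6 := by
  simp only [PiLp.inner_apply, Fin.sum_univ_seven, RCLike.inner_apply, conj_trivial]
  ring

theorem inner_cross7 (x y z : R7) : inner ℝ (cross7 x y) z = phi0 x y z := by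
  simp only [inner_eq_sum7, phi0, wedge3, Matrix.det_fin_three, cross7]
  simp
  ring

theorem cross7_add_left (x x' y : R7) : cross7 (x + x') y = cross7 x y + cross7 x' y := by
  ext i; fin_cases i <;> simp [cross7] <;> ring

theorem cross7_add_right (x y y' : R7) : cross7 x (y + y') = cross7 x y + cross7 x y' := by
  ext i; fin_cases i <;> simp [cross7] <;> ring

theorem cross7_smul_left (t : ℝ) (x y : R7) : cross7 (t • x) y = t • cross7 x y := by
  ext i; fin_cases i <;> simp [cross7] <;> ring

theorem cross7_smul_right (t : ℝ) (x y : R7) : cross7 x (t • y) = t • cross7 x y := by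
  ext i; fin_cases i <;> simp [cross7] <;> ring

theorem inner_cross7_left (x y : R7) : inner ℝ (cross7 x y) x = 0 := by
  simp only [inner_eq_sum7, cross7]; simp; ring

theorem inner_cross7_right (x y : R7) : inner ℝ (cross7 x y) y = 0 := by
  simp only [inner_eq_sum7, cross7]; simp; ring

theorem inner_cross7_self (x y : R7) : inner ℝ (cross7 x y) (cross7 x y) =
    inner ℝ x x * inner ℝ y y - inner ℝ x y ^ 2 := by
  simp only [inner_eq_sum7, cross7]; simp; ring

theorem contDiff_cross7 : ContDiff ℝ ∞ fun p : R7 × R7 => cross7 p.1 p.2 := by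
  rw [contDiff_euclidean]
  intro i
  fin_cases i <;> simp [cross7] <;> fun_prop

namespace G2

/-- The matrix of the form `φ₀ (y, -, -)`. -/
def contraction (y : Fin 7 → ℝ) : Matrix (Fin 7) (Fin 7) ℝ :=
  !![0, y 2, -y 1, y 4, -y 3, y 6, -y 5;
    -y 2, 0, y 0, y 5, -y 6, -y 3, y 4;
    y 1, -y 0, 0, -y 6, -y 5, y 4, y 3;
    -y 4, -y 5, y 6, 0, y 0, y 1, -y 2;
    y 3, y 6, y 5, -y 0, 0, -y 2, -y 1;
    -y 6, y 3, -y 4, -y 1, y 2, 0, y 0;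
    y 5, -y 4, -y 3, y 2, y 1, -y 0, 0]

open Matrix

theorem contraction_transpose (y : Fin 7 → ℝ) : (contraction y)ᵀ = -contraction y := by
  ext i j; fin_cases i <;> fin_cases j <;> simp [contraction]

theorem contraction_mulVec_self (y : Fin 7 → ℝ) : contraction y *ᵥ y = 0 := by
  ext i; fin_cases i <;> simp [contraction, Matrix.mulVec, dotProduct, Fin.sum_univ_seven] <;> ring

theorem contraction_mul_self (y : Fin 7 → ℝ) :
    contraction y * contraction y = vecMulVec y y - (y ⬝ᵥ y) • (1 : Matrix (Fin 7) (Fin 7) ℝ) := by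
  ext i j; fin_cases i <;> fin_cases j <;>
    simp [contraction, Matrix.mul_apply, dotProduct, Fin.sum_univ_seven, vecMulVec_apply] <;> ring

theorem dotProduct_contraction (x y z : R7) :
    y.ofLp ⬝ᵥ (contraction x.ofLp *ᵥ z.ofLp) = phi0 x y z := by
  simp only [phi0, wedge3, Matrix.det_fin_three]
  simp [contraction, mulVec, dotProduct, Fin.sum_univ_seven]
  ring

theorem det_one_add_vecMulVec (u v : Fin 7 → ℝ) :
    (1 + vecMulVec u v).det = 1 + v ⬝ᵥ u := by
  rw [← det_one_add_replicateCol_mul_replicateRow (ι := Unit) u v, vecMulVec_eq Unit]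

/-- The square of `det (M_y + y yᵀ)`, where `M_y` is the matrix of `φ₀ (y, -, -)`. -/
theorem det_contraction_add_sq {y : Fin 7 → ℝ} (hy : y ⬝ᵥ y ≠ 0) :
    (contraction y + vecMulVec y y).det ^ 2 = (y ⬝ᵥ y) ^ 8 := by
  have h1 : contraction y * vecMulVec y y = 0 := by
    rw [mul_vecMulVec, contraction_mulVec_self, zero_vecMulVec]
  have h2 : vecMulVec y y * contraction y = 0 := by
    rw [vecMulVec_mul, ← mulVec_transpose, contraction_transpose, neg_mulVec,
      contraction_mulVec_self, neg_zero, vecMulVec_zero]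
  have h3 : vecMulVec y y * vecMulVec y y = (y ⬝ᵥ y) • vecMulVec y y := by
    ext i j; simp [vecMulVec_mul_vecMulVec, vecMulVec_apply]; ring
  -- M_y is skew and annihilates y, so the product is -M_y² + |y|² y yᵀ, a rank-one perturbation of
  -- the scalar |y|². Its determinant is |y|¹⁴ · |y|².
  have key : (contraction y + vecMulVec y y) * (contraction y + vecMulVec y y)ᵀ =
      (y ⬝ᵥ y) • (1 + vecMulVec ((1 - (y ⬝ᵥ y)⁻¹) • y) y) := by
    rw [transpose_add, contraction_transpose, transpose_vecMulVec, add_mul, mul_add, mul_add,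
      mul_neg, mul_neg, h1, h2, h3, contraction_mul_self, smul_add, smul_vecMulVec, smul_smul,
      mul_sub, mul_one, mul_inv_cancel₀ hy, sub_smul, one_smul]
    abel
  have := congrArg det key
  rw [det_mul, det_transpose, det_smul, det_one_add_vecMulVec, dotProduct_smul, smul_eq_mul,
    Fintype.card_fin, sub_mul, inv_mul_cancel₀ hy] at this
  rw [sq, this]; ring

theorem eq_of_dotProduct {A B : Matrix (Fin 7) (Fin 7) ℝ}
    (h : ∀ v w, v ⬝ᵥ (A *ᵥ w) = v ⬝ᵥ (B *ᵥ w)) : A = B := by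
  ext i j
  simpa using h (Pi.single i 1) (Pi.single j 1)

/-- `G₂` preserves the inner product: a linear automorphism of `ℝ⁷` that preserves `φ₀` is an
isometry. -/
theorem inner_map_map {g : R7 ≃ₗ[ℝ] R7} (hg : g ∈ G2) (x y : R7) :
    inner ℝ (g x) (g y) = inner ℝ x y := by
  have hg' : ∀ x y z, phi0 (g x) (g y) (g z) = phi0 x y z := hg
  let b := (EuclideanSpace.basisFun (Fin 7) ℝ).toBasis
  set A : Matrix (Fin 7) (Fin 7) ℝ := LinearMap.toMatrix b b g.toLinearMap with hA
  have hAx (x : R7) : (g x).ofLp = A *ᵥ x.ofLp := by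
    have := LinearMap.toMatrix_mulVec_repr b b g.toLinearMap x
    rw [← hA] at this
    ext i
    exact (congrFun this i).symm
  have hAx' (v : Fin 7 → ℝ) : A *ᵥ v = (g (WithLp.toLp 2 v)).ofLp := (hAx (WithLp.toLp 2 v)).symm
  have hdet : A.det ≠ 0 := by
    rw [hA, LinearMap.det_toMatrix]
    exact (LinearEquiv.isUnit_det' g).ne_zero
  -- Invariance of φ₀ contracted with v. The norm of v cannot be read off from M_v by a plain
  -- determinant, since M_v is singular; adding v vᵀ repairs this.
  have hM (v : Fin 7 → ℝ) : Aᵀ * contraction (A *ᵥ v) * A = contraction v := by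
    refine eq_of_dotProduct fun u w => ?_
    rw [← mulVec_mulVec, ← mulVec_mulVec, dotProduct_mulVec, vecMul_transpose, hAx' u, hAx' w,
      hAx' v]
    rw [dotProduct_contraction, hg', ← dotProduct_contraction]
  -- Determinants of M_{Av} + (Av)(Av)ᵀ and M_v + v vᵀ are compared; up to the determinant of A this
  -- forces |Av|² to be proportional to |v|².
  have key (v : Fin 7 → ℝ) : (|A.det| * ((A *ᵥ v) ⬝ᵥ (A *ᵥ v))) ^ 4 = (v ⬝ᵥ v) ^ 4 := by
    by_cases hv : v = 0
    · simp [hv]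
    have hr : v ⬝ᵥ v ≠ 0 := by rwa [Ne, dotProduct_self_eq_zero]
    have hAv : A *ᵥ v ≠ 0 := fun h0 => hv (by
      rw [hAx'] at h0
      have h1 : g (WithLp.toLp 2 v) = 0 := by ext i; exact congrFun h0 i
      rw [map_eq_zero_iff g g.injective] at h1
      simpa using h1)
    have hs : (A *ᵥ v) ⬝ᵥ (A *ᵥ v) ≠ 0 := by rwa [Ne, dotProduct_self_eq_zero]
    set r := v ⬝ᵥ v with hrd
    set s := (A *ᵥ v) ⬝ᵥ (A *ᵥ v) with hsd
    set η := Aᵀ *ᵥ (A *ᵥ v) with hη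
    have hηv : η ⬝ᵥ v = s := by
      rw [hη, mulVec_transpose, ← dotProduct_mulVec]
    -- Chosen so that U = 1 + v ζᵀ satisfies Uᵀ v = AᵀA v and M_v U = M_v; hence U transforms M_v +
    -- v vᵀ exactly as A transforms its counterpart at Av, and det U = s / r.
    set ζ := r⁻¹ • (η - v) with hζ
    set U := 1 + vecMulVec v ζ with hU
    have hUd : U.det = s / r := by
      rw [hU, det_one_add_vecMulVec, hζ, smul_dotProduct, sub_dotProduct, hηv, ← hrd, smul_eq_mul]
      field_simp
      ring
    have hvU : Uᵀ *ᵥ v = η := by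
      rw [hU, transpose_add, transpose_one, transpose_vecMulVec, add_mulVec, one_mulVec,
        vecMulVec_mulVec, ← hrd, hζ, op_smul_eq_smul, smul_smul, mul_inv_cancel₀ hr]
      simp
    have hconj (B : Matrix (Fin 7) (Fin 7) ℝ) (w : Fin 7 → ℝ) :
        Bᵀ * vecMulVec w w * B = vecMulVec (Bᵀ *ᵥ w) (Bᵀ *ᵥ w) := by
      rw [mul_vecMulVec, vecMulVec_mul, mulVec_transpose]
    have hUM : Uᵀ * contraction v * U = contraction v := by
      have h1 : contraction v * U = contraction v := by
        rw [hU, mul_add, mul_vecMulVec, contraction_mulVec_self, zero_vecMulVec, mul_one, add_zero]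
      have h2 : Uᵀ * contraction v = contraction v := by
        have := congrArg transpose h1
        rw [transpose_mul, contraction_transpose, mul_neg, neg_inj] at this
        exact this
      rw [h2, h1]
    have heq : Aᵀ * (contraction (A *ᵥ v) + vecMulVec (A *ᵥ v) (A *ᵥ v)) * A =
        Uᵀ * (contraction v + vecMulVec v v) * U := by
      rw [mul_add, add_mul, mul_add _ (contraction v), add_mul _ _ U, hM, hconj, hconj, hUM, hvU]
    have hd := congrArg det heq
    rw [det_mul, det_mul, det_mul, det_mul, det_transpose, det_transpose, hUd] at hd
    have h2 := congrArg (· ^ 2) hd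
    simp only [mul_pow, det_contraction_add_sq hr, det_contraction_add_sq hs, ← hrd, ← hsd] at h2
    have h3 : A.det ^ 4 * s ^ 8 = s ^ 4 * r ^ 4 := by
      have : (A.det ^ 2) ^ 2 * s ^ 8 = (s / r) ^ 4 * r ^ 8 := by linear_combination h2
      rw [div_pow, show r ^ 8 = r ^ 4 * r ^ 4 by ring, ← mul_assoc,
        div_mul_cancel₀ _ (pow_ne_zero 4 hr)] at this
      linear_combination this
    have h4 : s ^ 4 * (A.det ^ 4 * s ^ 4 - r ^ 4) = 0 := by linear_combination h3
    have h5 := (mul_eq_zero.1 h4).resolve_left (pow_ne_zero 4 hs)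
    rw [mul_pow, Even.pow_abs (by decide)]
    linear_combination h5
  have hnn (v : Fin 7 → ℝ) : 0 ≤ v ⬝ᵥ v := by
    simpa using dotProduct_star_self_nonneg v
  have key2 (v : Fin 7 → ℝ) : |A.det| * ((A *ᵥ v) ⬝ᵥ (A *ᵥ v)) = v ⬝ᵥ v :=
    (pow_left_inj₀ (mul_nonneg (abs_nonneg _) (hnn _)) (hnn _) (by decide)).1 (key v)
  have key3 (v w : Fin 7 → ℝ) : |A.det| * ((A *ᵥ v) ⬝ᵥ (A *ᵥ w)) = v ⬝ᵥ w := by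
    have h := key2 (v + w)
    rw [mulVec_add] at h
    simp only [dotProduct_add, add_dotProduct, mul_add] at h
    rw [dotProduct_comm (A *ᵥ w) (A *ᵥ v), key2, key2, dotProduct_comm w v] at h
    linarith
  have hAA : |A.det| • (Aᵀ * A) = 1 := by
    refine eq_of_dotProduct fun v w => ?_
    rw [smul_mulVec, dotProduct_smul, ← mulVec_mulVec, dotProduct_mulVec, vecMul_transpose,
      one_mulVec, smul_eq_mul, key3]
  -- Seven factors come from the scalar on ℝ⁷ and two from det(AᵀA).
  have h9 : |A.det| ^ 9 = 1 := by
    have := congrArg det hAA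
    rw [det_smul, det_mul, det_transpose, det_one, Fintype.card_fin, ← sq, ← sq_abs] at this
    linear_combination this
  have h1 : |A.det| = 1 := (pow_eq_one_iff_of_nonneg (abs_nonneg _) (by decide)).1 h9
  have := key3 x.ofLp y.ofLp
  rw [h1, one_mul, ← hAx, ← hAx] at this
  simp only [EuclideanSpace.inner_eq_star_dotProduct, star_trivial]
  rw [dotProduct_comm, this, dotProduct_comm]

/-- `G₂` preserves the cross product. -/
theorem cross7_map_map {g : R7 ≃ₗ[ℝ] R7} (hg : g ∈ G2) (x y : R7) :
    cross7 (g x) (g y) = g (cross7 x y) := by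
  refine ext_inner_right ℝ fun z => ?_
  obtain ⟨z, rfl⟩ := g.surjective z
  rw [inner_cross7, inner_map_map hg, inner_cross7]
  exact hg x y z

end G2

/-! ### Octonion algebras and their fibres -/

namespace OctonionAlgebra

/-! ### Octonion algebras over a commutative ring and their base changes -/

section General

variable {R : Type u} [CommRing R] (C : OctonionAlgebra.{u, v} R)

theorem bilin_apply (x y : C.carrier) : C.bilin x y = C.norm (x + y) - C.norm x - C.norm y := rfl

theorem bilin_comm (x y : C.carrier) : C.bilin x y = C.bilin y x := by
  rw [bilin_apply, bilin_apply, add_comm y x]; ring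

theorem bilin_self (x : C.carrier) : C.bilin x x = 2 * C.norm x := by
  rw [bilin_apply, ← two_smul R x, QuadraticMap.map_smul, smul_eq_mul]; ring

theorem norm_add (x y : C.carrier) : C.norm (x + y) = C.norm x + C.norm y + C.bilin x y := by
  rw [bilin_apply]; ring

theorem bilin_mul_right (x y z : C.carrier) : C.bilin (x * y) (z * y) = C.bilin x z * C.norm y := by
  simp only [bilin_apply, ← add_mul, norm_mul]; ring

theorem bilin_mul_mul (x y z w : C.carrier) :
    C.bilin (x * y) (z * w) + C.bilin (x * w) (z * y) = C.bilin x z * C.bilin y w := by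
  have h := C.bilin_mul_right x (y + w) z
  simp only [mul_add, map_add, LinearMap.add_apply, bilin_mul_right, norm_add] at h
  have h2 : C.bilin (x * w) (z * y) = C.bilin (z * y) (x * w) := C.bilin_comm _ _
  linear_combination h

theorem ext_bilin {x y : C.carrier} (h : ∀ z, C.bilin x z = C.bilin y z) : x = y :=
  C.nondegenerate.1 (LinearMap.ext h)

/-- The product of an element with its conjugate. -/
theorem mul_conj (x : C.carrier) :
    x * (C.bilin 1 x • (1 : C.carrier) - x) = C.norm x • (1 : C.carrier) :=
  C.ext_bilin fun z => by
    have h := C.bilin_mul_mul x x z 1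
    have h2 := C.bilin_mul_right 1 x z
    rw [mul_one, mul_one] at h
    rw [one_mul] at h2
    rw [mul_sub, mul_smul_comm, mul_one, map_sub, LinearMap.sub_apply, map_smul,
      LinearMap.smul_apply, map_smul, LinearMap.smul_apply, smul_eq_mul, smul_eq_mul]
    rw [C.bilin_comm x 1] at h
    linear_combination h2 - h

/-- A finite dual basis of an octonion algebra in terms of its bilinear form. -/
theorem exists_dual_basis : ∃ (k : ℕ) (s t : Fin k → C.carrier),
    ∀ x, x = ∑ i, C.bilin x (s i) • t i := by
  obtain ⟨k, f, g, hf, hg, hfg⟩ := Module.Finite.exists_comp_eq_id_of_projective R C.carrier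
  -- The coordinate functionals of a splitting of a free cover are represented by elements, since b
  -- is perfect.
  choose s hs using fun i : Fin k => C.nondegenerate.2 ((LinearMap.proj i).comp g)
  refine ⟨k, s, fun i => f (Pi.single i 1), fun x => ?_⟩
  have h1 : ∀ i, C.bilin x (s i) = g x i := fun i => by
    rw [C.bilin_comm]; exact LinearMap.congr_fun (hs i) x
  simp only [h1, ← map_smul, ← map_sum]
  have : ∑ i, g x i • (Pi.single i 1 : Fin k → R) = g x := by
    ext j; simp [Finset.sum_apply, Pi.single_apply]
  rw [this]
  exact (LinearMap.congr_fun hfg x).symm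

variable (S : Type*) [CommRing S] [Algebra R S]

/-- The coefficients of x in a dual basis are values b(x, s), so an element whose pairings die in S
is itself zero in the base change. This reduces vanishing in fibres and over residue fields to
scalars. -/
theorem one_tmul_eq_zero_iff {x : C.carrier} :
    (1 : S) ⊗ₜ[R] x = 0 ↔ ∀ y, algebraMap R S (C.bilin x y) = 0 := by
  constructor
  · intro h y
    have := LinearMap.BilinForm.baseChange_tmul (A := S) C.bilin 1 x 1 y
    rw [h, map_zero, LinearMap.zero_apply, mul_one, Algebra.smul_def, mul_one] at this
    exact this.symm
  · intro h
    obtain ⟨k, s, t, hst⟩ := C.exists_dual_basis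
    rw [hst x, TensorProduct.tmul_sum]
    refine Finset.sum_eq_zero fun i _ => ?_
    rw [← TensorProduct.smul_tmul, Algebra.smul_def, h, zero_mul, TensorProduct.zero_tmul]

theorem finrank_baseChange (K : Type*) [Field K] [Algebra R K] :
    Module.finrank K (K ⊗[R] C.carrier) = 8 := by
  have p : PrimeSpectrum K := ⊥
  have h1 := Module.rankAtStalk_baseChange (R := R) (M := C.carrier) p
  rw [C.rank_eq, Module.rankAtStalk_eq_finrank_of_free] at h1
  exact_mod_cast h1

/-- An element of an octonion algebra that is isotropic at a maximal ideal where the algebra is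
non-split is orthogonal to everything there. -/
theorem IsNonsplitAt.bilin_mem {C : OctonionAlgebra.{u, v} R} {m : Ideal R} [m.IsPrime]
    (hC : C.IsNonsplitAt m) (h1 : C.norm 1 = 1) {x : C.carrier} (hx : C.norm x ∈ m)
    (y : C.carrier) : C.bilin x y ∈ m := by
  have : NoZeroDivisors (m.ResidueField ⊗[R] C.carrier) := hC
  have key (x : C.carrier) : (1 : m.ResidueField) ⊗ₜ[R] x = 0 ↔ ∀ y, C.bilin x y ∈ m := by
    rw [one_tmul_eq_zero_iff]
    simp only [Ideal.algebraMap_residueField_eq_zero]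
  -- The element times its conjugate is q(x), which is zero in the residue field; without zero
  -- divisors, x or its conjugate vanishes there.
  have h0 : ((1 : m.ResidueField) ⊗ₜ[R] x) *
      ((1 : m.ResidueField) ⊗ₜ[R] (C.bilin 1 x • (1 : C.carrier) - x)) = 0 := by
    rw [Algebra.TensorProduct.tmul_mul_tmul, C.mul_conj, one_mul, key]
    intro y
    rw [map_smul, LinearMap.smul_apply, smul_eq_mul]
    exact m.mul_mem_right _ hx
  rcases mul_eq_zero.1 h0 with h | h
  · exact (key _).1 h y
  · have h2 := (key _).1 h
    -- Pairing the vanishing conjugate b(1, x) - x with 1 gives 2b(1, x) - b(1, x); so the trace of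
    -- x vanishes as well, and then x does.
    have h3 : C.bilin 1 x ∈ m := by
      have := h2 1
      rw [map_sub, LinearMap.sub_apply, map_smul, LinearMap.smul_apply, bilin_self, h1,
        C.bilin_comm x 1, smul_eq_mul] at this
      have e : C.bilin 1 x = C.bilin 1 x * (2 * 1) - C.bilin 1 x := by ring
      rw [e]; exact this
    have h4 := h2 y
    rw [map_sub, LinearMap.sub_apply, map_smul, LinearMap.smul_apply, smul_eq_mul] at h4
    exact (m.sub_mem_iff_right (m.mul_mem_right _ h3)).1 h4

end General

/-! ### Fibres over the points of a manifold and positivity of the norm -/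

section Fiber

variable {n : ℕ} {M : Type u} [TopologicalSpace M] [ChartedSpace (EuclideanSpace ℝ (Fin n)) M]

/-- Evaluation at a point makes `ℝ` an algebra over the ring of smooth functions. -/
abbrev evalAlgebra (p : M) : Algebra (SmoothFun n M) ℝ :=
  (ContMDiffMap.evalRingHom p).toAlgebra

theorem evalRingHom_surjective (p : M) :
    Function.Surjective (ContMDiffMap.evalRingHom p : SmoothFun n M →+* ℝ) := fun t =>
  ⟨⟨fun _ => t, contMDiff_const⟩, rfl⟩

variable (C : OctonionAlgebra.{u, v} (SmoothFun n M))

/-- The fibre at `p` of an octonion algebra over the ring of smooth functions. -/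
def Fiber (p : M) : Type v :=
  -- The algebra structure on ℝ depends on p, so it stays inside the definition instead of being a
  -- global instance.
  letI := evalAlgebra (n := n) p
  ℝ ⊗[SmoothFun n M] C.carrier

namespace Fiber

variable (p : M)

instance : NonAssocRing (C.Fiber p) :=
  letI := evalAlgebra (n := n) p
  (Algebra.TensorProduct.instNonAssocRing : NonAssocRing (ℝ ⊗[SmoothFun n M] C.carrier))

instance : Module ℝ (C.Fiber p) :=
  letI := evalAlgebra (n := n) p
  (TensorProduct.leftModule : Module ℝ (ℝ ⊗[SmoothFun n M] C.carrier))

instance : IsScalarTower ℝ (C.Fiber p) (C.Fiber p) :=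
  letI := evalAlgebra (n := n) p
  (inferInstance : IsScalarTower ℝ (ℝ ⊗[SmoothFun n M] C.carrier) (ℝ ⊗[SmoothFun n M] C.carrier))

instance : SMulCommClass ℝ (C.Fiber p) (C.Fiber p) :=
  letI := evalAlgebra (n := n) p
  (inferInstance : SMulCommClass ℝ (ℝ ⊗[SmoothFun n M] C.carrier) (ℝ ⊗[SmoothFun n M] C.carrier))

instance : Module.Finite ℝ (C.Fiber p) :=
  letI := evalAlgebra (n := n) p
  (inferInstance : Module.Finite ℝ (ℝ ⊗[SmoothFun n M] C.carrier))

theorem finrank_eq : Module.finrank ℝ (C.Fiber p) = 8 :=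
  letI := evalAlgebra (n := n) p
  C.finrank_baseChange ℝ

variable {C}

/-- The value at `p` of an element of an octonion algebra over the ring of smooth functions. -/
def of (x : C.carrier) : C.Fiber p :=
  letI := evalAlgebra (n := n) p
  (1 : ℝ) ⊗ₜ[SmoothFun n M] x

theorem of_surjective : Function.Surjective (of p : C.carrier → C.Fiber p) :=
  letI := evalAlgebra (n := n) p
  TensorProduct.mk_surjective (SmoothFun n M) C.carrier ℝ (evalRingHom_surjective p)

theorem of_add (x y : C.carrier) : of p (x + y) = of p x + of p y :=
  letI := evalAlgebra (n := n) p
  TensorProduct.tmul_add _ _ _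

theorem of_smul (f : SmoothFun n M) (x : C.carrier) : of p (f • x) = f p • of p x := by
  let := evalAlgebra (n := n) p
  have h : (1 : ℝ) ⊗ₜ[SmoothFun n M] (f • x) = (f p) • ((1 : ℝ) ⊗ₜ[SmoothFun n M] x) := by
    rw [← TensorProduct.smul_tmul, Algebra.smul_def, TensorProduct.smul_tmul', smul_eq_mul]
    rfl
  exact h

theorem of_zero : of p (0 : C.carrier) = 0 :=
  letI := evalAlgebra (n := n) p
  TensorProduct.tmul_zero _ _

theorem of_sub (x y : C.carrier) : of p (x - y) = of p x - of p y :=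
  letI := evalAlgebra (n := n) p
  TensorProduct.tmul_sub _ _ _

theorem of_mul (x y : C.carrier) : of p (x * y) = of p x * of p y := by
  let := evalAlgebra (n := n) p
  have h : (1 : ℝ) ⊗ₜ[SmoothFun n M] (x * y) =
      ((1 : ℝ) ⊗ₜ[SmoothFun n M] x) * ((1 : ℝ) ⊗ₜ[SmoothFun n M] y) := by
    rw [Algebra.TensorProduct.tmul_mul_tmul, one_mul]
  exact h

theorem of_one : of p (1 : C.carrier) = 1 := rfl

theorem of_eq_zero_iff {x : C.carrier} : of p x = 0 ↔ ∀ y, C.bilin x y p = 0 :=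
  letI := evalAlgebra (n := n) p
  C.one_tmul_eq_zero_iff ℝ

variable (C)

/-- The inner product `½ b` on the fibre. -/
def form : LinearMap.BilinForm ℝ (C.Fiber p) :=
  letI := evalAlgebra (n := n) p
  (1 / 2 : ℝ) • (LinearMap.BilinForm.baseChange ℝ C.bilin :
    LinearMap.BilinForm ℝ (ℝ ⊗[SmoothFun n M] C.carrier))

variable {C}

theorem form_of_of (x y : C.carrier) : form C p (of p x) (of p y) = 1 / 2 * C.bilin x y p := by
  let := evalAlgebra (n := n) p
  have h := LinearMap.BilinForm.baseChange_tmul (A := ℝ) C.bilin 1 x 1 y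
  rw [mul_one, Algebra.smul_def, mul_one] at h
  exact congrArg (fun t => 1 / 2 * t) h

theorem form_of_self (x : C.carrier) : form C p (of p x) (of p x) = C.norm x p := by
  rw [form_of_of, bilin_self, two_mul]
  change 1 / 2 * (C.norm x p + C.norm x p) = _
  ring

theorem form_nondeg (x : C.Fiber p) (h : ∀ z, form C p x z = 0) : x = 0 := by
  obtain ⟨x, rfl⟩ := of_surjective p x
  rw [of_eq_zero_iff]
  intro y
  have := h (of p y)
  rw [form_of_of] at this
  linarith

end Fiber

/-- At each point q(1) is idempotent. Were it 0, then q = q(1)q, hence b, would vanish at the point,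
and nondegeneracy would make the 8-dimensional fibre zero. -/
theorem norm_one : C.norm 1 = 1 := by
  ext p
  have h := C.norm_mul 1 1
  rw [mul_one] at h
  have hp : C.norm 1 p = C.norm 1 p * C.norm 1 p := DFunLike.congr_fun h p
  rcases eq_or_ne (C.norm 1 p) 0 with h0 | h0
  · exfalso
    have hz (x : C.carrier) : C.norm x p = 0 := by
      have hx : C.norm x p = C.norm 1 p * C.norm x p := by
        have := C.norm_mul 1 x
        rw [one_mul] at this
        exact DFunLike.congr_fun this p
      rw [hx, h0, zero_mul]
    have hb (x : C.Fiber p) : x = 0 := by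
      obtain ⟨x, rfl⟩ := Fiber.of_surjective p x
      rw [Fiber.of_eq_zero_iff]
      intro y
      have : C.bilin x y p = C.norm (x + y) p - C.norm x p - C.norm y p := rfl
      rw [this, hz, hz, hz]; ring
    have := Fiber.finrank_eq C p
    have hs : Subsingleton (C.Fiber p) := ⟨fun x y => (hb x).trans (hb y).symm⟩
    rw [Module.finrank_zero_of_subsingleton] at this
    omega
  · exact (mul_left_cancel₀ h0 (by rw [← hp]; exact (mul_one _).symm))

theorem Fiber.isCompositionForm (p : M) : IsCompositionForm (Fiber.form C p) where
  symm x y := by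
    obtain ⟨x, rfl⟩ := of_surjective p x
    obtain ⟨y, rfl⟩ := of_surjective p y
    rw [form_of_of, form_of_of, bilin_comm]
  nondeg := form_nondeg p
  mul x y := by
    obtain ⟨x, rfl⟩ := of_surjective p x
    obtain ⟨y, rfl⟩ := of_surjective p y
    rw [← of_mul, form_of_self, form_of_self, form_of_self, norm_mul]
    rfl
  one := by rw [← of_one, form_of_self, norm_one]; rfl

variable {C}

/-- Non-splitness at the kernel of evaluation, a maximal ideal, says that the form on the fibre is
anisotropic. -/
theorem IsGloballyNonsplit.bilin_eq_zero (hC : C.IsGloballyNonsplit) {p : M} {x : C.carrier}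
    (hx : C.norm x p = 0) (y : C.carrier) : C.bilin x y p = 0 := by
  let m : Ideal (SmoothFun n M) := RingHom.ker (ContMDiffMap.evalRingHom p : SmoothFun n M →+* ℝ)
  have hm : m.IsMaximal := RingHom.ker_isMaximal_of_surjective _ (evalRingHom_surjective p)
  exact (hC m).bilin_mem C.norm_one (x := x) hx y

/-- The norm of a globally non-split octonion algebra over the ring of smooth functions is
nonnegative. -/
theorem IsGloballyNonsplit.norm_nonneg (hC : C.IsGloballyNonsplit) (p : M) (x : C.carrier) :
    0 ≤ C.norm x p := by
  by_contra! hneg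
  set β := C.bilin x 1 p with hβ
  -- If q(x) < 0, the polynomial q(x + t) in t has positive discriminant. At a root, x + t is
  -- isotropic, hence orthogonal to 1 and to x; the two relations β + 2t = 0 and 2q(x) + tβ = 0 give
  -- q(x) = t² ≥ 0.
  obtain ⟨t, ht⟩ : ∃ t : ℝ, C.norm x p + t ^ 2 + t * β = 0 := by
    have hd : 0 ≤ β ^ 2 - 4 * C.norm x p := by nlinarith [sq_nonneg β]
    refine ⟨(-β + √(β ^ 2 - 4 * C.norm x p)) / 2, ?_⟩
    linear_combination (1 / 4) * Real.sq_sqrt hd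
  let f : SmoothFun n M := ⟨fun _ => t, contMDiff_const⟩
  have hadd := C.norm_add x (f • 1)
  rw [QuadraticMap.map_smul, norm_one, map_smul, smul_eq_mul, smul_eq_mul, mul_one] at hadd
  have hval : C.norm (x + f • 1) p = 0 := by
    rw [hadd]
    change C.norm x p + t * t + t * β = 0
    rw [← ht]; ring
  have h1 := hC.bilin_eq_zero hval 1
  have h2 := hC.bilin_eq_zero hval x
  rw [map_add, LinearMap.add_apply, map_smul, LinearMap.smul_apply, bilin_self, norm_one,
    smul_eq_mul] at h1
  rw [map_add, LinearMap.add_apply, map_smul, LinearMap.smul_apply, bilin_self,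
    C.bilin_comm 1 x, smul_eq_mul] at h2
  have e1 : β + t * ((2 : SmoothFun n M) p * 1) = 0 := h1
  have e2 : (2 : SmoothFun n M) p * C.norm x p + t * β = 0 := h2
  have e3 : (2 : SmoothFun n M) p = 2 := map_ofNat (ContMDiffMap.evalRingHom p) 2
  rw [e3] at e1 e2
  nlinarith [sq_nonneg t]

theorem IsGloballyNonsplit.form_pos (hC : C.IsGloballyNonsplit) {p : M} {x : C.Fiber p}
    (hx : x ≠ 0) : 0 < Fiber.form C p x x := by
  obtain ⟨x, rfl⟩ := Fiber.of_surjective p x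
  rw [Fiber.form_of_self]
  refine lt_of_le_of_ne (hC.norm_nonneg p x) fun h => hx ?_
  rw [Fiber.of_eq_zero_iff]
  exact hC.bilin_eq_zero h.symm

end Fiber

end OctonionAlgebra

section

open Filter Topology

/-! ### Local adapted frames of octonion algebras -/

section Bump

variable {n : ℕ} {M : Type u} [TopologicalSpace M] [ChartedSpace (EuclideanSpace ℝ (Fin n)) M]
  [IsManifold (𝓡 n) ∞ M] [T2Space M]

/-- A smooth function on a neighbourhood of a point agrees near the point with a global one. -/
theorem exists_smoothFun_eventuallyEq {U : Set M} (hU : IsOpen U) {p : M} (hp : p ∈ U)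
    {h : M → ℝ} (hh : ContMDiffOn (𝓡 n) 𝓘(ℝ) ∞ h U) :
    ∃ g : SmoothFun n M, ∀ᶠ y in 𝓝 p, g y = h y := by
  obtain ⟨χ, -, hχ⟩ := (SmoothBumpFunction.nhds_basis_tsupport (I := 𝓡 n) p).mem_iff.1
    (hU.mem_nhds hp)
  refine ⟨⟨fun y => χ y * h y, contMDiff_of_tsupport fun y hy => ?_⟩, ?_⟩
  · have hy' : y ∈ U := hχ (tsupport_mul_subset_left hy)
    exact χ.contMDiffAt.mul (hh.contMDiffAt (hU.mem_nhds hy'))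
  · filter_upwards [χ.eventuallyEq_one] with y hy
    change χ y * h y = h y
    rw [hy, Pi.one_apply, one_mul]

/-- A smooth inverse square root near a point where a smooth function is positive. -/
theorem exists_smoothFun_inv_sqrt (f : SmoothFun n M) {p : M} (hp : 0 < f p) :
    ∃ g : SmoothFun n M, ∀ᶠ y in 𝓝 p, g y * g y * f y = 1 := by
  have hU : IsOpen {y | 0 < f y} := isOpen_lt continuous_const f.contMDiff.continuous
  obtain ⟨g, hg⟩ := exists_smoothFun_eventuallyEq (n := n) hU hp (h := fun y => (√(f y))⁻¹)
    fun y hy => by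
      have h1 : ContDiffAt ℝ ∞ (fun t : ℝ => (√t)⁻¹) (f y) :=
        (Real.contDiffAt_sqrt hy.ne').inv (Real.sqrt_pos.2 hy).ne'
      exact (h1.contMDiffAt.comp y f.contMDiff.contMDiffAt).contMDiffWithinAt
  refine ⟨g, ?_⟩
  filter_upwards [hg, hU.mem_nhds hp] with y hy hpos
  rw [hy, ← mul_inv, Real.mul_self_sqrt (le_of_lt hpos), inv_mul_cancel₀ (ne_of_gt hpos)]

end Bump

namespace IsBasicTriple

variable {V : Type*} [NonAssocRing V] [Module ℝ V] {B : LinearMap.BilinForm ℝ V} {a b c : V}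

/-- The unit and the frame are eight orthonormal vectors, hence a basis in dimension 8. -/
theorem eq_sum_frame [Module.Finite ℝ V] (h : IsBasicTriple B a b c) (hB : IsCompositionForm B)
    (hV : Module.finrank ℝ V = 8) {x : V} (hx : B 1 x = 0) :
    x = ∑ j, B x (tripleFrame a b c j) • tripleFrame a b c j := by
  set e := tripleFrame a b c with he
  let v : Option (Fin 7) → V := fun o => o.elim 1 e
  have hv (i j) : B (v i) (v j) = if i = j then 1 else 0 := by
    rcases i with _ | i <;> rcases j with _ | j
    · simp [v, hB.one]
    · simp [v, he, h.one_frame hB]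
    · simp [v, he, hB.symm _ 1, h.one_frame hB]
    · simp [v, he, h.frame_orthonormal hB]
  have hli : LinearIndependent ℝ v := LinearMap.linearIndependent_of_isOrthoᵢ (B := B)
    (fun i j hij => show B (v i) (v j) = 0 by rw [hv, if_neg hij]) fun i => by simp [hv]
  have hspan := hli.span_eq_top_of_card_eq_finrank (by simp [hV])
  rw [← sub_eq_zero]
  refine hB.nondeg _ fun z => ?_
  have hz : z ∈ Submodule.span ℝ (Set.range v) := hspan ▸ Submodule.mem_top
  induction hz using Submodule.span_induction with
  | mem z hz =>
    obtain ⟨o, rfl⟩ := hz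
    rcases o with _ | i
    · change B _ 1 = 0
      rw [map_sub, map_sum, LinearMap.sub_apply, LinearMap.sum_apply, hB.symm, hx, zero_sub,
        neg_eq_zero]
      refine Finset.sum_eq_zero fun j _ => ?_
      rw [map_smul, LinearMap.smul_apply, hB.symm (e j) 1, he, h.one_frame hB, smul_zero]
    · change B _ (e i) = 0
      rw [map_sub, map_sum, LinearMap.sub_apply, LinearMap.sum_apply]
      simp [he, h.frame_orthonormal hB]
  | zero => simp
  | add z w _ _ hz hw => rw [map_add, hz, hw, add_zero]
  | smul t z _ hz => rw [map_smul, hz, smul_zero]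

end IsBasicTriple

/-- The cross product as a bilinear map. -/
def cross7L : R7 →ₗ[ℝ] R7 →ₗ[ℝ] R7 :=
  LinearMap.mk₂ ℝ cross7 cross7_add_left cross7_smul_left cross7_add_right cross7_smul_right

theorem phi0_eq_sum (x y z : R7) : phi0 x y z = ∑ i, ∑ j, ∑ k, x i * (y j * (z k *
    phi0 (EuclideanSpace.single i 1) (EuclideanSpace.single j 1)
      (EuclideanSpace.single k 1))) := by
  have hs (x : R7) : x = ∑ i, x i • EuclideanSpace.single i (1 : ℝ) := by
    ext j; simp [Pi.single_apply]
  conv_lhs => rw [hs x, hs y, hs z, ← inner_cross7]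
  change inner ℝ (cross7L _ _) _ = _
  simp only [map_sum, LinearMap.sum_apply, map_smul, LinearMap.smul_apply, sum_inner, inner_sum,
    inner_smul_left, inner_smul_right, conj_trivial, Finset.mul_sum]
  simp only [← inner_cross7]
  rw [Finset.sum_comm, Finset.sum_congr rfl fun j _ => Finset.sum_comm, Finset.sum_comm]
  refine Finset.sum_congr rfl fun i _ => Finset.sum_congr rfl fun j _ =>
    Finset.sum_congr rfl fun k _ => ?_
  rw [mul_left_comm (z k), mul_left_comm (z k), mul_left_comm (y j)]
  rfl

namespace OctonionAlgebra

variable {n : ℕ} {M : Type u} [TopologicalSpace M] [ChartedSpace (EuclideanSpace ℝ (Fin n)) M]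
  {C : OctonionAlgebra.{u, v} (SmoothFun n M)}

/-- The smooth function `½ b (x, y)`. -/
def ip (C : OctonionAlgebra.{u, v} (SmoothFun n M)) (x y : C.carrier) : SmoothFun n M :=
  (1 / 2 : ℝ) • C.bilin x y

theorem form_of (p : M) (x y : C.carrier) :
    Fiber.form C p (Fiber.of p x) (Fiber.of p y) = C.ip x y p := Fiber.form_of_of p x y

theorem ip_comm (x y : C.carrier) : C.ip x y = C.ip y x := by rw [ip, bilin_comm, ip]

/-- Near a point, a short orthonormal system can be extended by a further unit vector. -/
theorem exists_unit_orthogonal [IsManifold (𝓡 n) ∞ M] [T2Space M] (hC : C.IsGloballyNonsplit)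
    (p : M) {k : ℕ} (hk : k < 8) (e : Fin k → C.carrier)
    (he : ∀ᶠ y in 𝓝 p, ∀ i j, C.ip (e i) (e j) y = if i = j then 1 else 0) :
    ∃ w : C.carrier, ∀ᶠ y in 𝓝 p, C.ip w w y = 1 ∧ ∀ i, C.ip (e i) w y = 0 := by
  -- Fewer than 8 linear conditions on the fibre at p have a nonzero common solution w0.
  let L : C.Fiber p →ₗ[ℝ] (Fin k → ℝ) := LinearMap.pi fun i => Fiber.form C p (Fiber.of p (e i))
  obtain ⟨w0, hw0, hne⟩ := Submodule.exists_mem_ne_zero_of_ne_bot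
    (LinearMap.ker_ne_bot_of_finrank_lt (f := L) (by
      rw [Fiber.finrank_eq, Module.finrank_fin_fun]; exact hk))
  obtain ⟨w0, rfl⟩ := Fiber.of_surjective p w0
  have hL : ∀ i, C.ip (e i) w0 p = 0 := fun i => by
    rw [← form_of]; exact congrFun (LinearMap.mem_ker.1 hw0) i
  -- A Gram–Schmidt step. The coefficients vanish at p, so w1 agrees with w0 there and has positive
  -- norm near p.
  set w1 := w0 - ∑ i, C.ip (e i) w0 • e i with hw1
  have hof (y : M) : Fiber.of y w1 = Fiber.of y w0 - ∑ i, C.ip (e i) w0 y • Fiber.of y (e i) := by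
    have hsum : ∀ s : Finset (Fin k), Fiber.of y (∑ i ∈ s, C.ip (e i) w0 • e i) =
        ∑ i ∈ s, C.ip (e i) w0 y • Fiber.of y (e i) := fun s => by
      induction s using Finset.cons_induction with
      | empty => simp [Fiber.of_zero]
      | cons a s ha ih => rw [Finset.sum_cons, Finset.sum_cons, Fiber.of_add, ih, Fiber.of_smul]
    rw [hw1, Fiber.of_sub, hsum]
  have hpos : 0 < C.ip w1 w1 p := by
    rw [← form_of, hof]
    simp only [hL, zero_smul, Finset.sum_const_zero, sub_zero]
    exact hC.form_pos hne
  obtain ⟨g, hg⟩ := exists_smoothFun_inv_sqrt _ hpos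
  refine ⟨g • w1, ?_⟩
  filter_upwards [hg, he] with y hy hey
  constructor
  · rw [← form_of, Fiber.of_smul, map_smul, map_smul, LinearMap.smul_apply, form_of, smul_smul,
      smul_eq_mul, hy]
  · intro i
    rw [← form_of, Fiber.of_smul, map_smul, hof, map_sub, map_sum]
    simp only [map_smul, form_of, hey, smul_eq_mul]
    simp

/-- Every point has a neighbourhood on which there is a basic triple. -/
theorem exists_basicTriple [IsManifold (𝓡 n) ∞ M] [T2Space M] (hC : C.IsGloballyNonsplit)
    (p : M) : ∃ a b c : C.carrier, ∀ᶠ y in 𝓝 p,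
      IsBasicTriple (Fiber.form C y) (Fiber.of y a) (Fiber.of y b) (Fiber.of y c) := by
  have h11 (y : M) : C.ip 1 1 y = 1 := by
    rw [← form_of]; exact (Fiber.isCompositionForm C y).one
  obtain ⟨a, ha⟩ := exists_unit_orthogonal hC p (by decide) ![1]
    (Eventually.of_forall fun y i j => by fin_cases i; fin_cases j; simp [h11])
  obtain ⟨b, hb⟩ := exists_unit_orthogonal hC p (by decide) ![1, a] (by
    filter_upwards [ha] with y ha i j
    have h1a := ha.2 0
    fin_cases i <;> fin_cases j <;> simp_all [C.ip_comm a 1])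
  -- The last element must avoid the quaternion algebra spanned by 1, a, b, ab, so these four must
  -- be shown orthonormal near p.
  obtain ⟨c, hc⟩ := exists_unit_orthogonal hC p (by decide) ![1, a, b, a * b] (by
    filter_upwards [ha, hb] with y ha hb i j
    have hB := Fiber.isCompositionForm C y
    have e1 : C.ip 1 a y = 0 := ha.2 0
    have e2 : C.ip 1 b y = 0 := hb.2 0
    have e3 : C.ip a b y = 0 := hb.2 1
    have e4 : C.ip 1 (a * b) y = 0 := by
      rw [← form_of, Fiber.of_mul, Fiber.of_one, hB.one_mul_eq, form_of, e3, neg_zero]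
      rw [← Fiber.of_one, form_of, e1]
    have e5 : C.ip a (a * b) y = 0 := by
      have := hB.mul_left (Fiber.of y a) 1 (Fiber.of y b)
      rw [mul_one, ← Fiber.of_one, ← Fiber.of_mul] at this
      simp only [form_of] at this
      rw [this, e2, mul_zero]
    have e6 : C.ip b (a * b) y = 0 := by
      have := hB.mul_right 1 (Fiber.of y b) (Fiber.of y a)
      rw [one_mul, ← Fiber.of_one, ← Fiber.of_mul] at this
      simp only [form_of] at this
      rw [this, e1, zero_mul]
    have e7 : C.ip (a * b) (a * b) y = 1 := by
      rw [← form_of, Fiber.of_mul, hB.mul, form_of, form_of, ha.1, hb.1, one_mul]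
    fin_cases i <;> fin_cases j <;> simp [h11, e1, e2, e3, e4, e5, e6, e7, ha.1, hb.1,
      C.ip_comm a 1, C.ip_comm b 1, C.ip_comm b a, C.ip_comm (a * b) 1, C.ip_comm (a * b) a,
      C.ip_comm (a * b) b])
  refine ⟨a, b, c, ?_⟩
  filter_upwards [ha, hb, hc] with y ha hb hc
  exact
    { one_a := (form_of ..).trans (ha.2 0)
      one_b := (form_of ..).trans (hb.2 0)
      one_c := (form_of ..).trans (hc.2 0)
      aa := (form_of ..).trans ha.1
      bb := (form_of ..).trans hb.1
      cc := (form_of ..).trans hc.1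
      ab := (form_of ..).trans (hb.2 1)
      ac := (form_of ..).trans (hc.2 1)
      bc := (form_of ..).trans (hc.2 2)
      ab_c := by rw [← Fiber.of_mul]; exact (form_of ..).trans (hc.2 3) }

/-- The coordinates at `y` of an imaginary element with respect to a frame. -/
def coord (σ : Fin 7 → C.imag) (y : M) (a : C.imag) : R7 :=
  WithLp.toLp 2 fun j => C.ip a (σ j) y

/-- An orthonormal frame of the imaginary elements at a point in which the form `φ_C` is the
standard one. -/
structure IsAdaptedFrameAt (C : OctonionAlgebra.{u, v} (SmoothFun n M)) (σ : Fin 7 → C.imag)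
    (y : M) : Prop where
  orthonormal : ∀ i j, C.ip (σ i) (σ j) y = if i = j then 1 else 0
  ip_eq : ∀ a b : C.imag, C.ip a b y = inner ℝ (coord σ y a) (coord σ y b)
  threeForm_eq : ∀ a b c : C.imag,
    C.threeForm a b c y = phi0 (coord σ y a) (coord σ y b) (coord σ y c)

/-- The projection to the orthogonal complement of the unit. -/
def imagProj (x : C.carrier) : C.imag :=
  ⟨x - C.ip 1 x • (1 : C.carrier), by
    rw [imag, LinearMap.mem_ker, map_sub, map_smul, bilin_self, norm_one, ip, smul_eq_mul,
      mul_one, sub_eq_zero]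
    have : (2 : SmoothFun n M) = (2 : ℝ) • (1 : SmoothFun n M) := by
      rw [← Algebra.algebraMap_eq_smul_one, map_ofNat]
    rw [this, smul_mul_smul_comm, mul_one]
    norm_num⟩

/-- The frame of a basic triple is orthogonal to the unit only near p. Projecting it makes it
imaginary everywhere and does not change it near p. -/
theorem exists_adaptedFrame [IsManifold (𝓡 n) ∞ M] [T2Space M] (hC : C.IsGloballyNonsplit)
    (p : M) : ∃ σ : Fin 7 → C.imag, ∀ᶠ y in 𝓝 p, C.IsAdaptedFrameAt σ y := by
  obtain ⟨a, b, c, habc⟩ := exists_basicTriple hC p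
  refine ⟨fun j => imagProj (tripleFrame a b c j), ?_⟩
  filter_upwards [habc] with y h
  set σ : Fin 7 → C.imag := fun j => imagProj (tripleFrame a b c j) with hσ
  have hB := Fiber.isCompositionForm C y
  set e := tripleFrame (Fiber.of y a) (Fiber.of y b) (Fiber.of y c) with he
  have hof (j : Fin 7) : Fiber.of y (σ j : C.carrier) = e j := by
    have h0 : Fiber.of y (tripleFrame a b c j) = e j := by
      fin_cases j <;> simp [tripleFrame, he, Fiber.of_mul]
    have h1 : C.ip 1 (tripleFrame a b c j) y = 0 := by
      rw [← form_of, h0, Fiber.of_one, h.one_frame hB]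
    change Fiber.of y (_ - _) = _
    rw [Fiber.of_sub, Fiber.of_smul, h1, zero_smul, sub_zero, h0]
  have hcoord (x : C.imag) (j : Fin 7) : coord σ y x j = Fiber.form C y (Fiber.of y x) (e j) := by
    rw [← hof, form_of]; rfl
  have hsum (x : C.imag) : Fiber.of y (x : C.carrier) = ∑ j, coord σ y x j • e j := by
    have hx : Fiber.form C y 1 (Fiber.of y (x : C.carrier)) = 0 := by
      have h0 : C.bilin 1 (x : C.carrier) = 0 := x.2
      rw [← Fiber.of_one, form_of, ip, h0, smul_zero]; rfl
    conv_lhs => rw [h.eq_sum_frame hB (Fiber.finrank_eq C y) hx]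
    simp only [hcoord, he]
  refine ⟨fun i j => ?_, fun x z => ?_, fun x z w => ?_⟩
  · rw [← form_of, hof, hof, he, h.frame_orthonormal hB]
  · rw [← form_of, hsum x, hsum z]
    simp only [map_sum, LinearMap.sum_apply, map_smul, LinearMap.smul_apply, he,
      h.frame_orthonormal hB, smul_eq_mul, PiLp.inner_apply, RCLike.inner_apply, conj_trivial]
    simp
  · change C.ip _ _ y = _
    rw [← form_of, Fiber.of_mul, hsum x, hsum z, hsum w, phi0_eq_sum]
    simp only [Finset.sum_mul, Finset.mul_sum, map_sum, LinearMap.sum_apply, map_smul,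
      LinearMap.smul_apply, smul_mul_assoc, mul_smul_comm, he, h.frame_phi0 hB, smul_eq_mul]
    rw [Finset.sum_comm, Finset.sum_congr rfl fun j _ => Finset.sum_comm, Finset.sum_comm]
    refine Finset.sum_congr rfl fun i _ => Finset.sum_congr rfl fun j _ =>
      Finset.sum_congr rfl fun k _ => ?_
    ring

end OctonionAlgebra

end

section

open Filter Topology

/-! ### Global sections of vector bundles -/

theorem ContMDiffAt.euclidean_coord {EH H N : Type*} [NormedAddCommGroup EH] [NormedSpace ℝ EH]
    [TopologicalSpace H] {I : ModelWithCorners ℝ EH H} [TopologicalSpace N] [ChartedSpace H N]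
    {f : N → R7} {x : N} (hf : ContMDiffAt I 𝓘(ℝ, R7) ∞ f x) (j : Fin 7) :
    ContMDiffAt I 𝓘(ℝ) ∞ (fun y => f y j) x :=
  ((EuclideanSpace.proj j : R7 →L[ℝ] ℝ).contDiff.contDiffAt.contMDiffAt).comp x hf

namespace Rank7Bundle

variable {n : ℕ} {M : Type u} [TopologicalSpace M] [ChartedSpace (EuclideanSpace ℝ (Fin n)) M]

/-- A constant smooth function. -/
def constFun (n : ℕ) (M : Type u) [TopologicalSpace M]
    [ChartedSpace (EuclideanSpace ℝ (Fin n)) M] (t : ℝ) : SmoothFun n M :=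
  ⟨fun _ => t, contMDiff_const⟩

section Apply

variable (E : Rank7Bundle n M)

@[simp]
theorem smul_apply (f : SmoothFun n M) (s : E.Sections) (x : M) : (f • s) x = f x • s x := rfl

theorem sum_apply {ι : Type*} (t : Finset ι) (s : ι → E.Sections) (x : M) :
    (∑ i ∈ t, s i) x = ∑ i ∈ t, s i x := by
  induction t using Finset.cons_induction with
  | empty => rfl
  | cons a t ha ih => rw [Finset.sum_cons, Finset.sum_cons, ← ih]; rfl

end Apply

variable [IsManifold (𝓡 n) ∞ M] [T2Space M]

/-- Near every point the coordinates in the standard trivialization are the coefficients with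
respect to suitable global sections. -/
theorem exists_frame_sections (E : Rank7Bundle n M) (x : M) :
    ∃ l : Fin 7 → E.Sections, ∃ U : Set M, IsOpen U ∧ x ∈ U ∧
      U ⊆ (trivializationAt R7 E.fiber x).baseSet ∧ ∀ y ∈ U, ∀ v : E.fiber y,
        v = ∑ j, (trivializationAt R7 E.fiber x ⟨y, v⟩).2 j • l j y := by
  set e := trivializationAt R7 E.fiber x with he
  have hx : x ∈ e.baseSet := FiberBundle.mem_baseSet_trivializationAt' x
  obtain ⟨χ, -, hχ⟩ := (SmoothBumpFunction.nhds_basis_tsupport (I := 𝓡 n) x).mem_iff.1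
    (e.open_baseSet.mem_nhds hx)
  let b := (EuclideanSpace.basisFun (Fin 7) ℝ).toBasis
  -- The local frame is cut off by a bump function that is 1 near x, which makes its members global
  -- sections.
  refine ⟨fun j => ⟨fun y => χ y • e.localFrame b j y,
    ContMDiffOn.smul_section_of_tsupport χ.contMDiff.contMDiffOn e.open_baseSet hχ
      (e.contMDiffOn_localFrame_baseSet ∞ b j)⟩, ?_⟩
  obtain ⟨U, hU, hUo, hxU⟩ := eventually_nhds_iff.1
    (χ.eventuallyEq_one.and (e.open_baseSet.mem_nhds hx))
  refine ⟨U, hUo, hxU, fun y hy => (hU y hy).2, fun y hy v => ?_⟩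
  obtain ⟨h1, hyb⟩ := hU y hy
  have hrepr := (e.basisAt b hyb).sum_repr v
  conv_lhs => rw [← hrepr]
  refine Finset.sum_congr rfl fun j _ => ?_
  change _ = _ • (χ y • e.localFrame b j y)
  rw [h1, Pi.one_apply, one_smul, e.localFrame_apply_of_mem_baseSet b hyb]
  congr 1

theorem exists_section_eq (E : Rank7Bundle n M) {x : M} (v : E.fiber x) :
    ∃ s : E.Sections, s x = v := by
  obtain ⟨l, U, -, hx, -, h⟩ := E.exists_frame_sections x
  refine ⟨∑ j, constFun n M ((trivializationAt R7 E.fiber x ⟨x, v⟩).2 j) • l j, ?_⟩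
  rw [sum_apply]
  exact (h x hx v).symm

omit [IsManifold (𝓡 n) ∞ M] [T2Space M] in
theorem contMDiffAt_triv (E : Rank7Bundle n M) {x y : M} {s : ∀ y, E.fiber y}
    (hs : ContMDiffAt (𝓡 n) ((𝓡 n).prod 𝓘(ℝ, R7)) ∞
      (fun y => (⟨y, s y⟩ : TotalSpace R7 E.fiber)) y)
    (hy : y ∈ (trivializationAt R7 E.fiber x).baseSet) :
    ContMDiffAt (𝓡 n) 𝓘(ℝ, R7) ∞ (fun y => (trivializationAt R7 E.fiber x ⟨y, s y⟩).2) y :=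
  ((trivializationAt R7 E.fiber x).contMDiffAt_section_iff hy).1 hs

/-- The value at a point of the image of a section under a linear map of modules of sections
depends only on the value of the section at the point. -/
theorem map_apply_eq_zero {E E' : Rank7Bundle n M} (F : E.Sections →ₗ[SmoothFun n M] E'.Sections)
    {s : E.Sections} {x : M} (hs : s x = 0) : F s x = 0 := by
  obtain ⟨l, U, hU, hx, hUb, h⟩ := E.exists_frame_sections x
  obtain ⟨χ, -, hχ⟩ := (SmoothBumpFunction.nhds_basis_tsupport (I := 𝓡 n) x).mem_iff.1
    (hU.mem_nhds hx)
  -- Cut-off coordinates of s: they are globally smooth, vanish at x, and satisfy ψ s = ∑ cⱼ lⱼ on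
  -- all of M. Applying F to this identity and evaluating at x gives the claim, since ψ(x) = 1.
  let c (j : Fin 7) : SmoothFun n M :=
    ⟨fun y => χ y * (trivializationAt R7 E.fiber x ⟨y, s y⟩).2 j,
      contMDiff_of_tsupport fun y hy => χ.contMDiffAt.mul (by
        have := E.contMDiffAt_triv (s.contMDiff y) (hUb (hχ (tsupport_mul_subset_left hy)))
        exact this.euclidean_coord j)⟩
  let ψ : SmoothFun n M := ⟨χ, χ.contMDiff⟩
  have hψs : ψ • s = ∑ j, c j • l j := by
    ext1 y
    rw [sum_apply]
    change χ y • s y = ∑ j, (χ y * _) • l j y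
    by_cases hy : y ∈ U
    · conv_lhs => rw [h y hy (s y), Finset.smul_sum]
      simp only [smul_smul]
    · have h0 : χ y = 0 := image_eq_zero_of_notMem_tsupport fun h => hy (hχ h)
      simp [h0]
  have h1 : ψ x = 1 := χ.eq_one
  have h2 : (ψ • F s) x = 0 := by
    rw [← map_smul, hψs, map_sum, sum_apply]
    refine Finset.sum_eq_zero fun j _ => ?_
    rw [map_smul, smul_apply]
    have : c j x = 0 := by
      change χ x * _ = 0
      have h3 : (trivializationAt R7 E.fiber x ⟨x, s x⟩).2 = 0 := by
        rw [hs]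
        exact ((trivializationAt R7 E.fiber x).linearEquivAt ℝ x
          (FiberBundle.mem_baseSet_trivializationAt' x)).map_zero
      rw [h3]; simp
    rw [this, zero_smul]
  rwa [smul_apply, h1, one_smul] at h2

/-- A fibrewise linear map that carries smooth sections to smooth sections is smooth. -/
theorem contMDiff_totalSpace_map {E E' : Rank7Bundle n M} (T : ∀ x, E.fiber x →ₗ[ℝ] E'.fiber x)
    (hT : ∀ s : E.Sections, ContMDiff (𝓡 n) ((𝓡 n).prod 𝓘(ℝ, R7)) ∞
      (fun y => (⟨y, T y (s y)⟩ : TotalSpace R7 E'.fiber))) :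
    ContMDiff ((𝓡 n).prod 𝓘(ℝ, R7)) ((𝓡 n).prod 𝓘(ℝ, R7)) ∞
      (fun p : TotalSpace R7 E.fiber => (⟨p.1, T p.1 p.2⟩ : TotalSpace R7 E'.fiber)) := by
  intro p0
  set x := p0.1 with hxp
  obtain ⟨l, U, hU, hx, hUb, h⟩ := E.exists_frame_sections x
  set e := trivializationAt R7 E.fiber x
  set e' := trivializationAt R7 E'.fiber x
  have hx' : x ∈ e'.baseSet := FiberBundle.mem_baseSet_trivializationAt' x
  have hproj : ContMDiffAt ((𝓡 n).prod 𝓘(ℝ, R7)) (𝓡 n) ∞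
    (fun p : TotalSpace R7 E.fiber => p.1) p0 := contMDiff_proj E.fiber p0
  rw [e'.contMDiffAt_iff (by rw [e'.mem_source]; exact hx')]
  refine ⟨hproj, ?_⟩
  -- Near x, the map sends a vector with coordinates vⱼ to ∑ vⱼ T(lⱼ), and each T(lⱼ) is smooth by
  -- hypothesis.
  have hsum : ContMDiffAt ((𝓡 n).prod 𝓘(ℝ, R7)) 𝓘(ℝ, R7) ∞
      (fun p : TotalSpace R7 E.fiber => ∑ j, (e p).2 j • (e' ⟨p.1, T p.1 (l j p.1)⟩).2) p0 := by
    refine ContMDiffAt.sum fun j _ => ?_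
    have h1 : ContMDiffAt ((𝓡 n).prod 𝓘(ℝ, R7)) 𝓘(ℝ, R7) ∞
        (fun p : TotalSpace R7 E.fiber => (e p).2) p0 :=
      ((e.contMDiffAt_iff (f := id) (x₀ := p0) (by rw [id, e.mem_source]; exact hUb hx)).1
        contMDiffAt_id).2
    have h2 := ContMDiffAt.comp (g := fun y => (e' ⟨y, T y (l j y)⟩).2) p0
        (E'.contMDiffAt_triv (hT (l j) x) hx') hproj
    exact (h1.euclidean_coord j).smul h2
  refine hsum.congr_of_eventuallyEq ?_
  have hev : ∀ᶠ p : TotalSpace R7 E.fiber in 𝓝 p0, p.1 ∈ U ∩ e'.baseSet :=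
    hproj.continuousAt.eventually_mem ((hU.inter e'.open_baseSet).mem_nhds ⟨hx, hx'⟩)
  filter_upwards [hev] with p hp
  have hlin : ∀ v, (e' ⟨p.1, v⟩).2 = e'.linearEquivAt ℝ p.1 hp.2 v := fun v => rfl
  conv_lhs => rw [h p.1 hp.1 p.2]
  simp only [hlin, map_sum, map_smul]

variable {E E' : Rank7Bundle n M}

/-- The map of fibres induced by a linear map of modules of sections. -/
def fiberMap (F : E.Sections →ₗ[SmoothFun n M] E'.Sections) (x : M) :
    E.fiber x →ₗ[ℝ] E'.fiber x :=
  have key {s t : E.Sections} (h : s x = t x) : F s x = F t x := by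
    have h0 : (s - t) x = 0 := sub_eq_zero.2 h
    have := map_apply_eq_zero F h0
    rw [map_sub] at this
    exact sub_eq_zero.1 this
  { toFun v := F (E.exists_section_eq v).choose x
    map_add' v w := by
      have h := key (s := (E.exists_section_eq (v + w)).choose)
        (t := (E.exists_section_eq v).choose + (E.exists_section_eq w).choose) (by
          rw [(E.exists_section_eq (v + w)).choose_spec]
          exact congrArg₂ _ (E.exists_section_eq v).choose_spec.symm
            (E.exists_section_eq w).choose_spec.symm)
      rw [h, map_add]; rfl
    map_smul' t v := by
      have h := key (s := (E.exists_section_eq (t • v)).choose)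
        (t := constFun n M t • (E.exists_section_eq v).choose)
        (by
          rw [(E.exists_section_eq (t • v)).choose_spec]
          exact congrArg _ (E.exists_section_eq v).choose_spec.symm)
      rw [h, map_smul]; rfl }

theorem fiberMap_apply (F : E.Sections →ₗ[SmoothFun n M] E'.Sections) (s : E.Sections) (x : M) :
    fiberMap F x (s x) = F s x := by
  have h0 : ((E.exists_section_eq (s x)).choose - s) x = 0 :=
    sub_eq_zero.2 (E.exists_section_eq (s x)).choose_spec
  have := map_apply_eq_zero F h0
  rw [map_sub] at this
  exact sub_eq_zero.1 this

/-- An isomorphism of modules of sections comes from an isomorphism of vector bundles. -/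
def isoOfSections (F : E.Sections ≃ₗ[SmoothFun n M] E'.Sections) : Iso E E' where
  toEquiv x := LinearEquiv.ofLinearMap (fiberMap F.toLinearMap x) (fiberMap F.symm.toLinearMap x)
    (by
      ext v
      obtain ⟨s, rfl⟩ := E'.exists_section_eq v
      simp [fiberMap_apply])
    (by
      ext v
      obtain ⟨s, rfl⟩ := E.exists_section_eq v
      simp [fiberMap_apply])
  smooth_toEquiv := contMDiff_totalSpace_map (fun x => fiberMap F.toLinearMap x) fun s => by
    simpa only [fiberMap_apply, LinearEquiv.coe_coe] using (F s).contMDiff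
  smooth_symm := contMDiff_totalSpace_map (fun x => fiberMap F.symm.toLinearMap x) fun s => by
    simpa only [fiberMap_apply, LinearEquiv.coe_coe] using (F.symm s).contMDiff

theorem isoOfSections_apply (F : E.Sections ≃ₗ[SmoothFun n M] E'.Sections) (s : E.Sections)
    (x : M) : (isoOfSections F).toEquiv x (s x) = F s x := fiberMap_apply F.toLinearMap s x

end Rank7Bundle

end

section

open Filter Topology

/-! ### The vector bundle of imaginary elements of an octonion algebra -/

namespace OctonionAlgebra

variable {n : ℕ} {M : Type u} [TopologicalSpace M] [ChartedSpace (EuclideanSpace ℝ (Fin n)) M]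
  {C : OctonionAlgebra.{u, v} (SmoothFun n M)}

section Coord

variable (σ τ : Fin 7 → C.imag) {y : M}

theorem contMDiff_coord (a : C.imag) : ContMDiff (𝓡 n) 𝓘(ℝ, R7) ∞ fun y => coord σ y a := by
  have h : ContMDiff (𝓡 n) 𝓘(ℝ, Fin 7 → ℝ) ∞ fun y j => C.ip a (σ j) y :=
    contMDiff_pi_space.2 fun j => (C.ip a (σ j)).contMDiff
  exact (EuclideanSpace.equiv (Fin 7) ℝ).symm.contDiff.contMDiff.comp h

theorem ip_add_left (x y z : C.carrier) : C.ip (x + y) z = C.ip x z + C.ip y z := by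
  simp [ip]

theorem ip_smul_left (f : SmoothFun n M) (x z : C.carrier) : C.ip (f • x) z = f * C.ip x z := by
  simp [ip]

theorem coord_add (a b : C.imag) : coord σ y (a + b) = coord σ y a + coord σ y b := by
  ext j; simp [coord, ip_add_left]

theorem coord_smul (f : SmoothFun n M) (a : C.imag) : coord σ y (f • a) = f y • coord σ y a := by
  ext j; simp [coord, ip_smul_left]

variable {σ τ}

theorem IsAdaptedFrameAt.coord_frame (h : C.IsAdaptedFrameAt σ y) (j : Fin 7) :
    coord σ y (σ j) = EuclideanSpace.single j 1 := by
  ext i; simp [coord, h.orthonormal, eq_comm]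

theorem IsAdaptedFrameAt.coord_surjective (h : C.IsAdaptedFrameAt σ y) :
    Function.Surjective (coord σ y) := fun v => by
  refine ⟨∑ j, Rank7Bundle.constFun n M (v j) • σ j, ?_⟩
  have hs : ∀ s : Finset (Fin 7), coord σ y (∑ j ∈ s, Rank7Bundle.constFun n M (v j) • σ j) =
      ∑ j ∈ s, v j • EuclideanSpace.single j 1 := fun s => by
    induction s using Finset.cons_induction with
    | empty => ext j; simp [coord, ip]
    | cons a s ha ih =>
      rw [Finset.sum_cons, Finset.sum_cons, coord_add, ih, coord_smul, h.coord_frame]; rfl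
  rw [hs]
  ext j; simp [Pi.single_apply]

variable (σ τ y)

/-- The change of coordinates between two frames. -/
def frameChange : R7 →L[ℝ] R7 :=
  ∑ j, ContinuousLinearMap.smulRightL ℝ R7 R7 (EuclideanSpace.proj j) (coord τ y (σ j))

theorem contMDiff_frameChange :
    ContMDiff (𝓡 n) 𝓘(ℝ, R7 →L[ℝ] R7) ∞ fun y => frameChange σ τ y := by
  refine ContMDiff.sum fun j _ => ?_
  exact (ContinuousLinearMap.contDiff _).contMDiff.comp (contMDiff_coord τ (σ j))

variable {σ τ y}

/-- The coordinates in τ are the inner products of a with the members of τ; expand these in the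
orthonormal frame σ. Only σ has to be adapted. -/
theorem frameChange_coord (h : C.IsAdaptedFrameAt σ y) (a : C.imag) :
    frameChange σ τ y (coord σ y a) = coord τ y a := by
  ext i
  have h1 := h.ip_eq a (τ i)
  rw [PiLp.inner_apply] at h1
  change _ = C.ip a (τ i) y
  rw [h1, frameChange, sum_apply]
  simp [coord, C.ip_comm, mul_comm]

end Coord

/-- A system of local adapted frames. -/
structure FrameSystem (C : OctonionAlgebra.{u, v} (SmoothFun n M)) where
  frame : M → Fin 7 → C.imag
  nbhd : M → Set M
  isOpen_nbhd : ∀ p, IsOpen (nbhd p)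
  mem_nbhd : ∀ p, p ∈ nbhd p
  adapted : ∀ p, ∀ y ∈ nbhd p, C.IsAdaptedFrameAt (frame p) y

theorem exists_frameSystem [IsManifold (𝓡 n) ∞ M] [T2Space M] (hC : C.IsGloballyNonsplit) :
    Nonempty (FrameSystem C) := by
  choose σ hσ using fun p => exists_adaptedFrame hC p
  choose U hU hUo hm using fun p => eventually_nhds_iff.1 (hσ p)
  exact ⟨⟨σ, U, hUo, hm, hU⟩⟩

namespace FrameSystem

variable (S : FrameSystem C)

/-- The fibres of the bundle attached to a system of frames. -/
@[nolint unusedArguments]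
def Fiber (_ : FrameSystem C) (_ : M) : Type u := ULift.{u} R7

instance (x : M) : AddCommGroup (S.Fiber x) := ULift.addCommGroup
instance (x : M) : Module ℝ (S.Fiber x) := ULift.module'
instance (x : M) : TopologicalSpace (S.Fiber x) := ULift.topologicalSpace

/-- The change of coordinates between the frames at two points. -/
def change (p q y : M) : R7 →L[ℝ] R7 := frameChange (S.frame p) (S.frame q) y

theorem change_coord {p y : M} (q : M) (hp : y ∈ S.nbhd p) (a : C.imag) :
    S.change p q y (coord (S.frame p) y a) = coord (S.frame q) y a :=
  frameChange_coord (S.adapted p y hp) a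

/-- The cocycle identity: every vector of ℝ⁷ is the coordinate vector of an imaginary element, and
on such vectors a change of frame just re-expresses the element. -/
theorem change_change {p q y : M} (r : M) (hp : y ∈ S.nbhd p) (hq : y ∈ S.nbhd q) (v : R7) :
    S.change q r y (S.change p q y v) = S.change p r y v := by
  obtain ⟨a, rfl⟩ := (S.adapted p y hp).coord_surjective v
  rw [S.change_coord q hp, S.change_coord r hq, S.change_coord r hp]

theorem change_self {p y : M} (hp : y ∈ S.nbhd p) (v : R7) : S.change p p y v = v := by
  obtain ⟨a, rfl⟩ := (S.adapted p y hp).coord_surjective v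
  rw [S.change_coord p hp]

theorem inner_change {p q y : M} (hp : y ∈ S.nbhd p) (hq : y ∈ S.nbhd q) (v w : R7) :
    inner ℝ (S.change p q y v) (S.change p q y w) = inner ℝ v w := by
  obtain ⟨a, rfl⟩ := (S.adapted p y hp).coord_surjective v
  obtain ⟨b, rfl⟩ := (S.adapted p y hp).coord_surjective w
  rw [S.change_coord q hp, S.change_coord q hp, ← (S.adapted p y hp).ip_eq,
    ← (S.adapted q y hq).ip_eq]

/-- The local trivialization given by the frame at a point. -/
def pretriv (p : M) : Pretrivialization R7 (π R7 S.Fiber) where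
  -- A vector over y is stored in the frame chosen at y itself; the trivialization rewrites it in
  -- the frame chosen at p.
  toFun z := (z.1, S.change z.1 p z.1 z.2.down)
  invFun z := ⟨z.1, ULift.up (S.change p z.1 z.1 z.2)⟩
  source := π R7 S.Fiber ⁻¹' S.nbhd p
  target := S.nbhd p ×ˢ Set.univ
  map_source' z hz := ⟨hz, trivial⟩
  map_target' z hz := hz.1
  left_inv' := by
    rintro ⟨y, ⟨v⟩⟩ hy
    change (⟨y, ULift.up _⟩ : TotalSpace R7 S.Fiber) = _
    simp only
    rw [S.change_change y (S.mem_nbhd y) hy, S.change_self (S.mem_nbhd y)]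
  right_inv' := by
    rintro ⟨y, v⟩ hy
    change (y, _) = _
    simp only
    rw [S.change_change p hy.1 (S.mem_nbhd y), S.change_self hy.1]
  open_target := (S.isOpen_nbhd p).prod isOpen_univ
  baseSet := S.nbhd p
  open_baseSet := S.isOpen_nbhd p
  source_eq := rfl
  target_eq := rfl
  proj_toFun z hz := rfl

theorem pretriv_symm {p y : M} (hy : y ∈ S.nbhd p) (v : R7) :
    (S.pretriv p).symm y v = ULift.up (S.change p y y v) :=
  (S.pretriv p).symm_apply hy v

instance (p : M) : (S.pretriv p).IsLinear ℝ where
  linear y _ :=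
    { map_add := fun v w => map_add (S.change y p y) v.down w.down
      map_smul := fun t v => map_smul (S.change y p y) t v.down }

/-- The frame chosen at y need not vary continuously with y, but by the cocycle identity it cancels
in the transition function, which leaves the smooth matrix `S.change p q`. -/
theorem exists_contMDiff_change (p q : M) : ∃ f : M → R7 →L[ℝ] R7,
    ContMDiff (𝓡 n) 𝓘(ℝ, R7 →L[ℝ] R7) ∞ f ∧
      ∀ y ∈ (S.pretriv p).baseSet ∩ (S.pretriv q).baseSet, ∀ v,
        f y v = (S.pretriv q ⟨y, (S.pretriv p).symm y v⟩).2 := by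
  refine ⟨S.change p q, contMDiff_frameChange _ _, fun y hy v => ?_⟩
  rw [S.pretriv_symm hy.1]
  exact (S.change_change q hy.1 (S.mem_nbhd y) v).symm

/-- The prebundle attached to a system of frames. -/
def prebundle : VectorPrebundle ℝ R7 S.Fiber where
  pretrivializationAtlas := Set.range S.pretriv
  pretrivialization_linear' := by rintro _ ⟨p, rfl⟩; infer_instance
  pretrivializationAt := S.pretriv
  mem_base_pretrivializationAt := S.mem_nbhd
  pretrivialization_mem_atlas p := ⟨p, rfl⟩
  exists_coordChange := by
    rintro _ ⟨p, rfl⟩ _ ⟨q, rfl⟩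
    obtain ⟨f, hf, h⟩ := S.exists_contMDiff_change p q
    exact ⟨f, hf.continuous.continuousOn, h⟩
  totalSpaceMk_isInducing p := by
    have h : (S.pretriv p ∘ TotalSpace.mk p : S.Fiber p → M × R7) =
        (fun v => (p, v)) ∘ (ULift.down : ULift.{u} R7 → R7) := by
      funext v
      exact Prod.ext rfl (S.change_self (S.mem_nbhd p) v.down)
    rw [h]
    exact (isInducing_prodMkRight p).comp Homeomorph.ulift.isInducing

instance : S.prebundle.IsContMDiff (𝓡 n) ∞ where
  exists_contMDiffCoordChange := by
    rintro _ ⟨p, rfl⟩ _ ⟨q, rfl⟩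
    obtain ⟨f, hf, h⟩ := S.exists_contMDiff_change p q
    exact ⟨f, hf.contMDiffOn, h⟩

/-- The smooth vector bundle attached to a system of frames. -/
def bundle : Rank7Bundle n M :=
  letI := S.prebundle.totalSpaceTopology
  letI := S.prebundle.toFiberBundle
  letI := S.prebundle.toVectorBundle
  letI := S.prebundle.contMDiffVectorBundle (n := ∞) (𝓡 n)
  { fiber := S.Fiber }

/-- The local trivialization of the bundle given by the frame at a point. -/
def triv (p : M) : Trivialization R7 (π R7 S.bundle.fiber) :=
  S.prebundle.trivializationOfMemPretrivializationAtlas ⟨p, rfl⟩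

instance (p : M) : MemTrivializationAtlas (S.triv p) := ⟨⟨S.pretriv p, ⟨p, rfl⟩, rfl⟩⟩

end FrameSystem

end OctonionAlgebra

end

/-! ### Sections of the bundle of imaginary elements and its reduction -/

section

open Filter Topology

namespace OctonionAlgebra

variable {n : ℕ} {M : Type u} [TopologicalSpace M] [ChartedSpace (EuclideanSpace ℝ (Fin n)) M]
  {C : OctonionAlgebra.{u, v} (SmoothFun n M)}

theorem ip_add_right (x y z : C.carrier) : C.ip x (y + z) = C.ip x y + C.ip x z := by
  simp [ip]

theorem ip_smul_right (f : SmoothFun n M) (x z : C.carrier) : C.ip x (f • z) = f * C.ip x z := by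
  simp [ip]

theorem ip_one_one : C.ip 1 1 = 1 := by
  rw [ip, bilin_self, norm_one, mul_one, ← map_ofNat (algebraMap ℝ (SmoothFun n M)) 2,
    Algebra.algebraMap_eq_smul_one, smul_smul]
  norm_num

theorem ip_one_imag (a : C.imag) : C.ip 1 a = 0 := by
  have h0 : C.bilin 1 (a : C.carrier) = 0 := a.2
  rw [ip, h0, smul_zero]

theorem bilin_eq_two_smul_ip (x y : C.carrier) : C.bilin x y = (2 : ℝ) • C.ip x y := by
  rw [ip, smul_smul]; norm_num

variable (C) in
/-- The projection to the orthogonal complement of the unit as a linear map. -/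
def imagProjₗ : C.carrier →ₗ[SmoothFun n M] C.imag where
  toFun := imagProj
  map_add' x y := Subtype.ext <| by
    change x + y - _ • _ = (x - _ • _) + (y - _ • _)
    rw [ip_add_right, add_smul]; abel
  map_smul' f x := Subtype.ext <| by
    change f • x - _ • _ = f • (x - _ • _)
    rw [ip_smul_right, mul_smul, smul_sub]

theorem imagProjₗ_one : C.imagProjₗ 1 = 0 := Subtype.ext <| by
  change 1 - _ • _ = _
  rw [ip_one_one, one_smul, sub_self]; rfl

theorem imagProjₗ_coe (a : C.imag) : C.imagProjₗ a = a := Subtype.ext <| by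
  change (a : C.carrier) - _ • _ = _
  rw [ip_one_imag, zero_smul, sub_zero]

theorem eq_ip_smul_add_imagProj (x : C.carrier) : x = C.ip 1 x • 1 + C.imagProjₗ x := by
  change x = _ + (x - _ • _)
  abel

theorem imag_ext {a b : C.imag} (h : ∀ c : C.imag, C.ip a c = C.ip b c) : a = b := by
  refine Subtype.ext (C.ext_bilin fun z => ?_)
  rw [bilin_eq_two_smul_ip, bilin_eq_two_smul_ip, eq_ip_smul_add_imagProj z, ip_add_right,
    ip_add_right, ip_smul_right, ip_smul_right, C.ip_comm a 1, ip_one_imag, C.ip_comm b 1,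
    ip_one_imag, h]

namespace FrameSystem

variable (S : FrameSystem C)

/-- The fibres of the bundle attached to a system of frames are copies of `ℝ⁷`. -/
def val (x : M) : S.bundle.fiber x ≃ₗ[ℝ] R7 :=
  (ULift.moduleEquiv : ULift.{u} R7 ≃ₗ[ℝ] R7)

theorem contMDiffAt_section_iff {s : ∀ y, S.bundle.fiber y} {p x : M} (hx : x ∈ S.nbhd p) :
    ContMDiffAt (𝓡 n) ((𝓡 n).prod 𝓘(ℝ, R7)) ∞
      (fun y => (⟨y, s y⟩ : TotalSpace R7 S.bundle.fiber)) x ↔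
    ContMDiffAt (𝓡 n) 𝓘(ℝ, R7) ∞ (fun y => S.change y p y (S.val y (s y))) x :=
  (S.triv p).contMDiffAt_section_iff hx

theorem change_phi0 {p q y : M} (hp : y ∈ S.nbhd p) (hq : y ∈ S.nbhd q) (u v w : R7) :
    phi0 (S.change p q y u) (S.change p q y v) (S.change p q y w) = phi0 u v w := by
  obtain ⟨a, rfl⟩ := (S.adapted p y hp).coord_surjective u
  obtain ⟨b, rfl⟩ := (S.adapted p y hp).coord_surjective v
  obtain ⟨c, rfl⟩ := (S.adapted p y hp).coord_surjective w
  simp only [S.change_coord q hp]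
  rw [← (S.adapted p y hp).threeForm_eq, ← (S.adapted q y hq).threeForm_eq]

/-- The section of the bundle attached to an imaginary element. -/
def toSection : C.imag →ₗ[SmoothFun n M] S.bundle.Sections where
  toFun a := ⟨fun x => (S.val x).symm (coord (S.frame x) x a), fun x => by
    rw [S.contMDiffAt_section_iff (S.mem_nbhd x)]
    refine (contMDiff_coord (S.frame x) a).contMDiffAt.congr_of_eventuallyEq ?_
    filter_upwards [(S.isOpen_nbhd x).mem_nhds (S.mem_nbhd x)] with y hy
    rw [LinearEquiv.apply_symm_apply, S.change_coord x (S.mem_nbhd y)]⟩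
  map_add' a b := by
    ext1 x
    change (S.val x).symm _ = (S.val x).symm _ + (S.val x).symm _
    rw [coord_add, map_add]
  map_smul' f a := by
    ext1 x
    change (S.val x).symm _ = f x • (S.val x).symm _
    rw [coord_smul, map_smul]

theorem val_toSection (a : C.imag) (x : M) :
    S.val x (S.toSection a x) = coord (S.frame x) x a := (S.val x).apply_symm_apply _

theorem ip_eq (a b : C.imag) (x : M) :
    C.ip a b x = inner ℝ (S.val x (S.toSection a x)) (S.val x (S.toSection b x)) := by
  rw [val_toSection, val_toSection]
  exact (S.adapted x x (S.mem_nbhd x)).ip_eq a b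

theorem threeForm_eq (a b c : C.imag) (x : M) :
    C.threeForm a b c x = phi0 (S.val x (S.toSection a x)) (S.val x (S.toSection b x))
      (S.val x (S.toSection c x)) := by
  simp only [val_toSection]
  exact (S.adapted x x (S.mem_nbhd x)).threeForm_eq a b c

/-- The pairing of a section with imaginary elements. -/
def pairing (s : S.bundle.Sections) : C.imag →ₗ[SmoothFun n M] SmoothFun n M where
  toFun b := ⟨fun x => inner ℝ (S.val x (s x)) (coord (S.frame x) x b), fun x => by
    have h1 := (S.contMDiffAt_section_iff (S.mem_nbhd x)).1 (s.contMDiff x)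
    have h2 := (contMDiff_coord (S.frame x) b).contMDiffAt (x := x)
    have h3 := (contDiff_inner (𝕜 := ℝ) (E := R7) (n := ∞)).contMDiff.contMDiffAt.comp x
      (h1.prodMk_space h2)
    -- Changes of frame are isometries, so near x the pairing may be computed in the one frame
    -- chosen at x, where everything is smooth.
    refine h3.congr_of_eventuallyEq ?_
    filter_upwards [(S.isOpen_nbhd x).mem_nhds (S.mem_nbhd x)] with y hy
    rw [Function.comp_apply, ← S.change_coord x (S.mem_nbhd y) b,
      S.inner_change (S.mem_nbhd y) hy]⟩
  map_add' a b := by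
    ext x
    change inner ℝ (S.val x (s x)) (coord (S.frame x) x (a + b)) =
      inner ℝ (S.val x (s x)) (coord (S.frame x) x a) +
      inner ℝ (S.val x (s x)) (coord (S.frame x) x b)
    rw [coord_add, inner_add_right]
  map_smul' f a := by
    ext x
    change inner ℝ (S.val x (s x)) (coord (S.frame x) x (f • a)) =
      f x * inner ℝ (S.val x (s x)) (coord (S.frame x) x a)
    rw [coord_smul, inner_smul_right]

theorem toSection_injective : Function.Injective S.toSection := fun a b h => by
  refine imag_ext fun c => ?_
  ext x
  rw [ip_eq, ip_eq, h]

/-- The functional z ↦ 2⟨s, Im z⟩ on C is represented through the perfect form b, with the factor 2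
because b = 2⟨ , ⟩. Since it kills the unit, the representing element is imaginary. -/
theorem toSection_surjective : Function.Surjective S.toSection := fun s => by
  obtain ⟨a, ha⟩ := C.nondegenerate.2 ((2 : ℝ) • (S.pairing s ∘ₗ C.imagProjₗ))
  replace ha (z : C.carrier) : C.bilin a z = (2 : ℝ) • S.pairing s (C.imagProjₗ z) :=
    LinearMap.congr_fun ha z
  have ha1 : a ∈ C.imag := by
    change C.bilin 1 a = 0
    rw [bilin_comm, ha, imagProjₗ_one, map_zero, smul_zero]
  refine ⟨⟨a, ha1⟩, ContMDiffSection.ext fun x => (S.val x).injective ?_⟩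
  refine ext_inner_right ℝ fun v => ?_
  obtain ⟨b, rfl⟩ := (S.adapted x x (S.mem_nbhd x)).coord_surjective v
  have h := S.ip_eq ⟨a, ha1⟩ b x
  rw [S.val_toSection b] at h
  rw [← h, ip, ha, imagProjₗ_coe, smul_smul]
  norm_num
  rfl

/-- The imaginary elements are the sections of the bundle. -/
def sectionEquiv : C.imag ≃ₗ[SmoothFun n M] S.bundle.Sections :=
  LinearEquiv.ofBijective S.toSection ⟨S.toSection_injective, S.toSection_surjective⟩

variable [IsManifold (𝓡 n) ∞ M] [T2Space M]

/-- The frames adapted to the form `φ_C`. -/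
abbrev frames : Set S.bundle.Frame := S.bundle.adaptedFrames fun r s t =>
  C.threeForm (S.sectionEquiv.symm r) (S.sectionEquiv.symm s) (S.sectionEquiv.symm t)

/-- Under `val` the form φ_C on the fibre becomes φ₀, so a frame is adapted exactly when its matrix
stabilizes φ₀. -/
theorem mem_frames_iff {x : M} {w : R7 ≃ₗ[ℝ] S.bundle.fiber x} :
    (⟨x, w⟩ : S.bundle.Frame) ∈ S.frames ↔ w.trans (S.val x) ∈ G2 := by
  have key (r s t : S.bundle.Sections) : C.threeForm (S.sectionEquiv.symm r)
      (S.sectionEquiv.symm s) (S.sectionEquiv.symm t) x =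
      phi0 (S.val x (r x)) (S.val x (s x)) (S.val x (t x)) := by
    rw [S.threeForm_eq]
    have h (r) : S.toSection (S.sectionEquiv.symm r) = r := S.sectionEquiv.apply_symm_apply r
    rw [h, h, h]
  constructor
  · intro h u v t
    obtain ⟨r, hr⟩ := S.bundle.exists_section_eq (w u)
    obtain ⟨s, hs⟩ := S.bundle.exists_section_eq (w v)
    obtain ⟨q, hq⟩ := S.bundle.exists_section_eq (w t)
    have h1 := h r s q
    rw [key, hr, hs, hq] at h1
    simpa using h1
  · intro h r s t
    have h1 := h (w.symm (r x)) (w.symm (s x)) (w.symm (t x))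
    rw [key, ← h1]
    simp

theorem isG2Reduction : S.bundle.IsG2Reduction S.frames where
  act_mem x w hw g hg := by
    rw [mem_frames_iff] at hw ⊢
    exact mul_mem hw hg
  transitive x w w' hw hw' := by
    rw [mem_frames_iff] at hw hw'
    refine ⟨_, mul_mem (inv_mem hw) hw', ?_⟩
    ext v
    change _ = w (w.symm ((S.val x).symm (S.val x (w' v))))
    simp
  exists_local_section x := by
    classical
    let τ (y : M) (hy : y ∈ S.nbhd x) : R7 ≃ₗ[ℝ] R7 :=
      LinearEquiv.ofLinearMap (S.change x y y).toLinearMap (S.change y x y).toLinearMap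
        (by ext1 v; exact (S.change_change y (S.mem_nbhd y) hy v).trans
              (S.change_self (S.mem_nbhd y) v))
        (by ext1 v; exact (S.change_change x hy (S.mem_nbhd y) v).trans (S.change_self hy v))
    refine ⟨S.nbhd x, S.isOpen_nbhd x, S.mem_nbhd x,
      -- The local frame inverts the trivialization at x; its value off the neighbourhood is
      -- immaterial.
      fun y => if hy : y ∈ S.nbhd x then (τ y hy).trans (S.val y).symm else (S.val y).symm,
      fun y hy => ?_, fun e y hy => ?_⟩
    · simp only [dif_pos hy]
      rw [mem_frames_iff]
      intro u v w
      exact S.change_phi0 hy (S.mem_nbhd y) u v w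
    · refine ContMDiffAt.contMDiffWithinAt ?_
      rw [S.contMDiffAt_section_iff hy]
      refine (contMDiffAt_const (c := e)).congr_of_eventuallyEq ?_
      filter_upwards [(S.isOpen_nbhd x).mem_nhds hy] with z hz
      rw [dif_pos hz, LinearEquiv.trans_apply, LinearEquiv.apply_symm_apply]
      exact (S.change_change x hz (S.mem_nbhd z) e).trans (S.change_self hz e)

end FrameSystem

/-- The vector bundle of imaginary elements, with its `G₂`-reduction. -/
theorem exists_bundle [IsManifold (𝓡 n) ∞ M] [T2Space M] (hC : C.IsGloballyNonsplit) :
    ∃ (E : Rank7Bundle n M) (θ : C.imag ≃ₗ[SmoothFun n M] E.Sections),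
      E.IsG2Reduction (E.adaptedFrames
        fun r s t => C.threeForm (θ.symm r) (θ.symm s) (θ.symm t)) ∧
      ∀ x, ∃ w : R7 ≃ₗ[ℝ] E.fiber x, (⟨x, w⟩ : E.Frame) ∈ (E.adaptedFrames
        fun r s t => C.threeForm (θ.symm r) (θ.symm s) (θ.symm t)) ∧
        ∀ a b : C.imag, C.ip a b x = inner ℝ (w.symm (θ a x)) (w.symm (θ b x)) := by
  obtain ⟨S⟩ := exists_frameSystem hC
  refine ⟨S.bundle, S.sectionEquiv, S.isG2Reduction, fun x => ⟨(S.val x).symm, ?_, fun a b => ?_⟩⟩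
  · refine S.mem_frames_iff.2 ?_
    rw [LinearEquiv.symm_trans_self]
    exact one_mem G2
  · exact S.ip_eq a b x

end OctonionAlgebra

end

section

open Filter Topology MeasureTheory

/-! ### Finitely many spanning sections of a vector bundle -/

/-- The matrices whose rows are all orthogonal to some nonzero vector of a family depending on
fewer parameters than there are rows form a null set. -/
theorem volume_orthogonal_family_eq_zero {F ι κ : Type*} [NormedAddCommGroup F] [NormedSpace ℝ F]
    [FiniteDimensional ℝ F] [Fintype ι] [Fintype κ] (D : Set F) (η : F → ι → ℝ)
    (hη : ∀ d ∈ D, ContDiffAt ℝ 1 η d) (hF : Module.finrank ℝ F < Fintype.card κ) :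
    volume {A : κ × ι → ℝ | ∃ d ∈ D, η d ≠ 0 ∧ ∀ k, ∑ l, A (k, l) * η d l = 0} = 0 := by
  classical
  -- Where the entry l₀ of η d is nonzero, column l₀ of the matrix is determined by d and the other
  -- columns. So the exceptional set is a finite union of C¹ images of sets of dimension dim F +
  -- |κ|(|ι| - 1) < |κ||ι|.
  let Ψ (l₀ : ι) (z : F × (κ × {l // l ≠ l₀} → ℝ)) : κ × ι → ℝ := fun kl =>
    if h : kl.2 = l₀ then -(∑ l : {l // l ≠ l₀}, z.2 (kl.1, l) * η z.1 l) / η z.1 l₀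
    else z.2 (kl.1, ⟨kl.2, h⟩)
  let s (l₀ : ι) : Set (F × (κ × {l // l ≠ l₀} → ℝ)) := {z | z.1 ∈ D ∧ η z.1 l₀ ≠ 0}
  have hsub : {A : κ × ι → ℝ | ∃ d ∈ D, η d ≠ 0 ∧ ∀ k, ∑ l, A (k, l) * η d l = 0} ⊆
      ⋃ l₀, Ψ l₀ '' s l₀ := by
    rintro A ⟨d, hd, hne, hA⟩
    obtain ⟨l₀, hl₀⟩ := Function.ne_iff.1 hne
    refine Set.mem_iUnion.2 ⟨l₀, ⟨d, fun kl => A (kl.1, kl.2)⟩, ⟨hd, hl₀⟩, ?_⟩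
    funext ⟨k, l⟩
    simp only [Ψ]
    split_ifs with h
    · subst h
      have h1 := hA k
      rw [Fintype.sum_eq_add_sum_subtype_ne _ l] at h1
      rw [div_eq_iff hl₀]
      linarith
    · rfl
  refine measure_mono_null hsub (measure_iUnion_null fun l₀ => ?_)
  have hΨ : ∀ z ∈ s l₀, ContDiffAt ℝ 1 (Ψ l₀) z := by
    rintro z ⟨hz, hz0⟩
    rw [contDiffAt_pi]
    have h1 (l : ι) : ContDiffAt ℝ 1
        (fun z : F × (κ × {l // l ≠ l₀} → ℝ) => η z.1 l) z :=
      ContDiffAt.comp z (contDiffAt_pi.1 (hη z.1 hz) l) contDiffAt_fst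
    have h2 (kl : κ × {l // l ≠ l₀}) : ContDiffAt ℝ 1
        (fun z : F × (κ × {l // l ≠ l₀} → ℝ) => z.2 kl) z :=
      contDiffAt_pi.1 contDiffAt_snd kl
    intro kl
    simp only [Ψ]
    split_ifs with h
    · refine ContDiffAt.div ?_ (h1 l₀) hz0
      exact (ContDiffAt.sum fun l _ => (h2 (kl.1, l)).mul (h1 l)).neg
    · exact h2 _
  have hdim : dimH (Ψ l₀ '' s l₀) < ((Fintype.card (κ × ι) : NNReal) : ENNReal) := by
    refine (dimH_image_le_of_locally_lipschitzOn fun z hz => ?_).trans_lt ?_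
    · obtain ⟨K, t, ht, hK⟩ := (hΨ z hz).exists_lipschitzOnWith
      exact ⟨K, t, mem_nhdsWithin_of_mem_nhds ht, hK⟩
    · refine (dimH_mono (Set.subset_univ _)).trans_lt ?_
      rw [Real.dimH_univ_eq_finrank, Module.finrank_prod, Module.finrank_fintype_fun_eq_card,
        Fintype.card_prod, Fintype.card_prod]
      have h1 : Fintype.card {l // l ≠ l₀} + 1 = Fintype.card ι := by
        have : Fintype.card {l // l ≠ l₀} = Fintype.card ι - 1 := by
          rw [Fintype.card_subtype_compl, Fintype.card_subtype_eq]
        have h2 : 0 < Fintype.card ι := Fintype.card_pos_iff.2 ⟨l₀⟩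
        omega
      rw [← h1, mul_add, mul_one]
      norm_cast
      omega
  have h := hausdorffMeasure_of_dimH_lt hdim
  rwa [NNReal.coe_natCast, hausdorffMeasure_pi_real] at h

/-- Finite marginals of the product of uniform measures are Lebesgue measure on a cube. This allows
infinitely many random coefficients while each local condition involves only finitely many. -/
theorem ae_not_infinitePi_of_volume_eq_zero {ι : Type*} (J : Finset ι) {s : Set (J → ℝ)}
    (hs : volume s = 0) :
    ∀ᵐ A ∂Measure.infinitePi fun _ : ι => (volume : Measure ℝ).restrict (Set.Icc 0 1),
      (J.restrict A : J → ℝ) ∉ s := by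
  have : IsProbabilityMeasure ((volume : Measure ℝ).restrict (Set.Icc 0 1)) := ⟨by simp⟩
  refine measure_mono_null (t := J.restrict ⁻¹' s) (fun A hA => not_not.1 hA) ?_
  refine le_antisymm ((Measure.le_map_apply (by fun_prop) s).trans ?_) bot_le
  rw [Measure.infinitePi_map_restrict, ← Measure.restrict_pi_pi]
  exact (Measure.restrict_le_self s).trans hs.le

namespace Rank7Bundle

variable {n : ℕ} {M : Type u} [TopologicalSpace M] [ChartedSpace (EuclideanSpace ℝ (Fin n)) M]
  [IsManifold (𝓡 n) ∞ M] [T2Space M]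

theorem exists_locallyFinite_sections [SigmaCompactSpace M] (E : Rank7Bundle n M) :
    ∃ (ι : Type u) (t : ι → E.Sections), LocallyFinite (fun i => {x | t i x ≠ 0}) ∧
      ∀ x, Submodule.span ℝ (Set.range fun i => t i x) = ⊤ := by
  choose l U hU hxU _ hl using E.exists_frame_sections
  obtain ⟨ι, f, hf⟩ := SmoothBumpCovering.exists_isSubordinate (𝓡 n) (s := (Set.univ : Set M))
    isClosed_univ (U := U) fun x _ => (hU x).mem_nhds (hxU x)
  let g (i : ι) : SmoothFun n M := ⟨f i, (f i).contMDiff⟩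
  refine ⟨ι × Fin 7, fun i => g i.1 • l (f.c i.1) i.2, fun x => ?_, fun x => ?_⟩
  · obtain ⟨W, hW, hfin⟩ := f.locallyFinite x
    refine ⟨W, hW, (hfin.prod (Set.finite_univ (α := Fin 7))).subset ?_⟩
    rintro ⟨i, j⟩ ⟨y, hy, hyW⟩
    refine ⟨⟨y, fun h0 => hy ?_, hyW⟩, trivial⟩
    change f i y • l (f.c i) j y = 0
    rw [h0, zero_smul]
  · obtain ⟨i, hi⟩ := f.eventuallyEq_one' x trivial
    have h1 : f i x = 1 := hi.self_of_nhds
    have hx : x ∈ U (f.c i) := hf.support_subset i (by simp [h1])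
    refine eq_top_iff.2 fun v _ => ?_
    rw [hl (f.c i) x hx v]
    refine Submodule.sum_mem _ fun j _ => Submodule.smul_mem _ _ (Submodule.subset_span ⟨(i, j), ?_⟩)
    change f i x • l (f.c i) j x = _
    rw [h1, one_smul]

/-- A vector bundle has finitely many sections that span every fibre. -/
theorem exists_finite_sections [SecondCountableTopology M] (E : Rank7Bundle n M) :
    ∃ (k : ℕ) (t : Fin k → E.Sections), ∀ x, Submodule.span ℝ (Set.range fun i => t i x) = ⊤ := by
  classical
  have : LocallyCompactSpace M :=
    ChartedSpace.locallyCompactSpace (EuclideanSpace ℝ (Fin n)) M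
  obtain ⟨ι, t, hfin, hspan⟩ := E.exists_locallyFinite_sections
  -- The failure of spanning is parametrized by a point of M and a vector of ℝ⁷, so by n + 7
  -- parameters; one more section than that is enough.
  let k := n + 8
  let S (A : Fin k × ι → ℝ) (j : Fin k) : E.Sections :=
    ⟨fun x => ∑ᶠ i, A (j, i) • t i x,
      ContMDiff.finsum_section_of_locallyFinite
        (hfin.subset fun i x hx h0 => hx (by rw [h0, smul_zero]))
        fun i => (constFun n M (A (j, i)) • t i).contMDiff⟩
  have hloc (x : M) : ∃ W ∈ 𝓝 x,
      ∀ᵐ A ∂Measure.infinitePi fun _ : Fin k × ι => (volume : Measure ℝ).restrict (Set.Icc 0 1),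
        ∀ y ∈ W, Submodule.span ℝ (Set.range fun j => S A j y) = ⊤ := by
    set e := trivializationAt R7 E.fiber x
    obtain ⟨W', hW', hWfin⟩ := hfin x
    set J := hWfin.toFinset
    set c := chartAt (EuclideanSpace ℝ (Fin n)) x
    set W := W' ∩ e.baseSet ∩ c.source
    have hW : W ∈ 𝓝 x := inter_mem (inter_mem hW' (e.open_baseSet.mem_nhds
      (FiberBundle.mem_baseSet_trivializationAt' x))) (c.open_source.mem_nhds (mem_chart_source _ x))
    have hJ {y : M} (hy : y ∈ W) {i : ι} (hi : t i y ≠ 0) : i ∈ J :=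
      hWfin.mem_toFinset.2 ⟨y, hi, hy.1.1⟩
    -- For d = (point, ξ) these are the pairings of ξ with the sections tᵢ. If the combinations with
    -- coefficients A fail to span at y, some ξ ≠ 0 is orthogonal to them all: every row of A is
    -- orthogonal to η(y, ξ), which is nonzero because the tᵢ span.
    let η (d : EuclideanSpace ℝ (Fin n) × R7) (i : J) : ℝ :=
      inner ℝ d.2 (e ⟨c.symm d.1, t i (c.symm d.1)⟩).2
    let D : Set (EuclideanSpace ℝ (Fin n) × R7) := {d | d.1 ∈ c.target ∧ c.symm d.1 ∈ W}
    have hη : ∀ d ∈ D, ContDiffAt ℝ 1 η d := by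
      rintro d ⟨hd, hdW⟩
      rw [contDiffAt_pi]
      intro i
      have h1 : ContMDiffAt (𝓡 n) 𝓘(ℝ, R7) ∞ (fun y => (e ⟨y, t i y⟩).2) (c.symm d.1) :=
        E.contMDiffAt_triv ((t i).contMDiff _) hdW.1.2
      have h2 : ContMDiffAt (𝓡 n) (𝓡 n) ∞ c.symm d.1 :=
        (contMDiffOn_chart_symm (I := 𝓡 n) (x := x)).contMDiffAt (c.open_target.mem_nhds hd)
      have h3 : ContDiffAt ℝ ∞ (fun z => (e ⟨c.symm z, t i (c.symm z)⟩).2) d.1 :=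
        (h1.comp d.1 h2).contDiffAt
      exact (contDiffAt_snd.inner ℝ (h3.comp d contDiffAt_fst)).of_le (by simp)
    have hnull := volume_orthogonal_family_eq_zero (κ := Fin k) D η hη (by simp [k])
    let J' : Finset (Fin k × ι) := Finset.univ ×ˢ J
    let σ : J' ≃ Fin k × J :=
      { toFun jl := (jl.1.1, ⟨jl.1.2, (Finset.mem_product.1 jl.2).2⟩)
        invFun jl := ⟨(jl.1, jl.2), Finset.mem_product.2 ⟨Finset.mem_univ _, jl.2.2⟩⟩
        left_inv _ := rfl
        right_inv _ := rfl }
    have hr := (volume_preserving_arrowCongr' σ (MeasurableEquiv.refl ℝ)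
      (MeasurePreserving.id _)).quasiMeasurePreserving.preimage_null hnull
    refine ⟨W, hW, ?_⟩
    filter_upwards [ae_not_infinitePi_of_volume_eq_zero J' hr] with A hA y hy
    by_contra hne
    have hyb : y ∈ e.baseSet := hy.1.2
    let L : E.fiber y ≃ₗ[ℝ] R7 := e.linearEquivAt ℝ y hyb
    have hne' : (Submodule.span ℝ (Set.range fun j => S A j y)).map L.toLinearMap ≠ ⊤ := fun h =>
      hne (Submodule.map_injective_of_injective L.injective
        (h.trans (LinearMap.range_eq_top.2 L.surjective ▸ Submodule.map_top _).symm))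
    obtain ⟨ξ, hξ, hξ0⟩ := Submodule.exists_mem_ne_zero_of_ne_bot
      (mt (Submodule.orthogonal_eq_bot_iff).1 hne')
    have hS (j : Fin k) : inner ℝ ξ (L (S A j y)) = 0 :=
      Submodule.inner_left_of_mem_orthogonal
        (Submodule.mem_map_of_mem (Submodule.subset_span (Set.mem_range_self j))) hξ
    have hηy (i : J) : η (c y, ξ) i = inner ℝ ξ (L (t i y)) := by
      simp only [η]
      rw [c.left_inv hy.2]
      rfl
    have hD : (c y, ξ) ∈ D := ⟨c.map_source hy.2, (c.left_inv hy.2).symm ▸ hy⟩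
    replace hA : ¬∃ d ∈ D, η d ≠ 0 ∧ ∀ k, ∑ l : J, A (k, l) * η d l = 0 := hA
    refine hA ⟨(c y, ξ), hD, fun h0 => hξ0 ?_, fun j => ?_⟩
    · have h1 : (⊤ : Submodule ℝ (E.fiber y)) ≤ LinearMap.ker ((innerₛₗ ℝ ξ) ∘ₗ L.toLinearMap) := by
        rw [← hspan y, Submodule.span_le]
        rintro _ ⟨i, rfl⟩
        by_cases hi : t i y = 0
        · simp [hi]
        · exact (hηy ⟨i, hJ hy hi⟩).symm.trans (congrFun h0 _)
      have h2 := h1 (Submodule.mem_top (x := L.symm ξ))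
      rw [LinearMap.mem_ker] at h2
      simpa using h2
    · have h1 : S A j y = ∑ i ∈ J, A (j, i) • t i y :=
        finsum_eq_sum_of_support_subset _ fun i hi => hJ hy fun h0 => hi (by
          change A (j, i) • t i y = 0
          rw [h0, smul_zero])
      have h2 := hS j
      rw [h1, map_sum, inner_sum, ← Finset.sum_coe_sort] at h2
      rw [← h2]
      refine Finset.sum_congr rfl fun i _ => ?_
      rw [hηy, map_smul, inner_smul_right]
  choose W hW hS using hloc
  -- Second countability leaves countably many null sets to avoid, so one choice of A works on all
  -- of M.
  obtain ⟨c, hc, hcW⟩ := TopologicalSpace.countable_cover_nhds hW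
  have : IsProbabilityMeasure ((volume : Measure ℝ).restrict (Set.Icc 0 1)) := ⟨by simp⟩
  have hall : ∀ᵐ A ∂Measure.infinitePi fun _ : Fin k × ι =>
      (volume : Measure ℝ).restrict (Set.Icc 0 1),
      ∀ x ∈ c, ∀ y ∈ W x, Submodule.span ℝ (Set.range fun j => S A j y) = ⊤ :=
    (ae_ball_iff hc).2 fun x _ => hS x
  obtain ⟨A, hA⟩ := hall.exists
  refine ⟨k, S A, fun y => ?_⟩
  obtain ⟨x, hx, hy⟩ := Set.mem_iUnion₂.1 (hcW ▸ Set.mem_univ y)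
  exact hA x hx y hy

end Rank7Bundle

end

/-! ### Octonion algebras from vector products -/

/-- A vector product on a module with a symmetric bilinear form. -/
structure VectorProduct (R : Type u) (V : Type v) [CommRing R] [AddCommGroup V] [Module R V] where
  ip : V →ₗ[R] V →ₗ[R] R
  cross : V →ₗ[R] V →ₗ[R] V
  ip_comm : ∀ x y, ip x y = ip y x
  ip_cross_left : ∀ x y, ip (cross x y) x = 0
  ip_cross_right : ∀ x y, ip (cross x y) y = 0
  ip_cross_self : ∀ x y, ip (cross x y) (cross x y) = ip x x * ip y y - ip x y ^ 2

namespace VectorProduct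

variable {R : Type u} {V : Type v} [CommRing R] [AddCommGroup V] [Module R V]

/-- The module `R ⊕ V` underlying the algebra attached to a vector product. -/
@[nolint unusedArguments]
def Carrier (_ : VectorProduct R V) : Type (max u v) := R × V

variable (T : VectorProduct R V)

/-- The element `r + x` of the algebra attached to a vector product. -/
def pair (r : R) (x : V) : T.Carrier := (r, x)

instance : AddCommGroup T.Carrier := inferInstanceAs (AddCommGroup (R × V))
instance : Module R T.Carrier := inferInstanceAs (Module R (R × V))
instance : One T.Carrier := ⟨T.pair 1 0⟩
instance : Mul T.Carrier :=
  ⟨fun x y => T.pair (x.1 * y.1 - T.ip x.2 y.2) (x.1 • y.2 + y.1 • x.2 + T.cross x.2 y.2)⟩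

variable {T}

@[ext] theorem Carrier.ext {x y : T.Carrier} (h1 : x.1 = y.1) (h2 : x.2 = y.2) : x = y :=
  Prod.ext h1 h2

@[simp] theorem pair_fst (r : R) (x : V) : (T.pair r x).1 = r := rfl
@[simp] theorem pair_snd (r : R) (x : V) : (T.pair r x).2 = x := rfl
@[simp] theorem add_fst (x y : T.Carrier) : (x + y).1 = x.1 + y.1 := rfl
@[simp] theorem add_snd (x y : T.Carrier) : (x + y).2 = x.2 + y.2 := rfl
@[simp] theorem zero_fst : (0 : T.Carrier).1 = 0 := rfl
@[simp] theorem zero_snd : (0 : T.Carrier).2 = 0 := rfl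
@[simp] theorem one_fst : (1 : T.Carrier).1 = 1 := rfl
@[simp] theorem one_snd : (1 : T.Carrier).2 = 0 := rfl
@[simp] theorem smul_fst (r : R) (x : T.Carrier) : (r • x).1 = r * x.1 := rfl
@[simp] theorem smul_snd (r : R) (x : T.Carrier) : (r • x).2 = r • x.2 := rfl
@[simp] theorem mul_fst (x y : T.Carrier) : (x * y).1 = x.1 * y.1 - T.ip x.2 y.2 := rfl
@[simp] theorem mul_snd (x y : T.Carrier) :
    (x * y).2 = x.1 • y.2 + y.1 • x.2 + T.cross x.2 y.2 := rfl

instance : NonAssocRing T.Carrier where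
  left_distrib x y z := by
    ext
    · simp; ring
    · simp [add_smul]; abel
  right_distrib x y z := by
    ext
    · simp; ring
    · simp [add_smul]; abel
  zero_mul x := by ext <;> simp
  mul_zero x := by ext <;> simp
  one_mul x := by ext <;> simp
  mul_one x := by ext <;> simp

instance : IsScalarTower R T.Carrier T.Carrier where
  smul_assoc r x y := by
    ext
    · simp; ring
    · simp [mul_smul, smul_comm y.1 r]

instance : SMulCommClass R T.Carrier T.Carrier where
  smul_comm r x y := by
    ext
    · simp; ring
    · simp [mul_smul, smul_comm x.1 r]

variable (T)

/-- The bilinear form `(r, x), (s, y) ↦ r s + ⟨x, y⟩`. -/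
def form : LinearMap.BilinForm R T.Carrier :=
  LinearMap.mk₂ R (fun x y => x.1 * y.1 + T.ip x.2 y.2)
    (fun x y z => by simp; ring) (fun r x y => by simp; ring)
    (fun x y z => by simp; ring) (fun r x y => by simp; ring)

theorem form_apply (x y : T.Carrier) : T.form x y = x.1 * y.1 + T.ip x.2 y.2 := rfl

/-- The mixed terms ±2rs⟨x, y⟩ cancel, the products of x × y with x and y vanish, and |x × y|²
restores the term lost to ⟨x, y⟩². -/
theorem form_mul (x y : T.Carrier) :
    T.form (x * y) (x * y) = T.form x x * T.form y y := by
  simp only [form_apply, mul_fst, mul_snd, map_add, map_smul, LinearMap.add_apply,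
    LinearMap.smul_apply, smul_eq_mul, T.ip_cross_self, T.ip_cross_left, T.ip_cross_right,
    T.ip_comm _ (T.cross _ _), T.ip_comm y.2 x.2]
  ring

theorem polarBilin_form (x z : T.Carrier) :
    QuadraticMap.polarBilin (LinearMap.BilinMap.toQuadraticMap T.form) x z =
      2 * (x.1 * z.1 + T.ip x.2 z.2) := by
  rw [LinearMap.BilinMap.polarBilin_toQuadraticMap]
  simp only [LinearMap.add_apply, LinearMap.flip_apply, form_apply, T.ip_comm z.2]
  ring

theorem linearCombination_comp_ip {k : ℕ} {t y : Fin k → V}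
    (hty : ∀ x, x = ∑ i, T.ip x (y i) • t i) :
    (Fintype.linearCombination R t) ∘ₗ LinearMap.pi (fun i => T.ip.flip (y i)) =
      LinearMap.id := by
  ext x
  simpa [Fintype.linearCombination_apply] using (hty x).symm

theorem projective_of_dual {k : ℕ} {t y : Fin k → V} (hty : ∀ x, x = ∑ i, T.ip x (y i) • t i) :
    Module.Projective R V :=
  .of_split _ _ (T.linearCombination_comp_ip hty)

theorem finite_of_dual {k : ℕ} {t y : Fin k → V} (hty : ∀ x, x = ∑ i, T.ip x (y i) • t i) :
    Module.Finite R V :=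
  .of_surjective (Fintype.linearCombination R t)
    fun x => ⟨_, LinearMap.congr_fun (T.linearCombination_comp_ip hty) x⟩

/-- The octonion algebra attached to a vector product on a module of rank `7` with a finite dual
basis. -/
def octonionAlgebra (h2 : IsUnit (2 : R)) {k : ℕ} (t y : Fin k → V)
    (hty : ∀ x, x = ∑ i, T.ip x (y i) • t i)
    (hrank : ∀ p : PrimeSpectrum R, Module.rankAtStalk (R := R) V p = 7) :
    OctonionAlgebra.{u, max u v} R :=
  have := T.projective_of_dual hty
  have := T.finite_of_dual hty
  { carrier := T.Carrier
    finite := inferInstanceAs (Module.Finite R (R × V))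
    projective := inferInstanceAs (Module.Projective R (R × V))
    rank_eq := fun p => by
      have : Nontrivial R := p.nontrivial
      have h := Module.rankAtStalk_prod (R := R) (M := R) V
      have h' := congrFun h p
      rw [Pi.add_apply, Module.rankAtStalk_self, hrank] at h'
      exact h'
    norm := LinearMap.BilinMap.toQuadraticMap T.form
    nondegenerate := by
      obtain ⟨u, hu⟩ := h2
      constructor
      · refine (injective_iff_map_eq_zero (QuadraticMap.polarBilin
          (LinearMap.BilinMap.toQuadraticMap T.form))).2 fun x hx => ?_
        have h (z : T.Carrier) : x.1 * z.1 + T.ip x.2 z.2 = 0 := by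
          have := LinearMap.congr_fun hx z
          rw [polarBilin_form, ← hu] at this
          simpa using this
        ext
        · simpa using h 1
        · rw [hty x.2]
          refine Finset.sum_eq_zero fun i _ => ?_
          have := h (T.pair 0 (y i))
          simp only [pair_fst, pair_snd, mul_zero, zero_add] at this
          rw [this, zero_smul]
      · intro f
        let g : V →ₗ[R] R := f ∘ₗ LinearMap.inr R R V
        -- The dual basis represents the restriction of f to V by ∑ g(tᵢ) yᵢ; the polar form is
        -- twice `form`, hence the division by 2.
        refine ⟨T.pair (↑u⁻¹ * f 1) ((↑u⁻¹ : R) • ∑ i, g (t i) • y i), ?_⟩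
        ext z
        have h1 : f z = z.1 * f 1 + g z.2 := by
          have : z = z.1 • (1 : T.Carrier) + T.pair 0 z.2 := by
            ext <;> simp
          conv_lhs => rw [this]
          rw [map_add, map_smul]
          rfl
        have h3 : g z.2 = ∑ i, g (t i) * T.ip (y i) z.2 := by
          conv_lhs => rw [hty z.2]
          simp only [map_sum, map_smul, smul_eq_mul, T.ip_comm _ (y _), mul_comm]
        rw [polarBilin_form, h1, h3]
        simp only [pair_fst, pair_snd, map_smul, map_sum, LinearMap.smul_apply, LinearMap.sum_apply, smul_eq_mul]
        rw [← hu]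
        linear_combination (z.1 * f 1 + ∑ i, g (t i) * T.ip (y i) z.2) * u.mul_inv
    norm_mul := T.form_mul }

theorem octonionAlgebra_bilin (h2 : IsUnit (2 : R)) {k : ℕ} (t y : Fin k → V)
    (hty : ∀ x, x = ∑ i, T.ip x (y i) • t i)
    (hrank : ∀ p : PrimeSpectrum R, Module.rankAtStalk (R := R) V p = 7) (x z : T.Carrier) :
    (T.octonionAlgebra h2 t y hty hrank).bilin x z = 2 * (x.1 * z.1 + T.ip x.2 z.2) :=
  T.polarBilin_form x z

end VectorProduct

section

open Filter Topology

/-! ### The vector product of a formal `G₂`-structure -/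

namespace Rank7Bundle

variable {n : ℕ} {M : Type u} [TopologicalSpace M] [ChartedSpace (EuclideanSpace ℝ (Fin n)) M]

/-- The solution of a system of linear equations depends smoothly on the system. -/
theorem contMDiffAt_of_eventually_apply_eq {B : M → R7 →L[ℝ] R7} {v c : M → R7} {x : M}
    (hB : ContMDiffAt (𝓡 n) 𝓘(ℝ, R7 →L[ℝ] R7) ∞ B x) (hc : ContMDiffAt (𝓡 n) 𝓘(ℝ, R7) ∞ c x)
    (hv : ∀ᶠ y in 𝓝 x, B y (v y) = c y) (hinj : Function.Injective (B x)) :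
    ContMDiffAt (𝓡 n) 𝓘(ℝ, R7) ∞ v x := by
  let e : R7 ≃L[ℝ] R7 :=
    (LinearEquiv.ofInjectiveEndo (B x).toLinearMap hinj).toContinuousLinearEquiv
  have he : (e : R7 →L[ℝ] R7) = B x := by ext1 z; rfl
  have h1 : ContMDiffAt (𝓡 n) 𝓘(ℝ, R7 →L[ℝ] R7) ∞ (fun y => (B y).inverse) x := by
    have h2 : ContDiffAt ℝ ∞ ContinuousLinearMap.inverse (B x) := he ▸ contDiffAt_map_inverse e
    exact h2.contMDiffAt.comp x hB
  refine (h1.clm_apply hc).congr_of_eventuallyEq ?_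
  have h3 : ∀ᶠ y in 𝓝 x, B y ∈ Set.range ((↑) : (R7 ≃L[ℝ] R7) → R7 →L[ℝ] R7) :=
    hB.continuousAt.eventually_mem (he ▸ ContinuousLinearEquiv.nhds e)
  filter_upwards [hv, h3] with y hy ⟨e', he'⟩
  rw [← hy, ← he', ContinuousLinearMap.inverse_equiv]
  simp

/-- The coordinates of a smooth section in a smooth frame are smooth. -/
theorem contMDiffAt_frame_symm {E : Rank7Bundle n M} {σ : ∀ y, R7 ≃ₗ[ℝ] E.fiber y} {U : Set M}
    (hU : IsOpen U) (hσ : ∀ e : R7, ContMDiffOn (𝓡 n) ((𝓡 n).prod 𝓘(ℝ, R7)) ∞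
      (fun y => (⟨y, σ y e⟩ : TotalSpace R7 E.fiber)) U)
    {s : ∀ y, E.fiber y} {x : M} (hx : x ∈ U)
    (hs : ContMDiffAt (𝓡 n) ((𝓡 n).prod 𝓘(ℝ, R7)) ∞
      (fun y => (⟨y, s y⟩ : TotalSpace R7 E.fiber)) x) :
    ContMDiffAt (𝓡 n) 𝓘(ℝ, R7) ∞ (fun y => (σ y).symm (s y)) x := by
  set e := trivializationAt R7 E.fiber x
  have hx' : x ∈ e.baseSet := FiberBundle.mem_baseSet_trivializationAt' x
  let B (y : M) : R7 →L[ℝ] R7 := ∑ j, ContinuousLinearMap.smulRightL ℝ R7 R7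
    (EuclideanSpace.proj j) (e ⟨y, σ y (EuclideanSpace.single j 1)⟩).2
  have hBe {y : M} (hy : y ∈ e.baseSet) (v : R7) : B y v = e.linearEquivAt ℝ y hy (σ y v) := by
    have hv : v = ∑ j, v j • EuclideanSpace.single j (1 : ℝ) := by
      ext j; simp [Pi.single_apply]
    conv_rhs => rw [hv]
    simp only [B, map_sum, map_smul]
    rfl
  refine contMDiffAt_of_eventually_apply_eq (B := B) ?_ (E.contMDiffAt_triv (x := x) hs hx') ?_ ?_
  · refine ContMDiffAt.sum fun j _ => ?_
    exact (ContinuousLinearMap.contDiff _).contMDiff.contMDiffAt.comp x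
      (E.contMDiffAt_triv ((hσ _).contMDiffAt (hU.mem_nhds hx)) hx')
  · filter_upwards [e.open_baseSet.mem_nhds hx'] with y hy
    rw [hBe hy, LinearEquiv.apply_symm_apply]
    rfl
  · have : ⇑(B x) = fun v => e.linearEquivAt ℝ x hx' (σ x v) := funext (hBe hx')
    rw [this]
    exact (e.linearEquivAt ℝ x hx').injective.comp (σ x).injective

/-- A section with smooth coordinates in a smooth frame is smooth. -/
theorem contMDiffAt_of_frame_symm {E : Rank7Bundle n M} {σ : ∀ y, R7 ≃ₗ[ℝ] E.fiber y} {U : Set M}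
    (hU : IsOpen U) (hσ : ∀ e : R7, ContMDiffOn (𝓡 n) ((𝓡 n).prod 𝓘(ℝ, R7)) ∞
      (fun y => (⟨y, σ y e⟩ : TotalSpace R7 E.fiber)) U)
    {s : ∀ y, E.fiber y} {x : M} (hx : x ∈ U)
    (hs : ContMDiffAt (𝓡 n) 𝓘(ℝ, R7) ∞ (fun y => (σ y).symm (s y)) x) :
    ContMDiffAt (𝓡 n) ((𝓡 n).prod 𝓘(ℝ, R7)) ∞
      (fun y => (⟨y, s y⟩ : TotalSpace R7 E.fiber)) x := by
  have h : ContMDiffAt (𝓡 n) ((𝓡 n).prod 𝓘(ℝ, R7)) ∞ (fun y => (⟨y, ∑ j : Fin 7,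
      (σ y).symm (s y) j • σ y (EuclideanSpace.single j 1)⟩ : TotalSpace R7 E.fiber)) x :=
    ContMDiffAt.sum_section fun j _ => (hs.euclidean_coord j).smul_section
      ((hσ _).contMDiffAt (hU.mem_nhds hx))
  convert h using 3 with y
  have hv (v : R7) : v = ∑ j, v j • EuclideanSpace.single j (1 : ℝ) := by
    ext j; simp [Pi.single_apply]
  conv_lhs => rw [← (σ y).apply_symm_apply (s y), hv ((σ y).symm (s y)), map_sum]
  simp only [map_smul]

namespace IsG2Reduction

variable {E : Rank7Bundle n M} {P : Set E.Frame} (hP : E.IsG2Reduction P)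

include hP in
theorem exists_frame (x : M) : ∃ w : R7 ≃ₗ[ℝ] E.fiber x, (⟨x, w⟩ : E.Frame) ∈ P := by
  obtain ⟨U, -, hx, σ, hσ, -⟩ := hP.exists_local_section x
  exact ⟨σ x, hσ x hx⟩

/-- The inner product on a fibre. -/
def fiberForm (x : M) : E.fiber x →ₗ[ℝ] E.fiber x →ₗ[ℝ] ℝ :=
  (innerₗ R7).compl₁₂ (hP.exists_frame x).choose.symm.toLinearMap
    (hP.exists_frame x).choose.symm.toLinearMap

/-- The vector product on a fibre. -/
def fiberCross (x : M) (u v : E.fiber x) : E.fiber x :=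
  (hP.exists_frame x).choose (cross7 ((hP.exists_frame x).choose.symm u)
    ((hP.exists_frame x).choose.symm v))

/-- Independence of the chosen frame: two frames in P over x differ by an element of G₂, hence by an
isometry. Smoothness can then be tested in smooth local frames. -/
theorem fiberForm_eq {x : M} {w : R7 ≃ₗ[ℝ] E.fiber x} (hw : (⟨x, w⟩ : E.Frame) ∈ P)
    (u v : E.fiber x) : hP.fiberForm x u v = inner ℝ (w.symm u) (w.symm v) := by
  obtain ⟨g, hg, h⟩ := hP.transitive x w _ hw (hP.exists_frame x).choose_spec
  rw [← G2.inner_map_map (inv_mem hg)]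
  change inner ℝ ((hP.exists_frame x).choose.symm u) ((hP.exists_frame x).choose.symm v) = _
  rw [h]
  rfl

theorem symm_fiberCross {x : M} {w : R7 ≃ₗ[ℝ] E.fiber x} (hw : (⟨x, w⟩ : E.Frame) ∈ P)
    (u v : E.fiber x) : w.symm (hP.fiberCross x u v) = cross7 (w.symm u) (w.symm v) := by
  obtain ⟨g, hg, h⟩ := hP.transitive x w _ hw (hP.exists_frame x).choose_spec
  rw [fiberCross, h, LinearEquiv.trans_apply, LinearEquiv.symm_apply_apply,
    ← G2.cross7_map_map hg]
  simp

theorem contMDiff_fiberForm (r s : E.Sections) :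
    ContMDiff (𝓡 n) 𝓘(ℝ) ∞ fun x => hP.fiberForm x (r x) (s x) := fun x => by
  obtain ⟨U, hU, hx, σ, hσP, hσ⟩ := hP.exists_local_section x
  have h1 := contMDiffAt_frame_symm hU hσ hx (r.contMDiff x)
  have h2 := contMDiffAt_frame_symm hU hσ hx (s.contMDiff x)
  refine ((contDiff_inner (𝕜 := ℝ) (E := R7) (n := ∞)).contMDiff.contMDiffAt.comp x
      (h1.prodMk_space h2)).congr_of_eventuallyEq ?_
  filter_upwards [hU.mem_nhds hx] with y hy
  exact hP.fiberForm_eq (hσP y hy) _ _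

theorem contMDiff_fiberCross (r s : E.Sections) :
    ContMDiff (𝓡 n) ((𝓡 n).prod 𝓘(ℝ, R7)) ∞
      fun x => (⟨x, hP.fiberCross x (r x) (s x)⟩ : TotalSpace R7 E.fiber) := fun x => by
  obtain ⟨U, hU, hx, σ, hσP, hσ⟩ := hP.exists_local_section x
  have h1 := contMDiffAt_frame_symm hU hσ hx (r.contMDiff x)
  have h2 := contMDiffAt_frame_symm hU hσ hx (s.contMDiff x)
  refine contMDiffAt_of_frame_symm hU hσ hx ((contDiff_cross7.contMDiff.contMDiffAt.comp x
      (h1.prodMk_space h2)).congr_of_eventuallyEq ?_)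
  filter_upwards [hU.mem_nhds hx] with y hy
  exact hP.symm_fiberCross (hσP y hy) _ _

theorem fiberForm_comm {x : M} (u v : E.fiber x) : hP.fiberForm x u v = hP.fiberForm x v u := by
  obtain ⟨w, hw⟩ := hP.exists_frame x
  rw [hP.fiberForm_eq hw, hP.fiberForm_eq hw, real_inner_comm]

theorem fiberForm_self_eq_zero {x : M} {u : E.fiber x} (h : hP.fiberForm x u u = 0) : u = 0 := by
  obtain ⟨w, hw⟩ := hP.exists_frame x
  rw [hP.fiberForm_eq hw, inner_self_eq_zero] at h
  exact w.symm.map_eq_zero_iff.1 h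

/-- The vector product on the sections. -/
def vectorProduct : VectorProduct (SmoothFun n M) E.Sections where
  ip := LinearMap.mk₂ _ (fun r s => ⟨fun x => hP.fiberForm x (r x) (s x),
      hP.contMDiff_fiberForm r s⟩)
    (fun r s t => by ext x; exact LinearMap.map_add₂ (hP.fiberForm x) (r x) (s x) (t x))
    (fun f r s => by ext x; exact LinearMap.map_smul₂ (hP.fiberForm x) (f x) (r x) (s x))
    (fun r s t => by ext x; exact map_add (hP.fiberForm x (r x)) (s x) (t x))
    (fun f r s => by ext x; exact map_smul (hP.fiberForm x (r x)) (f x) (s x))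
  cross := LinearMap.mk₂ _ (fun r s => ⟨fun x => hP.fiberCross x (r x) (s x),
      hP.contMDiff_fiberCross r s⟩)
    (fun r s t => by
      ext x
      change hP.fiberCross x (r x + s x) (t x) = hP.fiberCross x _ _ + hP.fiberCross x _ _
      simp only [fiberCross, map_add, cross7_add_left])
    (fun f r s => by
      ext x
      change hP.fiberCross x (f x • r x) (s x) = f x • hP.fiberCross x _ _
      simp only [fiberCross, map_smul, cross7_smul_left])
    (fun r s t => by
      ext x
      change hP.fiberCross x (r x) (s x + t x) = hP.fiberCross x _ _ + hP.fiberCross x _ _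
      simp only [fiberCross, map_add, cross7_add_right])
    (fun f r s => by
      ext x
      change hP.fiberCross x (r x) (f x • s x) = f x • hP.fiberCross x _ _
      simp only [fiberCross, map_smul, cross7_smul_right])
  ip_comm r s := by ext x; exact hP.fiberForm_comm _ _
  ip_cross_left r s := by
    ext x
    obtain ⟨w, hw⟩ := hP.exists_frame x
    change hP.fiberForm x (hP.fiberCross x _ _) _ = 0
    rw [hP.fiberForm_eq hw, hP.symm_fiberCross hw, inner_cross7_left]
  ip_cross_right r s := by
    ext x
    obtain ⟨w, hw⟩ := hP.exists_frame x
    change hP.fiberForm x (hP.fiberCross x _ _) _ = 0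
    rw [hP.fiberForm_eq hw, hP.symm_fiberCross hw, inner_cross7_right]
  ip_cross_self r s := by
    rw [sq]
    ext x
    obtain ⟨w, hw⟩ := hP.exists_frame x
    change hP.fiberForm x (hP.fiberCross x (r x) (s x)) (hP.fiberCross x (r x) (s x)) =
      hP.fiberForm x (r x) (r x) * hP.fiberForm x (s x) (s x) -
      hP.fiberForm x (r x) (s x) * hP.fiberForm x (r x) (s x)
    simp only [hP.fiberForm_eq hw, hP.symm_fiberCross hw, inner_cross7_self, sq]

theorem ip_apply (r s : E.Sections) (x : M) :
    hP.vectorProduct.ip r s x = hP.fiberForm x (r x) (s x) := rfl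

theorem ip_cross_apply {x : M} {w : R7 ≃ₗ[ℝ] E.fiber x} (hw : (⟨x, w⟩ : E.Frame) ∈ P)
    (r s t : E.Sections) : hP.vectorProduct.ip (hP.vectorProduct.cross r s) t x =
      phi0 (w.symm (r x)) (w.symm (s x)) (w.symm (t x)) := by
  change hP.fiberForm x (hP.fiberCross x _ _) _ = _
  rw [hP.fiberForm_eq hw, hP.symm_fiberCross hw, inner_cross7]

section DualBasis

variable {k : ℕ} (t : Fin k → E.Sections)

/-- The operator `v ↦ ∑ ⟨v, tᵢ⟩ tᵢ` on a fibre. -/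
def gram (x : M) : E.fiber x →ₗ[ℝ] E.fiber x :=
  ∑ i, (hP.fiberForm x (t i x)).smulRight (t i x)

theorem gram_apply {x : M} (v : E.fiber x) :
    hP.gram t x v = ∑ i, hP.fiberForm x (t i x) v • t i x := by
  simp [gram]

theorem fiberForm_gram {x : M} (u v : E.fiber x) : hP.fiberForm x (hP.gram t x u) v =
    ∑ i, hP.fiberForm x (t i x) u * hP.fiberForm x (t i x) v := by
  simp [gram_apply]

variable {t} (ht : ∀ x, Submodule.span ℝ (Set.range fun i => t i x) = ⊤)

include ht

/-- ⟨Gv, v⟩ = ∑ ⟨tᵢ, v⟩², so a vector in the kernel is orthogonal to a spanning set. -/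
theorem gram_injective (x : M) : Function.Injective (hP.gram t x) := by
  refine (injective_iff_map_eq_zero _).2 fun v hv => hP.fiberForm_self_eq_zero ?_
  have h := hP.fiberForm_gram t v v
  rw [hv, map_zero, LinearMap.zero_apply, eq_comm,
    Finset.sum_eq_zero_iff_of_nonneg fun i _ => mul_self_nonneg _] at h
  have h2 : (⊤ : Submodule ℝ (E.fiber x)) ≤ LinearMap.ker (hP.fiberForm x v) := by
    rw [← ht x, Submodule.span_le]
    rintro _ ⟨i, rfl⟩
    exact (hP.fiberForm_comm _ _).trans (mul_self_eq_zero.1 (h i (Finset.mem_univ i)))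
  exact h2 Submodule.mem_top

/-- The inverse of the operator `v ↦ ∑ ⟨v, tᵢ⟩ tᵢ` preserves smoothness. -/
theorem exists_gram_eq (s : E.Sections) : ∃ y : E.Sections, ∀ x, hP.gram t x (y x) = s x := by
  have hfd (x : M) : FiniteDimensional ℝ (E.fiber x) :=
    .of_surjective (hP.exists_frame x).choose.toLinearMap (hP.exists_frame x).choose.surjective
  choose y hy using fun x => LinearMap.surjective_of_injective (hP.gram_injective ht x) (s x)
  refine ⟨⟨y, fun x => ?_⟩, hy⟩
  obtain ⟨U, hU, hx, σ, hσP, hσ⟩ := hP.exists_local_section x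
  refine contMDiffAt_of_frame_symm hU hσ hx ?_
  have hc (i : Fin k) := contMDiffAt_frame_symm hU hσ hx ((t i).contMDiff x)
  let B (z : M) : R7 →L[ℝ] R7 := ∑ i,
    (innerSL ℝ ((σ z).symm (t i z))).smulRight ((σ z).symm (t i z))
  have hB {z : M} (hz : z ∈ U) (v : R7) : B z v = (σ z).symm (hP.gram t z (σ z v)) := by
    simp [B, gram_apply, hP.fiberForm_eq (hσP z hz)]
  refine contMDiffAt_of_eventually_apply_eq (B := B) ?_
    (contMDiffAt_frame_symm hU hσ hx (s.contMDiff x)) ?_ ?_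
  · refine ContMDiffAt.sum fun i _ => ?_
    have h1 : ContDiff ℝ ∞ fun a : R7 => (innerSL ℝ a).smulRight a :=
      (innerSL ℝ (E := R7)).contDiff.smulRight contDiff_id
    exact h1.contMDiff.contMDiffAt.comp x (hc i)
  · filter_upwards [hU.mem_nhds hx] with z hz
    rw [hB hz, LinearEquiv.apply_symm_apply, hy]
  · rw [show ⇑(B x) = _ from funext (hB hx)]
    exact (σ x).symm.injective.comp ((hP.gram_injective ht x).comp (σ x).injective)

/-- Take yᵢ = G⁻¹tᵢ. Then r = G(G⁻¹r) = ∑ ⟨tᵢ, G⁻¹r⟩ tᵢ, and the symmetry of G moves the inverse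
onto tᵢ. -/
theorem exists_dual_sections : ∃ y : Fin k → E.Sections,
    ∀ r : E.Sections, r = ∑ i, hP.vectorProduct.ip r (y i) • t i := by
  choose y hy using fun i => hP.exists_gram_eq ht (t i)
  refine ⟨y, fun r => ?_⟩
  obtain ⟨v, hv⟩ := hP.exists_gram_eq ht r
  ext1 x
  rw [sum_apply]
  conv_lhs => rw [← hv, gram_apply]
  refine Finset.sum_congr rfl fun i _ => ?_
  rw [smul_apply, ip_apply, ← hv x, fiberForm_gram, ← hy i x, hP.fiberForm_gram]
  simp only [mul_comm]

end DualBasis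

end IsG2Reduction

end Rank7Bundle

end

section

open Filter Topology

/-! ### The octonion algebra of a formal `G₂`-structure -/

/-- The dimension of a base change, computed from an orthonormal family that separates elements
modulo the kernel of a bilinear form with a finite dual basis. -/
theorem finrank_tensorProduct_of_orthonormal {R V K ι : Type*} [CommRing R] [AddCommGroup V]
    [Module R V] [Field K] [Algebra R K] [Fintype ι] [DecidableEq ι]
    (hK : Function.Surjective (algebraMap R K)) (B : LinearMap.BilinForm R V) {k : ℕ}
    {t y : Fin k → V} (hty : ∀ x, x = ∑ i, B x (y i) • t i) (s : ι → V)
    (hs : ∀ i j, algebraMap R K (B (s i) (s j)) = if i = j then 1 else 0)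
    (hsep : ∀ x, (∀ j, algebraMap R K (B x (s j)) = 0) → ∀ z, algebraMap R K (B x z) = 0) :
    Module.finrank K (K ⊗[R] V) = Fintype.card ι := by
  have h0 {x : V} (hx : ∀ z, algebraMap R K (B x z) = 0) : (1 : K) ⊗ₜ[R] x = 0 := by
    rw [hty x, TensorProduct.tmul_sum]
    refine Finset.sum_eq_zero fun i _ => ?_
    rw [← TensorProduct.smul_tmul, Algebra.smul_def, hx, zero_mul, TensorProduct.zero_tmul]
  have hsmul (f : R) (x : V) : (1 : K) ⊗ₜ[R] (f • x) = algebraMap R K f • ((1 : K) ⊗ₜ[R] x) := by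
    rw [← TensorProduct.smul_tmul, Algebra.smul_def, TensorProduct.smul_tmul', smul_eq_mul]
  let Λ : (ι → K) →ₗ[K] K ⊗[R] V := Fintype.linearCombination K fun j => (1 : K) ⊗ₜ[R] s j
  have hΛ : Function.Bijective Λ := by
    constructor
    · refine (injective_iff_map_eq_zero _).2 fun c hc => ?_
      ext j
      have h1 := congrArg (fun z => B.baseChange K z ((1 : K) ⊗ₜ[R] s j)) hc
      simpa [Λ, Fintype.linearCombination_apply, LinearMap.BilinForm.baseChange_tmul, hs,
        Algebra.smul_def] using h1
    · have hx (x : V) : (1 : K) ⊗ₜ[R] x = Λ fun j => algebraMap R K (B x (s j)) := by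
        rw [← sub_eq_zero]
        have h1 : (1 : K) ⊗ₜ[R] (x - ∑ j, B x (s j) • s j) = 0 := by
          refine h0 (hsep _ fun i => ?_)
          simp [hs]
        rw [TensorProduct.tmul_sub, TensorProduct.tmul_sum] at h1
        simpa only [Λ, Fintype.linearCombination_apply, hsmul] using h1
      intro z
      obtain ⟨x, rfl⟩ := TensorProduct.mk_surjective R V K hK z
      exact ⟨_, (hx x).symm⟩
  rw [← (LinearEquiv.ofBijective Λ hΛ).finrank_eq, Module.finrank_fintype_fun_eq_card]

/-- The rank of a finite projective module over a ring with connected spectrum, computed at one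
field-valued point. -/
theorem rankAtStalk_eq_of_finrank_eq {R V K : Type*} [CommRing R] [AddCommGroup V] [Module R V]
    [PreconnectedSpace (PrimeSpectrum R)] [Module.Finite R V] [Module.Projective R V] [Field K]
    [Algebra R K] (p : PrimeSpectrum R) :
    Module.rankAtStalk (R := R) V p = Module.finrank K (K ⊗[R] V) := by
  have : Module.FinitePresentation R V := Module.finitePresentation_of_projective R V
  have h1 := Module.rankAtStalk_baseChange (R := R) (M := V) (⊥ : PrimeSpectrum K)
  rw [Module.rankAtStalk_eq_finrank_of_free] at h1
  rw [(Module.isLocallyConstant_rankAtStalk (R := R) (M := V)).apply_eq_of_preconnectedSpace p,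
    ← h1]
  rfl

/-! ### The spectrum of the ring of smooth functions, rank and non-splitness -/

section SmoothFun

variable {n : ℕ} {M : Type u} [TopologicalSpace M] [ChartedSpace (EuclideanSpace ℝ (Fin n)) M]

namespace SmoothFun

/-- The spectrum of the ring of smooth functions on a connected manifold is connected. -/
theorem preconnectedSpace_primeSpectrum [PreconnectedSpace M] :
    PreconnectedSpace (PrimeSpectrum (SmoothFun n M)) := by
  refine preconnectedSpace_iff_clopen.2 fun s hs => ?_
  -- Clopen sets of the spectrum are cut out by idempotents, and a smooth idempotent is a continuous
  -- function with values 0 and 1.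
  obtain ⟨e, he, rfl⟩ := PrimeSpectrum.exists_idempotent_basicOpen_eq_of_isClopen hs
  have h01 (x : M) : e x = 0 ∨ e x = 1 := by
    have h : e x * e x = e x := DFunLike.congr_fun he x
    rcases mul_eq_zero.1 (show e x * (e x - 1) = 0 by linear_combination h) with h | h
    · exact .inl h
    · exact .inr (sub_eq_zero.1 h)
  have hcont : Continuous e := e.contMDiff.continuous
  have hc : IsClopen (e ⁻¹' {0}) := by
    refine ⟨isClosed_singleton.preimage hcont, ?_⟩
    have : e ⁻¹' {0} = e ⁻¹' Set.Iio (1 / 2) := by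
      ext x
      rcases h01 x with h | h <;> (simp [h]; try norm_num)
    rw [this]
    exact isOpen_Iio.preimage hcont
  rcases isClopen_iff.1 hc with h | h
  · right
    have : e = 1 := by
      ext x
      refine (h01 x).resolve_left fun hx => ?_
      have : x ∈ e ⁻¹' {0} := hx
      rw [h] at this
      exact this
    simp [this]
  · left
    have : e = 0 := by
      ext x
      have : x ∈ e ⁻¹' {0} := h ▸ Set.mem_univ x
      exact this
    simp [this]

/-- A nowhere vanishing smooth function is a unit. -/
theorem isUnit_of_ne_zero {f : SmoothFun n M} (hf : ∀ x, f x ≠ 0) : IsUnit f :=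
  IsUnit.of_mul_eq_one ⟨fun x => (f x)⁻¹, fun x => (f.contMDiff x).inv₀ (hf x)⟩
    (by ext x; exact mul_inv_cancel₀ (hf x))

/-- Maximal ideals of the ring of smooth functions are convex. -/
theorem mem_of_sq_le {m : Ideal (SmoothFun n M)} [hm : m.IsMaximal] {f g : SmoothFun n M}
    (hg : g ∈ m) (hfg : ∀ x, f x ^ 2 ≤ g x) : f ∈ m := by
  by_contra hf
  obtain ⟨a, i, hi, ha⟩ := hm.exists_inv hf
  -- With af + i = 1, this element of m is at least (af)² + i² > 0 everywhere, so it would be a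
  -- unit.
  have hmem : a * a * g + i * i ∈ m := m.add_mem (m.mul_mem_left _ hg) (m.mul_mem_left _ hi)
  refine hm.ne_top (Ideal.eq_top_of_isUnit_mem _ hmem (isUnit_of_ne_zero fun x => ne_of_gt ?_))
  have h1 : a x * f x + i x = 1 := DFunLike.congr_fun ha x
  change 0 < a x * a x * g x + i x * i x
  have h2 := mul_le_mul_of_nonneg_left (hfg x) (mul_self_nonneg (a x))
  nlinarith [sq_nonneg (a x * f x - i x)]

theorem ofNat_apply (k : ℕ) [k.AtLeastTwo] (x : M) :
    (OfNat.ofNat k : SmoothFun n M) x = OfNat.ofNat k :=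
  map_ofNat (ContMDiffMap.evalRingHom x : SmoothFun n M →+* ℝ) k

theorem isUnit_two : IsUnit (2 : SmoothFun n M) :=
  isUnit_of_ne_zero fun x => by rw [ofNat_apply]; exact two_ne_zero

end SmoothFun

/-- An octonion algebra over the ring of smooth functions with a positive semidefinite norm is
globally non-split. -/
theorem OctonionAlgebra.isGloballyNonsplit_of_sq_le {C : OctonionAlgebra.{u, v} (SmoothFun n M)}
    (hC : ∀ x z (p : M), C.bilin x z p ^ 2 ≤ 4 * C.norm x p * C.norm z p) :
    C.IsGloballyNonsplit := by
  intro m hm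
  have hz (x : C.carrier) (hx : C.norm x ∈ m) : (1 : m.ResidueField) ⊗ₜ[SmoothFun n M] x = 0 := by
    rw [one_tmul_eq_zero_iff]
    intro z
    rw [Ideal.algebraMap_residueField_eq_zero]
    exact SmoothFun.mem_of_sq_le (g := 4 * C.norm x * C.norm z)
      (m.mul_mem_right _ (m.mul_mem_left _ hx)) fun p => (hC x z p).trans_eq <| by
        rw [← SmoothFun.ofNat_apply (n := n) 4 p]; rfl
  have hsurj := TensorProduct.mk_surjective (SmoothFun n M) C.carrier m.ResidueField
    m.algebraMap_residueField_surjective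
  refine ⟨fun {a b} hab => ?_⟩
  obtain ⟨x, rfl⟩ := hsurj a
  obtain ⟨z, rfl⟩ := hsurj b
  change (1 ⊗ₜ x) * (1 ⊗ₜ z) = (0 : m.ResidueField ⊗[SmoothFun n M] C.carrier) at hab
  rw [Algebra.TensorProduct.tmul_mul_tmul, one_mul, one_tmul_eq_zero_iff] at hab
  -- The product is paired with itself: b(xz, xz) = 2q(x)q(z) lies in m, so one of the two norms
  -- does.
  have h := hab (x * z)
  rw [Ideal.algebraMap_residueField_eq_zero, bilin_self, C.norm_mul] at h
  have h2 : (2 : SmoothFun n M) ∉ m := fun h2 =>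
    hm.ne_top (Ideal.eq_top_of_isUnit_mem _ h2 SmoothFun.isUnit_two)
  rcases hm.isPrime.mem_or_mem ((hm.isPrime.mem_or_mem h).resolve_left h2) with h | h
  · exact .inl (hz x h)
  · exact .inr (hz z h)

namespace Rank7Bundle.IsG2Reduction

variable {E : Rank7Bundle n M} {P : Set E.Frame} (hP : E.IsG2Reduction P)

variable [IsManifold (𝓡 n) ∞ M] [T2Space M] [ConnectedSpace M]

/-- As the spectrum is connected, the rank may be computed at evaluation at one point, where global
sections extending an orthonormal frame give a basis. -/
theorem rankAtStalk_sections {k : ℕ} {t y : Fin k → E.Sections}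
    (hty : ∀ r : E.Sections, r = ∑ i, hP.vectorProduct.ip r (y i) • t i)
    (p : PrimeSpectrum (SmoothFun n M)) :
    Module.rankAtStalk (R := SmoothFun n M) E.Sections p = 7 := by
  have := hP.vectorProduct.projective_of_dual hty
  have := hP.vectorProduct.finite_of_dual hty
  have := SmoothFun.preconnectedSpace_primeSpectrum (n := n) (M := M)
  obtain ⟨x⟩ : Nonempty M := inferInstance
  let := OctonionAlgebra.evalAlgebra (n := n) x
  obtain ⟨w, hw⟩ := hP.exists_frame x
  choose s hs using fun j : Fin 7 => E.exists_section_eq (w (EuclideanSpace.single j 1))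
  have hip (r q : E.Sections) : algebraMap (SmoothFun n M) ℝ (hP.vectorProduct.ip r q) =
      inner ℝ (w.symm (r x)) (w.symm (q x)) := hP.fiberForm_eq hw _ _
  rw [rankAtStalk_eq_of_finrank_eq (K := ℝ),
    finrank_tensorProduct_of_orthonormal (K := ℝ) (OctonionAlgebra.evalRingHom_surjective x)
      hP.vectorProduct.ip hty s, Fintype.card_fin]
  · intro i j
    rw [hip, hs, hs]
    simp [EuclideanSpace.inner_single_left]
  · intro r hr z
    simp only [hip, hs] at hr ⊢
    have : w.symm (r x) = 0 := by
      ext j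
      simpa [EuclideanSpace.inner_single_right] using hr j
    rw [this, inner_zero_left]

end Rank7Bundle.IsG2Reduction

/-- Every formal `G₂`-structure comes from a globally non-split octonion algebra. -/
theorem Rank7Bundle.IsG2Reduction.exists_octonionAlgebra {E : Rank7Bundle n M} {P : Set E.Frame}
    (hP : E.IsG2Reduction P) [IsManifold (𝓡 n) ∞ M] [T2Space M] [SecondCountableTopology M]
    [ConnectedSpace M] :
    ∃ (C : OctonionAlgebra.{u, u} (SmoothFun n M)) (_ : C.IsGloballyNonsplit)
      (θ : C.imag ≃ₗ[SmoothFun n M] E.Sections), P = E.adaptedFrames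
        fun r s t => C.threeForm (θ.symm r) (θ.symm s) (θ.symm t) := by
  obtain ⟨k, t, ht⟩ := E.exists_finite_sections
  obtain ⟨y, hty⟩ := hP.exists_dual_sections ht
  set T := hP.vectorProduct with hT
  let C := T.octonionAlgebra SmoothFun.isUnit_two t y hty (hP.rankAtStalk_sections hty)
  have hb (a b : T.Carrier) : C.bilin a b = 2 * (a.1 * b.1 + T.ip a.2 b.2) :=
    T.octonionAlgebra_bilin _ _ _ _ _ a b
  have hq (a : T.Carrier) : C.norm a = a.1 * a.1 + T.ip a.2 a.2 := rfl
  have two_apply (x : M) : (2 : SmoothFun n M) x = 2 := SmoothFun.ofNat_apply 2 x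
  let val (a : C.imag) : T.Carrier := a.1
  have himag (a : C.imag) : (val a).1 = 0 := by
    have h : C.bilin (1 : T.Carrier) (val a) = 0 := a.2
    rw [hb] at h
    simpa [SmoothFun.isUnit_two.mul_right_eq_zero] using h
  let θ : C.imag ≃ₗ[SmoothFun n M] E.Sections :=
    { toFun a := (val a).2
      invFun r := ⟨T.pair 0 r, by
        change C.bilin (1 : T.Carrier) _ = 0
        rw [hb]; simp⟩
      map_add' _ _ := rfl
      map_smul' _ _ := rfl
      left_inv a := Subtype.ext (VectorProduct.Carrier.ext (T := T) (himag a).symm rfl)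
      right_inv _ := rfl }
  refine ⟨C, OctonionAlgebra.isGloballyNonsplit_of_sq_le fun (a b : T.Carrier) p => ?_, θ, ?_⟩
  · obtain ⟨w, hw⟩ := hP.exists_frame p
    rw [hb, hq, hq]
    change ((2 : SmoothFun n M) p * (a.1 p * b.1 p + hP.fiberForm p (a.2 p) (b.2 p))) ^ 2 ≤
      4 * (a.1 p * a.1 p + hP.fiberForm p (a.2 p) (a.2 p)) *
        (b.1 p * b.1 p + hP.fiberForm p (b.2 p) (b.2 p))
    simp only [hP.fiberForm_eq hw, two_apply]
    -- Cauchy–Schwarz on ℝ ⊕ ℝ⁷, assembled from Cauchy–Schwarz on ℝ⁷ and the mixed terms |r w - s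
    -- v|² ≥ 0.
    have h1 := real_inner_mul_inner_self_le (w.symm (a.2 p)) (w.symm (b.2 p))
    have h2 := real_inner_self_nonneg (x := a.1 p • w.symm (b.2 p) - b.1 p • w.symm (a.2 p))
    simp only [inner_sub_left, inner_sub_right, real_inner_smul_left, real_inner_smul_right,
      real_inner_comm (w.symm (a.2 p)) (w.symm (b.2 p))] at h2
    linarith
  · have hφ (r s q : E.Sections) : C.threeForm (θ.symm r) (θ.symm s) (θ.symm q) =
        T.ip (T.cross r s) q := by
      change (1 / 2 : ℝ) • C.bilin (T.pair 0 r * T.pair 0 s) (T.pair 0 q) = _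
      rw [hb]
      ext x
      simp [two_apply]
    ext ⟨x, w⟩
    obtain ⟨w₀, hw₀⟩ := hP.exists_frame x
    simp only [adaptedFrames, hφ, Set.mem_ofPred_eq]
    constructor
    · intro hw r s q
      exact hP.ip_cross_apply hw r s q
    · intro h
      -- A frame adapted to the form differs from a frame of P by an element of the stabilizer, and
      -- P is closed under G₂.
      have hg : w.trans w₀.symm ∈ G2 := fun a b c => by
        obtain ⟨r, hr⟩ := E.exists_section_eq (w a)
        obtain ⟨s, hs⟩ := E.exists_section_eq (w b)
        obtain ⟨q, hq⟩ := E.exists_section_eq (w c)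
        have h1 := h r s q
        rw [hP.ip_cross_apply hw₀, hr, hs, hq] at h1
        simpa using h1
      have h2 := hP.act_mem x w₀ hw₀ _ hg
      rwa [LinearEquiv.trans_assoc, LinearEquiv.symm_trans_self, LinearEquiv.trans_refl] at h2

end SmoothFun

end

/-! ### The equivalence -/

section Equivalence

variable {n : ℕ} {M : Type u} [TopologicalSpace M] [ChartedSpace (EuclideanSpace ℝ (Fin n)) M]

namespace OctonionAlgebra

theorem ip_one_mul {C : OctonionAlgebra.{u, v} (SmoothFun n M)} (a b : C.imag) :
    C.ip 1 (a * b : C.carrier) = -C.ip a b := by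
  have h := C.bilin_mul_mul 1 1 a b
  have ha : C.bilin 1 (a : C.carrier) = 0 := a.2
  rw [one_mul, one_mul, mul_one, ha, zero_mul, C.bilin_comm b] at h
  rw [ip, ip, eq_neg_of_add_eq_zero_left h, smul_neg]

theorem ip_imag_one {C : OctonionAlgebra.{u, v} (SmoothFun n M)} (a : C.imag) :
    C.ip (a : C.carrier) 1 = 0 := by rw [ip_comm, ip_one_imag]

theorem threeForm_eq_ip {C : OctonionAlgebra.{u, v} (SmoothFun n M)} (a b c : C.imag) :
    C.threeForm a b c = C.ip (a * b : C.carrier) c := rfl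

theorem ip_imagProjₗ {C : OctonionAlgebra.{u, v} (SmoothFun n M)} (x : C.carrier) (c : C.imag) :
    C.ip (C.imagProjₗ x : C.carrier) c = C.ip x c := by
  conv_rhs => rw [C.eq_ip_smul_add_imagProj x, ip_add_left, ip_smul_left, ip_one_imag, mul_zero,
    zero_add]

/-! ### Extending maps of imaginary elements to octonion algebras -/

section Extend

variable {C D : OctonionAlgebra.{u, v} (SmoothFun n M)} (h : C.imag ≃ₗ[SmoothFun n M] D.imag)

/-- The extension of a linear map of imaginary elements that carries the unit to the unit. -/
def extendImag (h : C.imag →ₗ[SmoothFun n M] D.imag) : C.carrier →ₗ[SmoothFun n M] D.carrier :=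
  ((1 / 2 : ℝ) • C.bilin 1).smulRight (1 : D.carrier) + D.imag.subtype ∘ₗ h ∘ₗ C.imagProjₗ

theorem extendImag_apply (h : C.imag →ₗ[SmoothFun n M] D.imag) (x : C.carrier) :
    extendImag h x = C.ip 1 x • 1 + h (C.imagProjₗ x) := rfl

theorem extendImag_add (h : C.imag →ₗ[SmoothFun n M] D.imag) (f : SmoothFun n M) (a : C.imag) :
    extendImag h (f • 1 + a) = f • 1 + h a := by
  rw [extendImag_apply, ip_add_right, ip_smul_right, ip_one_one, ip_one_imag, map_add, map_smul,
    imagProjₗ_one, imagProjₗ_coe, smul_zero, zero_add, mul_one, add_zero]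

theorem extendImag_comp (h : C.imag →ₗ[SmoothFun n M] D.imag)
    (h' : D.imag →ₗ[SmoothFun n M] C.imag) (hh : h ∘ₗ h' = LinearMap.id) :
    extendImag h ∘ₗ extendImag h' = LinearMap.id := by
  ext1 x
  rw [LinearMap.comp_apply, extendImag_apply h', extendImag_add]
  have := LinearMap.congr_fun hh (D.imagProjₗ x)
  rw [LinearMap.comp_apply] at this
  rw [this]
  exact (eq_ip_smul_add_imagProj x).symm

/-- A linear isomorphism of imaginary elements that is compatible with the bilinear form and with
the form `φ` extends to an isomorphism of octonion algebras. -/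
def homOfImag (hip : ∀ a b : C.imag, D.ip (h a : D.carrier) (h b) = C.ip (a : C.carrier) b)
    (hφ : ∀ a b c, D.threeForm (h a) (h b) (h c) = C.threeForm a b c) : Hom C D where
  toEquiv := LinearEquiv.ofLinearMap (extendImag h.toLinearMap) (extendImag h.symm.toLinearMap)
    (extendImag_comp _ _ (by ext1 x; exact h.apply_symm_apply x))
    (extendImag_comp _ _ (by ext1 x; exact h.symm_apply_apply x))
  map_mul x y := by
    -- The scalar part of a product of imaginary elements is -⟨a, b⟩, and its imaginary part is
    -- determined by pairing with imaginary elements, that is, by φ. Both are preserved by h.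
    have key (a b : C.imag) : (h a * h b : D.carrier) =
        (-C.ip a b) • 1 + h (C.imagProjₗ (a * b : C.carrier)) := by
      rw [eq_ip_smul_add_imagProj (h a * h b : D.carrier), ip_one_mul, hip]
      congr 2
      refine imag_ext fun c => ?_
      obtain ⟨c, rfl⟩ := h.surjective c
      rw [ip_imagProjₗ, ← threeForm_eq_ip, hφ, hip, ip_imagProjₗ, threeForm_eq_ip]
    change extendImag h.toLinearMap _ = extendImag h.toLinearMap _ * extendImag h.toLinearMap _
    rw [eq_ip_smul_add_imagProj x, eq_ip_smul_add_imagProj y]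
    set r := C.ip 1 x
    set s := C.ip 1 y
    set a := C.imagProjₗ x
    set b := C.imagProjₗ y
    have h1 : (r • (1 : C.carrier) + (a : C.carrier)) * (s • (1 : C.carrier) + b) =
        (r * s - C.ip a b) • (1 : C.carrier) +
          (r • b + s • a + C.imagProjₗ (a * b : C.carrier) : C.imag) := by
      have h2 := eq_ip_smul_add_imagProj (a * b : C.carrier)
      rw [ip_one_mul] at h2
      obtain ⟨c, hc⟩ : ∃ c, C.imagProjₗ (a * b : C.carrier) = c := ⟨_, rfl⟩
      rw [hc] at h2 ⊢
      rw [add_mul, mul_add, mul_add, h2]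
      simp only [smul_mul_assoc, mul_smul_comm, one_mul, mul_one, Submodule.coe_add,
        Submodule.coe_smul]
      module
    rw [h1, extendImag_add, extendImag_add, extendImag_add]
    rw [add_mul, mul_add, mul_add]
    simp only [LinearEquiv.coe_coe, key, map_add, map_smul, smul_mul_assoc, mul_smul_comm, one_mul,
      mul_one, Submodule.coe_add, Submodule.coe_smul]
    module
  map_one := by
    change extendImag h.toLinearMap 1 = 1
    rw [extendImag_apply, ip_one_one, imagProjₗ_one, map_zero, one_smul, ZeroMemClass.coe_zero,
      add_zero]
  map_bilin x y := by
    change D.bilin (extendImag h.toLinearMap x) (extendImag h.toLinearMap y) = _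
    rw [bilin_eq_two_smul_ip, bilin_eq_two_smul_ip, extendImag_apply, extendImag_apply]
    conv_rhs => rw [eq_ip_smul_add_imagProj x, eq_ip_smul_add_imagProj y]
    simp only [ip_add_left, ip_add_right, ip_smul_left, ip_smul_right, ip_one_one, ip_one_imag,
      ip_imag_one, LinearEquiv.coe_coe, hip]

theorem homOfImag_imag (hip : ∀ a b : C.imag, D.ip (h a : D.carrier) (h b) = C.ip (a : C.carrier) b)
    (hφ : ∀ a b c, D.threeForm (h a) (h b) (h c) = C.threeForm a b c) (a : C.imag) :
    (homOfImag h hip hφ).imag a = h a := by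
  refine Subtype.ext ?_
  change extendImag h.toLinearMap (a : C.carrier) = h a
  rw [extendImag_apply, ip_one_imag, zero_smul, zero_add, imagProjₗ_coe]
  rfl

end Extend

variable {C D : OctonionAlgebra.{u, v} (SmoothFun n M)}

theorem Hom.ip_map (f : Hom C D) (x y : C.carrier) :
    D.ip (f.toEquiv x) (f.toEquiv y) = C.ip x y := by
  rw [ip, ip, f.map_bilin]

theorem Hom.threeForm_map (f : Hom C D) (a b c : C.imag) :
    D.threeForm (f.imag a) (f.imag b) (f.imag c) = C.threeForm a b c := by
  rw [threeForm_eq_ip, threeForm_eq_ip, ← f.ip_map, f.map_mul]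
  rfl

/-- The restriction of a morphism to the imaginary elements is an isomorphism. -/
def Hom.imagEquiv (f : Hom C D) : C.imag ≃ₗ[SmoothFun n M] D.imag :=
  LinearEquiv.ofBijective f.imag
    ⟨fun _ _ h => Subtype.ext (f.toEquiv.injective (congrArg Subtype.val h)), fun d =>
      ⟨⟨f.toEquiv.symm d, by
        have h := f.map_bilin 1 (f.toEquiv.symm d)
        rw [f.map_one, f.toEquiv.apply_symm_apply] at h
        exact h.symm.trans d.2⟩, Subtype.ext (f.toEquiv.apply_symm_apply _)⟩⟩

theorem Hom.ext_imag {f g : Hom C D} (h : ∀ a, f.imag a = g.imag a) : f = g := by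
  refine Hom.ext (LinearEquiv.ext fun x => ?_)
  rw [eq_ip_smul_add_imagProj x, map_add, map_add, map_smul, map_smul, f.map_one, g.map_one]
  have h1 : f.toEquiv (C.imagProjₗ x : C.carrier) = g.toEquiv (C.imagProjₗ x : C.carrier) :=
    congrArg Subtype.val (h (C.imagProjₗ x))
  rw [h1]

end OctonionAlgebra

namespace Rank7Bundle

variable {E E' : Rank7Bundle n M}

/-- The inverse of an isomorphism of vector bundles. -/
def Iso.symm (g : Iso E E') : Iso E' E :=
  ⟨fun x => (g.toEquiv x).symm, g.smooth_symm, g.smooth_toEquiv⟩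

/-- The map of sections induced by an isomorphism of vector bundles. -/
def Iso.mapSections (g : Iso E E') : E.Sections ≃ₗ[SmoothFun n M] E'.Sections where
  toFun s := ⟨fun x => g.toEquiv x (s x), g.smooth_toEquiv.comp s.contMDiff⟩
  invFun s := ⟨fun x => (g.toEquiv x).symm (s x), g.smooth_symm.comp s.contMDiff⟩
  map_add' s t := ContMDiffSection.ext fun x => map_add (g.toEquiv x) (s x) (t x)
  map_smul' f s := ContMDiffSection.ext fun x => map_smul (g.toEquiv x) (f x) (s x)
  left_inv s := ContMDiffSection.ext fun x => (g.toEquiv x).symm_apply_apply (s x)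
  right_inv s := ContMDiffSection.ext fun x => (g.toEquiv x).apply_symm_apply (s x)

/-- Adapted frames are carried to adapted frames. -/
theorem adaptedFrames_eq_image (g : Iso E E') (F : E.Sections ≃ₗ[SmoothFun n M] E'.Sections)
    (hF : ∀ s x, g.toEquiv x (s x) = F s x)
    {φ : E.Sections → E.Sections → E.Sections → SmoothFun n M}
    {φ' : E'.Sections → E'.Sections → E'.Sections → SmoothFun n M}
    (hφ : ∀ r s t, φ' (F r) (F s) (F t) = φ r s t) :
    E'.adaptedFrames φ' = g.mapFrame '' E.adaptedFrames φ := by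
  have h (s : E.Sections) (x : M) (w : R7 ≃ₗ[ℝ] E.fiber x) :
      (w.trans (g.toEquiv x)).symm (F s x) = w.symm (s x) := by
    rw [← hF]; simp
  have h' (x : M) (w : R7 ≃ₗ[ℝ] E.fiber x) :
      (⟨x, w.trans (g.toEquiv x)⟩ : E'.Frame) ∈ E'.adaptedFrames φ' ↔
      (⟨x, w⟩ : E.Frame) ∈ E.adaptedFrames φ := by
    constructor
    · intro hw r s t
      rw [← hφ, hw, h, h, h]
    · intro hw r s t
      obtain ⟨r, rfl⟩ := F.surjective r
      obtain ⟨s, rfl⟩ := F.surjective s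
      obtain ⟨t, rfl⟩ := F.surjective t
      rw [hφ, hw, h, h, h]
  ext ⟨x, w⟩
  constructor
  · intro hw
    have e : (w.trans (g.toEquiv x).symm).trans (g.toEquiv x) = w := by ext v; simp
    refine ⟨⟨x, w.trans (g.toEquiv x).symm⟩, (h' x _).1 (e.symm ▸ hw), ?_⟩
    change (⟨x, (w.trans (g.toEquiv x).symm).trans (g.toEquiv x)⟩ : E'.Frame) = _
    rw [e]
  · rintro ⟨⟨y, w₀⟩, hw₀, he⟩
    exact he ▸ (h' y w₀).2 hw₀

end Rank7Bundle

namespace FormalG2Structure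

/-- A morphism of formal `G₂`-structures is an isomorphism. -/
def isoOfHom {P Q : FormalG2Structure n M} (f : P ⟶ Q) : P ≅ Q where
  hom := f
  inv := (⟨(Hom.toIso f).symm, by
    rw [Hom.map_frames f, Set.image_image]
    refine (Set.image_id' P.frames).symm.trans (Set.image_congr fun w _ => ?_)
    refine Sigma.ext rfl (heq_of_eq (LinearEquiv.ext fun v => ?_))
    exact (((Hom.toIso f).toEquiv w.1).symm_apply_apply _).symm⟩ : Hom Q P)
  hom_inv_id := Hom.ext (Rank7Bundle.Iso.ext (funext fun x => LinearEquiv.ext fun v =>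
    ((Hom.toIso f).toEquiv x).symm_apply_apply v))
  inv_hom_id := Hom.ext (Rank7Bundle.Iso.ext (funext fun x => LinearEquiv.ext fun v =>
    ((Hom.toIso f).toEquiv x).apply_symm_apply v))

end FormalG2Structure

/-! ### The functor to formal G₂-structures -/

namespace NonsplitOctonionAlgebra

variable [IsManifold (𝓡 n) ∞ M] [T2Space M]

section Objects

variable (C : NonsplitOctonionAlgebra.{u, v} (SmoothFun n M))

/-- The vector bundle of imaginary elements. -/
def bundle : Rank7Bundle n M := (OctonionAlgebra.exists_bundle C.property).choose

/-- The identification of the imaginary elements with the sections of their bundle. -/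
def sectionEquiv : C.obj.imag ≃ₗ[SmoothFun n M] (bundle C).Sections :=
  (OctonionAlgebra.exists_bundle C.property).choose_spec.choose

/-- The formal `G₂`-structure of a globally non-split octonion algebra. -/
def toG2Structure : FormalG2Structure n M where
  bundle := bundle C
  frames := (bundle C).adaptedFrames fun r s t =>
    C.obj.threeForm ((sectionEquiv C).symm r) ((sectionEquiv C).symm s) ((sectionEquiv C).symm t)
  isReduction := (OctonionAlgebra.exists_bundle C.property).choose_spec.choose_spec.1

theorem exists_isometric_frame (x : M) : ∃ w : R7 ≃ₗ[ℝ] (bundle C).fiber x,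
    (⟨x, w⟩ : (bundle C).Frame) ∈ (toG2Structure C).frames ∧
    ∀ a b : C.obj.imag, C.obj.ip a b x =
      inner ℝ (w.symm (sectionEquiv C a x)) (w.symm (sectionEquiv C b x)) :=
  (OctonionAlgebra.exists_bundle C.property).choose_spec.choose_spec.2 x

variable {C}

theorem threeForm_apply {x : M} {w : R7 ≃ₗ[ℝ] (bundle C).fiber x}
    (hw : (⟨x, w⟩ : (bundle C).Frame) ∈ (toG2Structure C).frames) (a b c : C.obj.imag) :
    C.obj.threeForm a b c x = phi0 (w.symm (sectionEquiv C a x)) (w.symm (sectionEquiv C b x))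
      (w.symm (sectionEquiv C c x)) := by
  have h := hw (sectionEquiv C a) (sectionEquiv C b) (sectionEquiv C c)
  simpa only [LinearEquiv.symm_apply_apply] using h

/-- One adapted frame at x is isometric by construction, and the others differ from it by G₂ ⊆ O(7).
Fullness needs this to carry the inner product along with φ. -/
theorem ip_apply {x : M} {w : R7 ≃ₗ[ℝ] (bundle C).fiber x}
    (hw : (⟨x, w⟩ : (bundle C).Frame) ∈ (toG2Structure C).frames) (a b : C.obj.imag) :
    C.obj.ip a b x = inner ℝ (w.symm (sectionEquiv C a x)) (w.symm (sectionEquiv C b x)) := by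
  obtain ⟨w₀, hw₀, h⟩ := exists_isometric_frame C x
  obtain ⟨g, hg, rfl⟩ := (toG2Structure C).isReduction.transitive x w₀ w hw₀ hw
  rw [h, ← G2.inner_map_map (inv_mem hg)]
  rfl

theorem exists_sectionEquiv_apply_eq {x : M} (v : (bundle C).fiber x) :
    ∃ a, sectionEquiv C a x = v := by
  obtain ⟨s, rfl⟩ := (bundle C).exists_section_eq v
  exact ⟨(sectionEquiv C).symm s, by rw [LinearEquiv.apply_symm_apply]⟩

end Objects

variable {C D : NonsplitOctonionAlgebra.{u, v} (SmoothFun n M)}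

/-- The isomorphism of formal `G₂`-structures attached to an isomorphism of octonion algebras. -/
def mapHom (f : C ⟶ D) : toG2Structure C ⟶ toG2Structure D :=
  let F := (sectionEquiv C).symm ≪≫ₗ OctonionAlgebra.Hom.imagEquiv f.hom ≪≫ₗ sectionEquiv D
  ({ toIso := Rank7Bundle.isoOfSections F
     map_frames := Rank7Bundle.adaptedFrames_eq_image _ F (Rank7Bundle.isoOfSections_apply F)
      fun r s t => by
        simp only [F, LinearEquiv.trans_apply, LinearEquiv.symm_apply_apply]
        exact OctonionAlgebra.Hom.threeForm_map f.hom _ _ _ } : FormalG2Structure.Hom _ _)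

theorem mapHom_apply (f : C ⟶ D) (a : C.obj.imag) (x : M) :
    (FormalG2Structure.Hom.toIso (mapHom f)).toEquiv x (sectionEquiv C a x) =
      sectionEquiv D (OctonionAlgebra.Hom.imag f.hom a) x := by
  refine (Rank7Bundle.isoOfSections_apply _ _ _).trans ?_
  change sectionEquiv D (OctonionAlgebra.Hom.imagEquiv f.hom
    ((sectionEquiv C).symm (sectionEquiv C a))) x = _
  rw [LinearEquiv.symm_apply_apply]
  rfl

theorem hom_ext {Q : FormalG2Structure n M} {f g : toG2Structure C ⟶ Q}
    (h : ∀ (a : C.obj.imag) (x : M),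
      (FormalG2Structure.Hom.toIso f).toEquiv x (sectionEquiv C a x) =
        (FormalG2Structure.Hom.toIso g).toEquiv x (sectionEquiv C a x)) : f = g := by
  refine FormalG2Structure.Hom.ext (Rank7Bundle.Iso.ext (funext fun x =>
    LinearEquiv.ext fun v => ?_))
  obtain ⟨a, rfl⟩ := exists_sectionEquiv_apply_eq v
  exact h a x

variable (n M) in
/-- The functor from globally non-split octonion algebras to formal `G₂`-structures. -/
def toG2StructureFunctor :
    NonsplitOctonionAlgebra.{u, v} (SmoothFun n M) ⥤ FormalG2Structure n M where
  obj := toG2Structure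
  map := mapHom
  map_id C := hom_ext fun a x => mapHom_apply _ _ _
  map_comp {C D D'} f g := hom_ext fun a x => by
    rw [mapHom_apply]
    change _ = (FormalG2Structure.Hom.toIso (mapHom g)).toEquiv x
      ((FormalG2Structure.Hom.toIso (mapHom f)).toEquiv x _)
    rw [mapHom_apply, mapHom_apply]
    rfl

instance : (toG2StructureFunctor.{u, v} n M).Faithful where
  map_injective {C D f g} h := by
    refine ObjectProperty.hom_ext _ (OctonionAlgebra.Hom.ext_imag fun a => ?_)
    refine (sectionEquiv D).injective (ContMDiffSection.ext fun x => ?_)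
    rw [← mapHom_apply, ← mapHom_apply]
    change mapHom f = mapHom g at h
    rw [h]

/-- A bundle map with P' = fP carries an adapted frame to an adapted frame. In such a pair of frames
both the inner products and the 3-forms are the standard ones, so `homOfImag` applies to the induced
map of sections. -/
instance : (toG2StructureFunctor.{u, v} n M).Full where
  map_surjective {C D} g := by
    let gi : Rank7Bundle.Iso (bundle C) (bundle D) := FormalG2Structure.Hom.toIso g
    let h := sectionEquiv C ≪≫ₗ gi.mapSections ≪≫ₗ (sectionEquiv D).symm
    have hh (a : C.obj.imag) (x : M) :
        sectionEquiv D (h a) x = gi.toEquiv x (sectionEquiv C a x) := by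
      simp only [h, LinearEquiv.trans_apply, LinearEquiv.apply_symm_apply]
      rfl
    have hframe (x : M) : ∃ w : R7 ≃ₗ[ℝ] (bundle C).fiber x,
        (⟨x, w⟩ : (bundle C).Frame) ∈ (toG2Structure C).frames ∧
        (⟨x, w.trans (gi.toEquiv x)⟩ : (bundle D).Frame) ∈ (toG2Structure D).frames := by
      obtain ⟨w, hw, -⟩ := exists_isometric_frame C x
      refine ⟨w, hw, ?_⟩
      have hm := FormalG2Structure.Hom.map_frames g
      exact hm.symm ▸ ⟨⟨x, w⟩, hw, rfl⟩
    have hs (x : M) (w : R7 ≃ₗ[ℝ] (bundle C).fiber x) (a : C.obj.imag) :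
        (w.trans (gi.toEquiv x)).symm (sectionEquiv D (h a) x) =
          w.symm (sectionEquiv C a x) := by
      rw [hh]; simp
    let f : OctonionAlgebra.Hom C.obj D.obj := OctonionAlgebra.homOfImag h
      (fun a b => by
        ext x
        obtain ⟨w, hw, hw'⟩ := hframe x
        rw [ip_apply hw, ip_apply hw', hs, hs])
      (fun a b c => by
        ext x
        obtain ⟨w, hw, hw'⟩ := hframe x
        rw [threeForm_apply hw, threeForm_apply hw', hs, hs, hs])
    refine ⟨⟨f⟩, hom_ext fun a x => (mapHom_apply _ _ _).trans ?_⟩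
    change sectionEquiv D (f.imag a) x = _
    rw [OctonionAlgebra.homOfImag_imag, hh]
    rfl

instance [SecondCountableTopology M] [ConnectedSpace M] :
    (toG2StructureFunctor.{u, u} n M).EssSurj where
  mem_essImage Q := by
    obtain ⟨C, hC, θ, hθ⟩ := Q.isReduction.exists_octonionAlgebra
    let C' : NonsplitOctonionAlgebra.{u, u} (SmoothFun n M) := ⟨C, hC⟩
    let F := (sectionEquiv C').symm ≪≫ₗ θ
    let f : FormalG2Structure.Hom (toG2Structure C') Q :=
      { toIso := Rank7Bundle.isoOfSections F
        map_frames := by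
          rw [hθ]
          refine Rank7Bundle.adaptedFrames_eq_image _ F (Rank7Bundle.isoOfSections_apply F)
            fun r s t => ?_
          simp only [F, LinearEquiv.trans_apply, LinearEquiv.symm_apply_apply]
          rfl }
    exact ⟨C', ⟨FormalG2Structure.isoOfHom f⟩⟩

end NonsplitOctonionAlgebra

end Equivalence

end

theorem mainTheorem5 (n : ℕ) (M : Type u) [TopologicalSpace M]
    [ChartedSpace (EuclideanSpace ℝ (Fin n)) M] [IsManifold (𝓡 n) ∞ M]
    [T2Space M] [SecondCountableTopology M] [ConnectedSpace M] :
    ∃ (Φ : NonsplitOctonionAlgebra.{u, u} (SmoothFun n M) ⥤ FormalG2Structure n M)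
      (θ : ∀ C : NonsplitOctonionAlgebra.{u, u} (SmoothFun n M),
        C.obj.imag ≃ₗ[SmoothFun n M] (Φ.obj C).bundle.Sections),
      Φ.IsEquivalence ∧
      (∀ C, (Φ.obj C).frames = (Φ.obj C).bundle.adaptedFrames
        (fun r s t => C.obj.threeForm ((θ C).symm r) ((θ C).symm s) ((θ C).symm t))) ∧
      (∀ (C D : NonsplitOctonionAlgebra.{u, u} (SmoothFun n M)) (f : C ⟶ D)
        (a : C.obj.imag) (x : M),
        θ D (OctonionAlgebra.Hom.imag f.hom a) x =
          (FormalG2Structure.Hom.toIso (Φ.map f)).toEquiv x (θ C a x)) := by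
  refine ⟨NonsplitOctonionAlgebra.toG2StructureFunctor n M, NonsplitOctonionAlgebra.sectionEquiv,
    -- The empty structure is filled by the instances for faithfulness, fullness and essential
    -- surjectivity.
    { }, fun _ => rfl, fun C D f a x => (NonsplitOctonionAlgebra.mapHom_apply f a x).symm⟩
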